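/- **Setting.** Let $(W,S)$ be a Coxeter system with $W$ finite, with length function $l$; let $\Gamma$ be an abelian group with a total order compatible with addition, and let $L\colon W\to\Gamma$ be a weight function ($L(ww')=L(w)+L(w')$ whenever $l(ww')=l(w)+l(w')$) with $L(s)>0$ for all $s\in S$. Let $R\subseteq\mathbb{C}$ be a subring with field of fractions $F$, let $A=R[\Gamma]$ be the group ring with $R$-basis $\{\varepsilon^g\mid g\in\Gamma\}$, and let $K$ be its field of fractions. Let $\mathbf{H}$ be the generic Iwahori–Hecke algebra over $A$, with $A$-basis $\{T_w\mid w\in W\}$ and, for $s\in S$, $v_s=\varepsilon^{L(s)}$: $T_sT_w=T_{sw}$ if $l(sw)>l(w)$, and $T_sT_w=T_{sw}+(v_s-v_s^{-1})T_w$ if $l(sw)<l(w)$. *Kazhdan–Lusztig basis.* Let $a\mapsto\bar a$ be the ring involution of $A$ with $\overline{\varepsilon^g}=\varepsilon^{-g}$, extended to $\mathbf{H}$ by $\overline{\sum a_wT_w}=\sum\bar a_wT_{w^{-1}}^{-1}$. Let $C'_w$ be the unique bar-invariant element of the form $T_w+\sum_y p_{y,w}T_y$ with all $p_{y,w}\in\mathbb{Z}[\Gamma_{<0}]$,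 and let $\mathbf{C}_w=(C'_w)^\dagger$, where $\dagger$ is the $A$-algebra automorphism with $T_s^\dagger=-T_s^{-1}$ $(s\in S)$. The $\mathbf{C}_w$ form an $A$-basis of $\mathbf{H}$; write $\mathbf{C}_x\mathbf{C}_y=\sum_z h_{x,y,z}\mathbf{C}_z$. Let $\leq_{\mathcal{LR}}$ be the reflexive and transitive closure of the relation "$\mathbf{C}_y$ occurs with non-zero coefficient in $\mathbf{C}_s\mathbf{C}_w$ or in $\mathbf{C}_w\mathbf{C}_s$ for some $s\in S$" between $y$ and $w$, and let $y\sim_{\mathcal{LR}}w$ mean $y\leq_{\mathcal{LR}}w$ and $w\leq_{\mathcal{LR}}y$. *Balanced representations.* Every $0\neq x\in K$ can be written $x=r_x\varepsilon^{g_x}(1+p)/(1+q)$ with $p,q\in F[\Gamma_{>0}]$ and unique $0\neq r_x\in F$, $g_x\in\Gamma$. Let $\mathcal{O}=\{0\}\cup\{x\neq 0\mid g_x\geq0\}$; the constant term of $x\in\mathcal{O}$ is $r_x$ if $x\ne0$ and $g_x=0$, and $0$ otherwise. Let $\{E^\lambda\mid\lambda\in\Lambda\}$ be the irreducible representations of $W$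 up to isomorphism, $d_\lambda=\dim E^\lambda$. For every $\lambda$ let $\rho^\lambda\colon K\otimes_A\mathbf{H}\to M_{d_\lambda}(K)$ be a matrix representation affording the representation $E^\lambda_\varepsilon$ that corresponds to $E^\lambda$, i.e. $\operatorname{trace}\rho^\lambda(T_w)\in A$ is mapped to $\operatorname{trace}(w,E^\lambda)$ by the ring homomorphism $A\to R$, $\varepsilon^g\mapsto1$, for all $w\in W$. Define $\mathbf{c}_\lambda$ by $d_\lambda\mathbf{c}_\lambda=\sum_w\operatorname{trace}\rho^\lambda(T_w)\operatorname{trace}\rho^\lambda(T_{w^{-1}})$, and $f_\lambda\in F$, $\mathbf{a}_\lambda\in\Gamma$ by $\mathbf{c}_\lambda=f_\lambda\varepsilon^{-2\mathbf{a}_\lambda}+{}$higher terms, $f_\lambda\neq0$. Assume that each $\rho^\lambda$ is balanced, i.e. $\varepsilon^{\mathbf{a}_\lambda}\rho^\lambda_{ij}(T_w)\in\mathcal{O}$ for all $w,i,j$, and let $c^{ij}_{w,\lambda}\in F$ be the constant term of $(-1)^{l(w)}\varepsilon^{\mathbf{a}_\lambda}\rho^\lambda_{ij}(T_w)$. Assume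 that $R$ is $L$-good: $2\cos(2\pi/m_{st})\in R$ for all $s,t\in S$, where $m_{st}$ is the order of $st$, and every $f_\lambda$ is contained and invertible in $R$. *The ring $\tilde{\mathbf{J}}$.* Put $\tilde\gamma_{x,y,z}=\sum_\lambda\sum_{i,j,k}f_\lambda^{-1}c^{ij}_{x,\lambda}c^{jk}_{y,\lambda}c^{ki}_{z,\lambda}$, $\tilde n_w=\sum_\lambda\sum_i f_\lambda^{-1}c^{ii}_{w^{-1},\lambda}$ and $\tilde{\mathcal{D}}=\{w\in W\mid\tilde n_w\neq0\}$. Let $\tilde{\mathbf{J}}$ be the $F$-algebra with basis $\{t_w\mid w\in W\}$, product $t_xt_y=\sum_z\tilde\gamma_{x,y,z^{-1}}t_z$ and identity element $\sum_{d\in\tilde{\mathcal{D}}}\tilde n_dt_d$. Let $\tilde{\mathbf{J}}_A\subseteq K\otimes_F\tilde{\mathbf{J}}$ be the $A$-span of the $t_w$, and let $h\in\mathbf{H}$ act on it by left multiplication transported via $\mathbf{C}_w\leftrightarrow t_w$, so that $\mathbf{C}_x.t_y=\sum_zh_{x,y,z}t_z$. **Theorem** (Lusztig). Assume that $\widetilde{\mathrm{P15}}$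 holds: if $x,x',y,w\in W$ and $w\sim_{\mathcal{LR}}y$, then $$\sum_{u\in W}\tilde\gamma_{w,x',u^{-1}}\,h_{x,u,y}=\sum_{u\in W}h_{x,w,u}\,\tilde\gamma_{u,x',y^{-1}}.$$ Then there is a unique unital $A$-algebra homomorphism $\phi\colon\mathbf{H}\to\tilde{\mathbf{J}}_A$ such that, for all $h\in\mathbf{H}$ and $w\in W$, the difference $\phi(h)t_w-h.t_w$ is an $A$-linear combination of terms $t_y$ with $y\leq_{\mathcal{LR}}w$ and $y\not\sim_{\mathcal{LR}}w$. Explicitly, $$\phi(\mathbf{C}_w)=\sum_{\substack{z\in W,\ d\in\tilde{\mathcal{D}}\\ z\sim_{\mathcal{LR}}d}}h_{w,d,z}\,\tilde n_d\,t_z\qquad(w\in W).$$ -/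

import Mathlib

noncomputable section

namespace KLAsym

open scoped Classical

section Exchange

theorem end_mul_apply {X : Type*} (f g : Function.End X) (p : X) : (f * g) p = f (g p) := rfl

variable {B W : Type*} [Group W] {M : CoxeterMatrix B} (cs : CoxeterSystem M W)

/-- The action of a simple reflection on pairs `(t, e)`. -/
def signedConj (i : B) : Function.End (W × ZMod 2) := fun p =>
  (cs.simple i * p.1 * cs.simple i, p.2 + if p.1 = cs.simple i then 1 else 0)

theorem signedConj_pow (i i' : B) (k : ℕ) (p : W × ZMod 2) :
    ((signedConj cs i * signedConj cs i') ^ k) p =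
      ((cs.simple i * cs.simple i') ^ k * p.1 * ((cs.simple i * cs.simple i') ^ k)⁻¹,
        p.2 + ∑ j ∈ Finset.range (2 * k),
          if p.1 = ((cs.simple i * cs.simple i') ^ j)⁻¹ * cs.simple i' then (1 : ZMod 2) else 0) := by
  set a := cs.simple i with ha
  set b := cs.simple i' with hb
  have haa : a * a = 1 := cs.simple_mul_simple_self i
  have hbb : b * b = 1 := cs.simple_mul_simple_self i'
  have ha' : a⁻¹ = a := inv_eq_of_mul_eq_one_left haa
  have hb' : b⁻¹ = b := inv_eq_of_mul_eq_one_left hbb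
  have hcomm : ∀ k : ℕ, b * (a * b) ^ k = ((a * b) ^ k)⁻¹ * b := by
    intro k
    induction k with
    | zero => simp
    | succ k ih =>
      rw [pow_succ, ← mul_assoc, ih, ← pow_succ, pow_succ', mul_inv_rev, mul_inv_rev, ha', hb']
      simp only [mul_assoc]
  induction k with
  | zero => simp [Function.End.one_def]
  | succ k ih =>
    rw [pow_succ', end_mul_apply, ih, end_mul_apply]
    simp only [signedConj, ← ha, ← hb]
    set r := a * b with hr
    have hrinv : r⁻¹ = b * a := by rw [hr, mul_inv_rev, ha', hb']
    refine Prod.ext ?_ ?_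
    · simp only [pow_succ', mul_inv_rev, hrinv]
      simp only [hr, mul_assoc]
    · have e1 : (r ^ k * p.1 * (r ^ k)⁻¹ = b) ↔ p.1 = (r ^ (2 * k))⁻¹ * b := by
        rw [mul_inv_eq_iff_eq_mul, hcomm, ← eq_inv_mul_iff_mul_eq, ← mul_assoc, ← mul_inv_rev,
          ← pow_add, two_mul]
      have e2 : (b * (r ^ k * p.1 * (r ^ k)⁻¹) * b = a) ↔
          p.1 = (r ^ (2 * k + 1))⁻¹ * b := by
        have : (b * (r ^ k * p.1 * (r ^ k)⁻¹) * b = a) ↔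
            (r ^ k * p.1 * (r ^ k)⁻¹ = r⁻¹ * b) := by
          constructor
          · intro h
            rw [hrinv, ← h]
            simp only [mul_assoc, hbb, mul_one]
            rw [← mul_assoc b b, hbb, one_mul]
          · intro h
            rw [h, hrinv]
            simp only [mul_assoc, hbb, mul_one]
            rw [← mul_assoc b b, hbb, one_mul]
        rw [this, mul_inv_eq_iff_eq_mul, mul_assoc, hcomm, ← eq_inv_mul_iff_mul_eq,
          ← mul_assoc, ← mul_assoc]
        congr! 2
        rw [← mul_inv_rev, ← mul_inv_rev]
        congr 1
        rw [← pow_succ', ← pow_add]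
        congr 1
        ring
      rw [show 2 * (k + 1) = 2 * k + 1 + 1 by ring, Finset.sum_range_succ, Finset.sum_range_succ]
      simp only [e1, e2, add_assoc]

theorem signedConj_liftable : M.IsLiftable (signedConj cs) := by
  intro i i'
  funext p
  rw [signedConj_pow, cs.simple_mul_simple_pow]
  rw [two_mul, Finset.sum_range_add]
  have : ∀ j, (cs.simple i * cs.simple i') ^ (M i i' + j) = (cs.simple i * cs.simple i') ^ j := by
    intro j
    rw [pow_add, cs.simple_mul_simple_pow, one_mul]
  simp only [this]
  rw [CharTwo.add_self_eq_zero]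
  simp [Function.End.one_def]

theorem signedConj_wordProd (ω : List B) (p : W × ZMod 2) :
    cs.lift ⟨signedConj cs, signedConj_liftable cs⟩ (cs.wordProd ω) p =
      (cs.wordProd ω * p.1 * (cs.wordProd ω)⁻¹, p.2 + ((cs.rightInvSeq ω).count p.1 : ℕ)) := by
  induction ω with
  | nil => simp [Function.End.one_def]
  | cons i ω ih =>
    rw [cs.wordProd_cons, map_mul, end_mul_apply, ih,
      cs.lift_apply_simple]
    simp only [signedConj, CoxeterSystem.rightInvSeq, List.count_cons, beq_iff_eq]
    refine Prod.ext (by simp [mul_assoc]) ?_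
    have : (cs.wordProd ω * p.1 * (cs.wordProd ω)⁻¹ = cs.simple i) ↔
        ((cs.wordProd ω)⁻¹ * cs.simple i * cs.wordProd ω = p.1) := by
      rw [mul_inv_eq_iff_eq_mul, mul_assoc, inv_mul_eq_iff_eq_mul, eq_comm]
    simp only [this]
    push_cast
    rw [add_assoc]

/-- If `s w` and `w t` are both longer than `w`, but `s w t` is not longer than them,
then `s w = w t`. -/
theorem simple_mul_eq_mul_simple {w : W} {i j : B}
    (h1 : cs.length w < cs.length (w * cs.simple j))
    (h2 : cs.length (cs.simple i * w * cs.simple j) < cs.length (cs.simple i * w)) :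
    cs.simple i * w = w * cs.simple j := by
  set Φ := cs.lift ⟨signedConj cs, signedConj_liftable cs⟩ with hΦ
  -- the sign is trivial when `t` is not a right descent
  have key : ∀ v : W, cs.length v < cs.length (v * cs.simple j) →
      ∀ e : ZMod 2, (Φ v (cs.simple j, e)).2 = e := by
    intro v hv e
    obtain ⟨ω, hω, rfl⟩ := cs.exists_isReduced v
    rw [hΦ, signedConj_wordProd]
    have : cs.simple j ∉ cs.rightInvSeq ω := fun hm =>
      absurd (cs.isRightInversion_of_mem_rightInvSeq hω hm).2 (by omega)
    simp [List.count_eq_zero.2 this]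
  have hsimp : ∀ (i : B) (p : W × ZMod 2), Φ (cs.simple i) p = signedConj cs i p := by
    intro i p
    rw [hΦ, cs.lift_apply_simple]
  have hA : (Φ (cs.simple i * w) (cs.simple j, 0)).2 = 1 := by
    have h3 : cs.simple i * w = (cs.simple i * w * cs.simple j) * cs.simple j := by simp
    rw [h3, map_mul, end_mul_apply, hsimp]
    have : signedConj cs j (cs.simple j, 0) = (cs.simple j, 1) := by simp [signedConj]
    rw [this]
    exact key _ (by simpa using h2) 1
  rw [map_mul, end_mul_apply, hsimp] at hA
  have h4 : Φ w (cs.simple j, 0) = (w * cs.simple j * w⁻¹, 0) := by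
    refine Prod.ext ?_ (key w h1 0)
    obtain ⟨ω, hω, rfl⟩ := cs.exists_isReduced w
    rw [hΦ, signedConj_wordProd]
  rw [h4] at hA
  simp only [signedConj, zero_add] at hA
  split_ifs at hA with h5
  · rw [← h5]; simp
  · simp at hA

end Exchange

/-- A weight function `L : W → Γ` on a Coxeter group: `L (w w') = L w + L w'` whenever
`ℓ (w w') = ℓ w + ℓ w'`. -/
structure WeightFunction {B W : Type*} [Group W] {M : CoxeterMatrix B} (cs : CoxeterSystem M W)
    (Γ : Type*) [AddCommGroup Γ] where
  toFun : W → Γ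
  map_mul' : ∀ w w' : W, cs.length (w * w') = cs.length w + cs.length w' →
    toFun (w * w') = toFun w + toFun w'

instance {B W : Type*} [Group W] {M : CoxeterMatrix B} (cs : CoxeterSystem M W)
    (Γ : Type*) [AddCommGroup Γ] : CoeFun (WeightFunction cs Γ) (fun _ => W → Γ) :=
  ⟨WeightFunction.toFun⟩

section HeckeAlgebra

variable {B W Γ : Type*} [Group W] {M : CoxeterMatrix B} {cs : CoxeterSystem M W}
  [AddCommGroup Γ] (R : Type*) [CommRing R] (L : WeightFunction cs Γ)

/-- The element `ε^g` of `R[Γ]`. -/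
def eps (g : Γ) : AddMonoidAlgebra R Γ := AddMonoidAlgebra.single g 1

/-- `v_s - v_s⁻¹`, where `v_s = ε^{L(s)}`. -/
def xi (i : B) : AddMonoidAlgebra R Γ := eps R (L (cs.simple i)) - eps R (-L (cs.simple i))

/-- Left multiplication by `T_s` on the free module with basis `W`:
`T_w ↦ T_{sw}` if `ℓ(sw) > ℓ(w)`, and `T_w ↦ T_{sw} + (v_s - v_s⁻¹) T_w` otherwise. -/
def leftOp (i : B) : Module.End (AddMonoidAlgebra R Γ) (W →₀ AddMonoidAlgebra R Γ) :=
  Finsupp.linearCombination (AddMonoidAlgebra R Γ) fun w =>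
    if cs.length w < cs.length (cs.simple i * w) then Finsupp.single (cs.simple i * w) 1
    else Finsupp.single (cs.simple i * w) 1 + xi R L i • Finsupp.single w 1

/-- Right multiplication by `T_s` on the free module with basis `W`. -/
def rightOp (j : B) : Module.End (AddMonoidAlgebra R Γ) (W →₀ AddMonoidAlgebra R Γ) :=
  Finsupp.linearCombination (AddMonoidAlgebra R Γ) fun w =>
    if cs.length w < cs.length (w * cs.simple j) then Finsupp.single (w * cs.simple j) 1
    else Finsupp.single (w * cs.simple j) 1 + xi R L j • Finsupp.single w 1

/-- The generic Iwahori-Hecke algebra over `R[Γ]` attached to the weight function `L`, realised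
through its left regular representation. It is free with basis `heckeT`, whose multiplication rule
is `heckeT_simple_mul`. -/
def Hecke : Type _ :=
  Algebra.adjoin (AddMonoidAlgebra R Γ) (Set.range (leftOp R L))

instance : Ring (Hecke R L) := inferInstanceAs (Ring (Subalgebra.toSubring
  (R := AddMonoidAlgebra R Γ) (A := Module.End (AddMonoidAlgebra R Γ) (W →₀ AddMonoidAlgebra R Γ))
  (Algebra.adjoin (AddMonoidAlgebra R Γ) (Set.range (leftOp R L)))))

instance : Algebra (AddMonoidAlgebra R Γ) (Hecke R L) :=
  inferInstanceAs (Algebra (AddMonoidAlgebra R Γ)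
    (Algebra.adjoin (AddMonoidAlgebra R Γ) (Set.range (leftOp R L))))

/-- The generator `T_s`. -/
def heckeGen (i : B) : Hecke R L :=
  ⟨leftOp R L i, Algebra.subset_adjoin (Set.mem_range_self i)⟩

theorem leftOp_single (i : B) (w : W) :
    leftOp R L i (Finsupp.single w 1) =
      if cs.length w < cs.length (cs.simple i * w) then Finsupp.single (cs.simple i * w) 1
      else Finsupp.single (cs.simple i * w) 1 + xi R L i • Finsupp.single w 1 := by
  simp [leftOp, Finsupp.linearCombination_single]

theorem rightOp_single (j : B) (w : W) :
    rightOp R L j (Finsupp.single w 1) =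
      if cs.length w < cs.length (w * cs.simple j) then Finsupp.single (w * cs.simple j) 1
      else Finsupp.single (w * cs.simple j) 1 + xi R L j • Finsupp.single w 1 := by
  simp [rightOp, Finsupp.linearCombination_single]

theorem xi_eq {w : W} {i j : B} (h : cs.simple i * w = w * cs.simple j)
    (hl : cs.length w < cs.length (cs.simple i * w)) : xi R L i = xi R L j := by
  have h1 := L.map_mul' (cs.simple i) w (by
    rcases cs.length_simple_mul w i with h' | h' <;> simp <;> omega)
  have h2 := L.map_mul' w (cs.simple j) (by
    rw [← h]
    rcases cs.length_simple_mul w i with h' | h' <;> simp <;> omega)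
  have : L (cs.simple i) = L (cs.simple j) := by
    have h3 : L.toFun (cs.simple i) + L.toFun w = L.toFun w + L.toFun (cs.simple j) := by
      rw [← h1, ← h2, h]
    rw [add_comm] at h3
    exact add_left_cancel h3
  simp only [xi, this]

theorem leftOp_rightOp (i j : B) (x : W →₀ AddMonoidAlgebra R Γ) :
    leftOp R L i (rightOp R L j x) = rightOp R L j (leftOp R L i x) := by
  suffices h : leftOp R L i ∘ₗ rightOp R L j = rightOp R L j ∘ₗ leftOp R L i from
    LinearMap.congr_fun h x
  refine Finsupp.lhom_ext' fun w => LinearMap.ext_ring ?_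
  simp only [LinearMap.comp_apply, Finsupp.lsingle_apply]
  have hr1 := cs.length_simple_mul (w * cs.simple j) i
  have hr2 := cs.length_mul_simple (cs.simple i * w) j
  rw [← mul_assoc] at hr1
  have hpos : ∀ {b c : ℕ}, b < c → ¬ c < b := fun h => by omega
  rcases cs.length_simple_mul w i with hi | hi <;>
  rcases cs.length_mul_simple w j with hj | hj
  · -- both `s w` and `w t` are longer
    have ci : cs.length w < cs.length (cs.simple i * w) := by omega
    have cj : cs.length w < cs.length (w * cs.simple j) := by omega
    rw [rightOp_single, leftOp_single, if_pos ci, if_pos cj, leftOp_single, rightOp_single,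
      ← mul_assoc]
    by_cases hr : cs.length (cs.simple i * w) < cs.length (cs.simple i * w * cs.simple j)
    · rw [if_pos hr, if_pos (by omega)]
    · rw [if_neg hr, if_neg (by omega)]
      have h := simple_mul_eq_mul_simple cs cj (i := i) (by omega)
      rw [xi_eq R L h ci, h]
  · have ci : cs.length w < cs.length (cs.simple i * w) := by omega
    have cj : ¬ cs.length w < cs.length (w * cs.simple j) := by omega
    rw [rightOp_single, leftOp_single, if_pos ci, if_neg cj, map_add, map_smul, leftOp_single,
      leftOp_single, rightOp_single, if_pos ci, ← mul_assoc, if_pos (by omega),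
      if_neg (by omega)]
  · have ci : ¬ cs.length w < cs.length (cs.simple i * w) := by omega
    have cj : cs.length w < cs.length (w * cs.simple j) := by omega
    rw [rightOp_single, leftOp_single, if_neg ci, if_pos cj, map_add, map_smul, leftOp_single,
      rightOp_single, rightOp_single, if_pos cj, ← mul_assoc, if_neg (by omega),
      if_pos (by omega)]
  · have ci : ¬ cs.length w < cs.length (cs.simple i * w) := by omega
    have cj : ¬ cs.length w < cs.length (w * cs.simple j) := by omega
    rw [rightOp_single, leftOp_single, if_neg ci, if_neg cj, map_add, map_add, map_smul, map_smul,
      leftOp_single, leftOp_single, rightOp_single, rightOp_single, if_neg ci, if_neg cj,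
      ← mul_assoc]
    by_cases hr : cs.length (cs.simple i * w) < cs.length (cs.simple i * w * cs.simple j)
    · rw [if_pos hr, if_pos (by omega)]
      have h := simple_mul_eq_mul_simple cs (w := cs.simple i * w) (i := i) hr (by
        rw [cs.simple_mul_simple_cancel_left]; omega)
      have hx := xi_eq R L h (by rw [cs.simple_mul_simple_cancel_left]; omega)
      rw [cs.simple_mul_simple_cancel_left] at h
      have h' : w * cs.simple j = cs.simple i * w := by
        conv_lhs => rw [h]
        rw [cs.simple_mul_simple_cancel_right]
      rw [hx, h']
    · rw [if_neg hr, if_neg (by omega)]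
      simp only [smul_add, smul_smul]
      rw [mul_comm (xi R L i)]
      abel

theorem hecke_rightOp (h : Hecke R L) (j : B) (x : W →₀ AddMonoidAlgebra R Γ) :
    h.1 (rightOp R L j x) = rightOp R L j (h.1 x) := by
  obtain ⟨f, hf⟩ := h
  suffices hh : Commute (rightOp R L j) f from (LinearMap.congr_fun hh x).symm
  refine Algebra.adjoin_induction (fun y hy => ?_) (fun a => ?_) (fun _ _ _ _ => Commute.add_right)
    (fun _ _ _ _ => Commute.mul_right) hf
  · obtain ⟨i, rfl⟩ := hy
    exact LinearMap.ext fun x => (leftOp_rightOp R L i j x).symm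
  · exact Algebra.commute_algebraMap_right a _

/-- Evaluation of operators at the basis vector of the identity. -/
def heckeEval : Hecke R L →ₗ[AddMonoidAlgebra R Γ] (W →₀ AddMonoidAlgebra R Γ) :=
  (LinearMap.applyₗ (Finsupp.single (1 : W) (1 : AddMonoidAlgebra R Γ))) ∘ₗ
    (Algebra.adjoin (AddMonoidAlgebra R Γ) (Set.range (leftOp R L))).val.toLinearMap

theorem heckeEval_apply (h : Hecke R L) : heckeEval R L h = h.1 (Finsupp.single 1 1) := rfl

theorem heckeEval_bijective : Function.Bijective (heckeEval R L) := by
  constructor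
  · refine (injective_iff_map_eq_zero (heckeEval R L)).2 fun h hh => ?_
    rw [heckeEval_apply] at hh
    refine Subtype.ext (Finsupp.lhom_ext' fun w => LinearMap.ext_ring ?_)
    simp only [LinearMap.comp_apply, Finsupp.lsingle_apply]
    change h.1 (Finsupp.single w 1) = 0
    induction hn : cs.length w generalizing w with
    | zero =>
      rw [cs.length_eq_zero_iff] at hn
      rw [hn, hh]
    | succ n ih =>
      have hw : w ≠ 1 := by rintro rfl; simp at hn
      obtain ⟨j, hj⟩ := cs.exists_rightDescent_of_ne_one hw
      rw [cs.isRightDescent_iff] at hj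
      have := rightOp_single R L j (w * cs.simple j)
      rw [cs.simple_mul_simple_cancel_right, if_pos (by omega)] at this
      rw [← this, hecke_rightOp, ih _ (by omega), map_zero]
  · have key : ∀ w : W, ∃ h : Hecke R L, heckeEval R L h = Finsupp.single w 1 := by
      intro w
      induction hn : cs.length w generalizing w with
      | zero =>
        rw [cs.length_eq_zero_iff] at hn
        exact ⟨1, by rw [hn]; rfl⟩
      | succ n ih =>
        have hw : w ≠ 1 := by rintro rfl; simp at hn
        obtain ⟨i, hi⟩ := cs.exists_leftDescent_of_ne_one hw
        rw [cs.isLeftDescent_iff] at hi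
        have h1 := leftOp_single R L i (cs.simple i * w)
        rw [cs.simple_mul_simple_cancel_left, if_pos (by omega)] at h1
        obtain ⟨h, hh⟩ := ih (cs.simple i * w) (by omega)
        refine ⟨heckeGen R L i * h, ?_⟩
        rw [← h1, ← hh]
        rfl
    intro x
    induction x using Finsupp.induction_linear with
    | zero => exact ⟨0, map_zero _⟩
    | add x y hx hy =>
      obtain ⟨a, rfl⟩ := hx
      obtain ⟨b, rfl⟩ := hy
      exact ⟨a + b, map_add _ _ _⟩
    | single w a =>
      obtain ⟨h, hh⟩ := key w
      exact ⟨a • h, by rw [map_smul, hh, Finsupp.smul_single, smul_eq_mul, mul_one]⟩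

/-- The standard basis `T_w` of the Iwahori-Hecke algebra. -/
def heckeT : Module.Basis W (AddMonoidAlgebra R Γ) (Hecke R L) :=
  Module.Basis.ofRepr (LinearEquiv.ofBijective (heckeEval R L) (heckeEval_bijective R L))

theorem heckeEval_heckeT (w : W) : heckeEval R L (heckeT R L w) = Finsupp.single w 1 :=
  (heckeT R L).repr_self w

theorem heckeT_one : heckeT R L 1 = 1 := by
  refine (heckeEval_bijective R L).1 ?_
  rw [heckeEval_heckeT]
  rfl

/-- The multiplication rule of the Iwahori-Hecke algebra. -/
theorem heckeT_simple_mul (i : B) (w : W) :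
    heckeT R L (cs.simple i) * heckeT R L w =
      if cs.length w < cs.length (cs.simple i * w) then heckeT R L (cs.simple i * w)
      else heckeT R L (cs.simple i * w) + xi R L i • heckeT R L w := by
  have h0 : heckeT R L (cs.simple i) = heckeGen R L i := by
    refine (heckeEval_bijective R L).1 ?_
    rw [heckeEval_heckeT, heckeEval_apply, heckeGen, leftOp_single, mul_one, if_pos (by simp)]
  refine (heckeEval_bijective R L).1 ?_
  have h1 : heckeEval R L (heckeT R L (cs.simple i) * heckeT R L w) =
      leftOp R L i (Finsupp.single w 1) := by
    rw [← heckeEval_heckeT R L w, h0]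
    rfl
  rw [h1, leftOp_single]
  split_ifs
  · rw [heckeEval_heckeT]
  · rw [map_add, map_smul, heckeEval_heckeT, heckeEval_heckeT]

end HeckeAlgebra

section KazhdanLusztig

variable {B W Γ : Type*} [Group W] [Fintype W] {M : CoxeterMatrix B} {cs : CoxeterSystem M W}
  [AddCommGroup Γ] [LinearOrder Γ] [IsOrderedAddMonoid Γ] (R : Subring ℂ) (L : WeightFunction cs Γ)

/-- The ring involution `ε^g ↦ ε^{-g}` of `R[Γ]`. -/
def barA (a : AddMonoidAlgebra R Γ) : AddMonoidAlgebra R Γ :=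
  a.coeff.sum fun g r => AddMonoidAlgebra.single (-g) r

/-- The bar involution: the sum of the `a_w T_w` goes to the sum of the `ā_w (T_{w⁻¹})⁻¹`. -/
def barH (h : Hecke R L) : Hecke R L :=
  ∑ w : W, barA R ((heckeT R L).repr h w) • Ring.inverse (heckeT R L w⁻¹)

/-- Membership in `ℤ[Γ_{<0}]`. -/
def IsIntNeg (a : AddMonoidAlgebra R Γ) : Prop :=
  ∀ g : Γ, (∃ n : ℤ, a.coeff g = n) ∧ (a.coeff g ≠ 0 → g < 0)

/-- The two conditions that characterise `C'_w`: it is fixed by the bar involution, and it is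
`T_w` plus a `ℤ[Γ_{<0}]`-linear combination of the `T_y`. -/
def IsKLElement (w : W) (c : Hecke R L) : Prop :=
  barH R L c = c ∧ ∀ y : W, IsIntNeg R ((heckeT R L).repr c y - if y = w then 1 else 0)

/-- The Kazhdan-Lusztig basis element `C'_w`. -/
def klC' (w : W) : Hecke R L := Classical.epsilon (IsKLElement R L w)

/-- The `A`-algebra automorphism `†` of the Hecke algebra with `T_s† = -T_s⁻¹`. On the standard
basis it is given by `T_w† = (-1)^{ℓ(w)} (T_{w⁻¹})⁻¹`. -/
def dagger : Hecke R L →ₗ[AddMonoidAlgebra R Γ] Hecke R L :=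
  (heckeT R L).constr (AddMonoidAlgebra R Γ) fun w =>
    (-1) ^ cs.length w * Ring.inverse (heckeT R L w⁻¹)

/-- The Kazhdan-Lusztig basis element `C_w = (C'_w)†`. -/
def klC (w : W) : Hecke R L := dagger R L (klC' R L w)

/-- The coordinates of an element of the Hecke algebra in the basis `C_w`. -/
def klCoord (h : Hecke R L) : W → AddMonoidAlgebra R Γ :=
  Classical.epsilon fun c => h = ∑ z : W, c z • klC R L z

/-- The structure constants `h_{x,y,z}`, where `C_x C_y` is the sum of the `h_{x,y,z} C_z`. -/
def hConst (x y z : W) : AddMonoidAlgebra R Γ := klCoord R L (klC R L x * klC R L y) z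

/-- `C_y` occurs in `C_s C_w` or in `C_w C_s`, for some simple reflection `s`. -/
def stepLR (y w : W) : Prop :=
  ∃ i : B, hConst R L (cs.simple i) w y ≠ 0 ∨ hConst R L w (cs.simple i) y ≠ 0

/-- The Kazhdan-Lusztig preorder `y ≤_LR w`. -/
def leLR (y w : W) : Prop := Relation.ReflTransGen (stepLR R L) y w

/-- The equivalence relation `y ∼_LR w`, whose classes are the two-sided cells. -/
def eqvLR (y w : W) : Prop := leLR R L y w ∧ leLR R L w y

end KazhdanLusztig

section ValuationRing

variable {Γ : Type*} [AddCommGroup Γ] [LinearOrder Γ] [IsOrderedAddMonoid Γ] (R : Subring ℂ)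

/-- The field `K` of fractions of `A = R[Γ]`. -/
abbrev KField (Γ : Type*) [AddCommGroup Γ] [LinearOrder Γ] [IsOrderedAddMonoid Γ]
    (R : Subring ℂ) : Type _ := FractionRing (AddMonoidAlgebra R Γ)

/-- The inclusion of `F`, the field of fractions of `R`, into `K`. -/
def FtoK : FractionRing R →+* KField Γ R :=
  IsFractionRing.lift (FaithfulSMul.algebraMap_injective R (KField Γ R))

/-- The element `ε^g` of `K`. -/
def epsK (g : Γ) : KField Γ R := algebraMap (AddMonoidAlgebra R Γ) (KField Γ R) (eps R g)

/-- The inclusion of `F[Γ]` into `K`. -/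
def FGtoK (p : AddMonoidAlgebra (FractionRing R) Γ) : KField Γ R :=
  p.coeff.sum fun g r => FtoK R r * epsK R g

/-- Membership in `F[Γ_{>0}]`. -/
def IsPos (p : AddMonoidAlgebra (FractionRing R) Γ) : Prop := ∀ g : Γ, p.coeff g ≠ 0 → 0 < g

/-- `x = r ε^g (1 + p) / (1 + q)` with `p, q ∈ F[Γ_{>0}]`. -/
def HasLead (x : KField Γ R) (r : FractionRing R) (g : Γ) : Prop :=
  ∃ p q : AddMonoidAlgebra (FractionRing R) Γ, IsPos R p ∧ IsPos R q ∧
    x = FtoK R r * epsK R g * ((1 + FGtoK R p) / (1 + FGtoK R q))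

/-- The exponent `g_x` of a nonzero element of `K` (with the value `0` at `x = 0`). -/
def leadExp (x : KField Γ R) : Γ :=
  if h : ∃ g : Γ, ∃ r : FractionRing R, r ≠ 0 ∧ HasLead R x r g then h.choose else 0

/-- The coefficient `r_x` of an element of `K`, with `r_0 = 0`. -/
def leadCoeff (x : KField Γ R) : FractionRing R :=
  if h : ∃ r : FractionRing R, r ≠ 0 ∧ ∃ g : Γ, HasLead R x r g then h.choose else 0

/-- The valuation ring `𝒪`, the set of all `x ∈ K` with `g_x ≥ 0`, where `g_0 = +∞`. -/
def valO : Set (KField Γ R) := {x | x = 0 ∨ 0 ≤ leadExp R x}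

/-- The constant term in `F` of an element of `𝒪`. -/
def constTerm (x : KField Γ R) : FractionRing R := if leadExp R x = 0 then leadCoeff R x else 0

/-- The ring homomorphism `θ₁ : A → R` with `θ₁(ε^g) = 1` for all `g`. -/
def theta1 (a : AddMonoidAlgebra R Γ) : R := a.coeff.sum fun _ r => r

end ValuationRing

section Balanced

variable {B W Γ : Type*} [Group W] [Fintype W] {M : CoxeterMatrix B} {cs : CoxeterSystem M W}
  [AddCommGroup Γ] [LinearOrder Γ] [IsOrderedAddMonoid Γ]

/-- `{E_l}` is a complete set of representatives of the isomorphism classes of irreducible complex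
representations of the finite group `W`. -/
structure IsIrrFamily {Λ W : Type*} [Group W] (E : Λ → FDRep ℂ W) : Prop where
  simple : ∀ l, CategoryTheory.Simple (E l)
  inequivalent : ∀ l m, Nonempty (E l ≅ E m) → l = m
  complete : ∀ V : FDRep ℂ W, CategoryTheory.Simple V → ∃ l, Nonempty (V ≅ E l)

/-- Matrix representations over `K` of degree `n` of the Hecke algebra. Such `A`-algebra maps are
the same thing as `K`-algebra maps `K ⊗_A H → M_n(K)`. -/
abbrev MatRep (R : Subring ℂ) (L : WeightFunction cs Γ) (n : ℕ) : Type _ :=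
  Hecke R L →ₐ[AddMonoidAlgebra R Γ] Matrix (Fin n) (Fin n) (KField Γ R)

variable {R : Subring ℂ} {L : WeightFunction cs Γ} {n : ℕ}

/-- `ρ` affords the representation of `H_K` that corresponds to the representation `V` of `W`
under specialisation: the trace of `T_w` lies in `A`, and `θ₁` maps it to the trace of `w`
on `V`. -/
def Corresponds (V : FDRep ℂ W) (ρ : MatRep R L n) : Prop :=
  n = Module.finrank ℂ V ∧ ∀ w : W, ∃ a : AddMonoidAlgebra R Γ,
    algebraMap (AddMonoidAlgebra R Γ) (KField Γ R) a = (ρ (heckeT R L w)).trace ∧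
    (theta1 R a : ℂ) = V.character w

/-- The element `c_ρ`, where `n c_ρ` is the sum of the
`trace (T_w, ρ) trace (T_{w⁻¹}, ρ)` over all `w ∈ W`. -/
def schurElt (ρ : MatRep R L n) : KField Γ R :=
  (n : KField Γ R)⁻¹ * ∑ w : W, (ρ (heckeT R L w)).trace * (ρ (heckeT R L w⁻¹)).trace

/-- The invariant `f_ρ`: the leading coefficient of `c_ρ = f_ρ ε^{-2 a_ρ} + higher terms`. -/
def fInv (ρ : MatRep R L n) : FractionRing R := leadCoeff R (schurElt ρ)

/-- The invariant `a_ρ`: the leading exponent of `c_ρ` is `-2 a_ρ`. -/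
def aInv (ρ : MatRep R L n) : Γ := Classical.epsilon fun a => leadExp R (schurElt ρ) = -(2 • a)

/-- `ρ` is balanced: `ε^{a_ρ} ρ_{ij}(T_w) ∈ 𝒪` for all `w, i, j`. -/
def IsBalanced (ρ : MatRep R L n) : Prop :=
  ∀ (w : W) (i j : Fin n), epsK R (aInv ρ) * ρ (heckeT R L w) i j ∈ valO R

/-- The leading matrix coefficients: the constant term of
`(-1)^{ℓ(w)} ε^{a_ρ} ρ_{ij}(T_w)`. -/
def leadMat (ρ : MatRep R L n) (w : W) (i j : Fin n) : FractionRing R :=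
  constTerm R ((-1) ^ cs.length w * (epsK R (aInv ρ) * ρ (heckeT R L w) i j))

end Balanced

section AsymptoticRing

variable {B W Γ Λ : Type*} [Group W] [Fintype W] {M : CoxeterMatrix B} {cs : CoxeterSystem M W}
  [AddCommGroup Γ] [LinearOrder Γ] [IsOrderedAddMonoid Γ] {R : Subring ℂ}
  {L : WeightFunction cs Γ} [Fintype Λ] {d : Λ → ℕ} (ρ : ∀ l : Λ, MatRep R L (d l))

/-- The constants `γ̃_{x,y,z}`. -/
def gammaT (x y z : W) : FractionRing R :=
  ∑ l : Λ, ∑ i : Fin (d l), ∑ j : Fin (d l), ∑ k : Fin (d l),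
    (fInv (ρ l))⁻¹ * leadMat (ρ l) x i j * leadMat (ρ l) y j k * leadMat (ρ l) z k i

/-- The constants `ñ_w`. -/
def nT (w : W) : FractionRing R :=
  ∑ l : Λ, ∑ i : Fin (d l), (fInv (ρ l))⁻¹ * leadMat (ρ l) w⁻¹ i i

/-- The set `D̃` of all `w` with `ñ_w ≠ 0`. -/
def setD : Finset W := Finset.univ.filter fun w => nT ρ w ≠ 0

/-- The algebra `K ⊗_F J̃`: the `K`-vector space with basis `t_w`, with the product
given by `t_x t_y = ∑_z γ̃_{x,y,z⁻¹} t_z`. -/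
def JTilde (_ρ : ∀ l : Λ, MatRep R L (d l)) : Type _ := W → KField Γ R

instance : AddCommGroup (JTilde ρ) := inferInstanceAs (AddCommGroup (W → KField Γ R))

instance : Module (KField Γ R) (JTilde ρ) := inferInstanceAs (Module _ (W → KField Γ R))

instance : Module (AddMonoidAlgebra R Γ) (JTilde ρ) := inferInstanceAs (Module _ (W → KField Γ R))

instance : NonUnitalNonAssocRing (JTilde ρ) where
  mul a b := fun z => ∑ x : W, ∑ y : W, a x * b y * FtoK R (gammaT ρ x y z⁻¹)
  left_distrib a b c := funext fun z => by
    change ∑ x : W, ∑ y : W, a x * (b y + c y) * FtoK R (gammaT ρ x y z⁻¹) =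
      ∑ x : W, ∑ y : W, a x * b y * FtoK R (gammaT ρ x y z⁻¹) +
      ∑ x : W, ∑ y : W, a x * c y * FtoK R (gammaT ρ x y z⁻¹)
    simp only [mul_add, add_mul, Finset.sum_add_distrib]
  right_distrib a b c := funext fun z => by
    change ∑ x : W, ∑ y : W, (a x + b x) * c y * FtoK R (gammaT ρ x y z⁻¹) =
      ∑ x : W, ∑ y : W, a x * c y * FtoK R (gammaT ρ x y z⁻¹) +
      ∑ x : W, ∑ y : W, b x * c y * FtoK R (gammaT ρ x y z⁻¹)
    simp only [add_mul, Finset.sum_add_distrib]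
  zero_mul a := funext fun z => by
    change ∑ x : W, ∑ y : W, (0 : KField Γ R) * a y * FtoK R (gammaT ρ x y z⁻¹) = 0
    simp
  mul_zero a := funext fun z => by
    change ∑ x : W, ∑ y : W, a x * (0 : KField Γ R) * FtoK R (gammaT ρ x y z⁻¹) = 0
    simp

/-- The basis element `t_w`. -/
def tElt (w : W) : JTilde ρ := fun z => if z = w then 1 else 0

/-- The identity element `∑_{w ∈ D̃} ñ_w t_w`. -/
def oneJ : JTilde ρ := ∑ w ∈ setD ρ, (FtoK R (nT ρ w) : KField Γ R) • tElt ρ w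

/-- `J̃_A`, the `A`-span of the `t_w`. -/
def JA : Submodule (AddMonoidAlgebra R Γ) (JTilde ρ) :=
  Submodule.span (AddMonoidAlgebra R Γ) (Set.range (tElt ρ))

/-- The left action of the Hecke algebra on the `t_w`, transported from left multiplication via
`C_w ↔ t_w`. -/
def actT (h : Hecke R L) (w : W) : JTilde ρ :=
  ∑ z : W, klCoord R L (h * klC R L w) z • tElt ρ z

/-- The `A`-linear combinations of the `t_y` with `y ≤_LR w` and not `y ∼_LR w`. -/
def lowerSpan (w : W) : Submodule (AddMonoidAlgebra R Γ) (JTilde ρ) :=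
  Submodule.span (AddMonoidAlgebra R Γ) (tElt ρ '' {y | leLR R L y w ∧ ¬ eqvLR R L y w})

/-- The property P̃15. -/
def P15Tilde : Prop :=
  ∀ x x' y w : W, eqvLR R L w y →
    ∑ u : W, FtoK R (gammaT ρ w x' u⁻¹) *
        algebraMap (AddMonoidAlgebra R Γ) (KField Γ R) (hConst R L x u y) =
      ∑ u : W, algebraMap (AddMonoidAlgebra R Γ) (KField Γ R) (hConst R L x w u) *
        FtoK R (gammaT ρ u x' y⁻¹)

/-- The ring `ℤ_W` generated by the numbers `2 cos (2π / m_{st})`, where `m_{st}` is the order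
of `st`. -/
def zW (cs : CoxeterSystem M W) : Subring ℂ :=
  Subring.closure (Set.range fun p : B × B =>
    (2 * Real.cos (2 * Real.pi / orderOf (cs.simple p.1 * cs.simple p.2)) : ℂ))

/-- `R` is `L`-good: `ℤ_W ⊆ R`, and every `f_l` is contained and invertible in `R`. -/
def IsLGood : Prop :=
  zW cs ≤ R ∧ ∀ l : Λ, ∃ u : Rˣ, algebraMap R (FractionRing R) u = fInv (ρ l)

/-- The conditions on `φ`: a unital homomorphism of `A`-algebras from `H` to `J̃_A` such that every
`φ(h) t_w - h.t_w` is an `A`-linear combination of the `t_y` with `y ≤_LR w`, not `y ∼_LR w`. -/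
structure IsLusztigHom (φ : Hecke R L →ₙₐ[AddMonoidAlgebra R Γ] JTilde ρ) : Prop where
  map_one : φ 1 = oneJ ρ
  mem_JA : ∀ h : Hecke R L, φ h ∈ JA ρ
  sub_mem : ∀ (h : Hecke R L) (w : W), φ h * tElt ρ w - actT ρ h w ∈ lowerSpan ρ w

end AsymptoticRing

end KLAsym

end

open KLAsym

noncomputable section

set_option linter.unusedSectionVars false

namespace KLAsym

open scoped Classical

/-! ### Multiplication rules and a universal property of the Hecke algebra -/

section HeckeMaps

variable {B W Γ : Type*} [Group W] {M : CoxeterMatrix B} {cs : CoxeterSystem M W}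
  [AddCommGroup Γ] (R : Type*) [CommRing R] (L : WeightFunction cs Γ)

/-! Filter the Hecke algebra by the two-sided ideals spanned by the `C_y` with `y ≤_LR w`. The
associated graded module, transported along `C_w ↔ t_w`, gives a left action `grAct` of `H` on `J̃`:
it is `h.t_w` with every term outside the two-sided cell of `w` discarded. The point is that this
action commutes with right multiplication in `J̃` (`grAct_mul`). This is P̃15, once it is known that
a nonzero `γ̃_{x,y,z⁻¹}` forces `x`, `y`, `z` into one cell, so that the truncation to cells can be
inserted or removed freely. Setting `φ(h) = h · 1_J`, one gets `φ(h) t_w = h · (1_J t_w) = h · t_w`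
and `φ(h) φ(h') = h · (1_J φ(h')) = h · (h' · 1_J) = φ(h h')`. Only the two-sided identity of `J̃`
enters, not associativity. Conversely, cell support leaves in `ψ(h) t_w` only terms from the cell of
`w`, and these are prescribed; hence `ψ(h) = ψ(h) 1_J` is determined. The explicit formula is the
expansion of `C_w · 1_J`.

Two facts about leading coefficients carry this. First, `1_J` is an identity. The field `K` embeds
into Hahn series over `ℂ`, where balancedness says that the entries of `ρ(T_w)` start no earlier
than exponent `-a`, and the leading coefficients are, up to sign, the coefficients at `-a`. The
coefficient at `-2a` of the Schur relations gives orthogonality relations for the `c_w`; since the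
squares of the degrees sum to `|W|`, these are the relations between mutually inverse square
matrices. The Schur relations come from linear independence of the representing matrices, tested by
a Gram determinant that specialises to the regular character of `W`. Complex conjugation shows that
`c_λ` is, up to a positive rational factor, a sum of terms `x̄ x`, so its lowest term cannot cancel
and its order is twice an element of `Γ`.

Second, cell support (`leLR_of_leadMat_inv`). If `x ≤_LR y` fails, the coefficient of `C_x` is a
linear form vanishing on `H C_y H`. If moreover `ρ(C_y) ≠ 0`, the component of this form at `ρ`
vanishes. As `T_w` has zero constant coefficient at `C_x` for `w ≠ x` and a nonzero one for `w = x`,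
the lowest coefficient of this identity says that the leading matrix of `x⁻¹` is zero. -/

theorem length_induction (cs : CoxeterSystem M W) {P : W → Prop} (one : P 1)
    (step : ∀ i w, cs.length w < cs.length (cs.simple i * w) → P w → P (cs.simple i * w)) (w : W) :
    P w := by
  induction hn : cs.length w generalizing w with
  | zero =>
    rw [cs.length_eq_zero_iff] at hn
    rwa [hn]
  | succ n ih =>
    have hw : w ≠ 1 := by rintro rfl; simp at hn
    obtain ⟨i, hi⟩ := cs.exists_leftDescent_of_ne_one hw
    rw [cs.isLeftDescent_iff] at hi
    have := step i (cs.simple i * w) (by rw [cs.simple_mul_simple_cancel_left]; omega)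
      (ih _ (by omega))
    rwa [cs.simple_mul_simple_cancel_left] at this

theorem heckeT_simple_mul_of_lt {i : B} {w : W} (h : cs.length w < cs.length (cs.simple i * w)) :
    heckeT R L (cs.simple i) * heckeT R L w = heckeT R L (cs.simple i * w) := by
  rw [heckeT_simple_mul, if_pos h]

/-- Elements of the Hecke algebra are operators commuting with `rightOp`, and `rightOp` sends the
vector of the identity to that of `s`; so the right-handed rule is read off by evaluating at the
identity vector. -/
theorem heckeT_mul_simple (j : B) (w : W) :
    heckeT R L w * heckeT R L (cs.simple j) =
      if cs.length w < cs.length (w * cs.simple j) then heckeT R L (w * cs.simple j)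
      else heckeT R L (w * cs.simple j) + xi R L j • heckeT R L w := by
  refine (heckeEval_bijective R L).1 ?_
  have h2 : rightOp R L j (Finsupp.single 1 1) = Finsupp.single (cs.simple j) 1 := by
    rw [rightOp_single, if_pos (by simp), one_mul]
  have h1 : heckeEval R L (heckeT R L w * heckeT R L (cs.simple j)) =
      rightOp R L j (Finsupp.single w 1) := by
    rw [← heckeEval_heckeT R L w, heckeEval_apply, heckeEval_apply, ← hecke_rightOp, h2,
      ← heckeEval_heckeT R L (cs.simple j)]
    rfl
  rw [h1, rightOp_single]
  split_ifs
  · rw [heckeEval_heckeT]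
  · rw [map_add, map_smul, heckeEval_heckeT, heckeEval_heckeT]

theorem heckeT_mul_simple_of_lt {j : B} {w : W} (h : cs.length w < cs.length (w * cs.simple j)) :
    heckeT R L w * heckeT R L (cs.simple j) = heckeT R L (w * cs.simple j) := by
  rw [heckeT_mul_simple, if_pos h]

theorem heckeT_simple_mul_self (i : B) :
    heckeT R L (cs.simple i) * heckeT R L (cs.simple i) =
      1 + xi R L i • heckeT R L (cs.simple i) := by
  rw [heckeT_simple_mul, if_neg (by simp), cs.simple_mul_simple_self, heckeT_one]

/-- A family `U` indexed by `W` multiplies like the standard basis of the Hecke algebra with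
parameters `ζ`. -/
structure HeckeRule {A S : Type*} [CommRing A] [Ring S] [Algebra A S] (cs : CoxeterSystem M W)
    (ζ : B → A) (U : W → S) : Prop where
  one : U 1 = 1
  mul_of_lt : ∀ i w, cs.length w < cs.length (cs.simple i * w) →
    U (cs.simple i) * U w = U (cs.simple i * w)
  mul_self : ∀ i, U (cs.simple i) * U (cs.simple i) = 1 + ζ i • U (cs.simple i)

namespace HeckeRule

variable {A S : Type*} [CommRing A] [Ring S] [Algebra A S] {ζ : B → A} {U : W → S}

theorem mul_of_gt (hU : HeckeRule cs ζ U) (i : B) (w : W)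
    (h : ¬ cs.length w < cs.length (cs.simple i * w)) :
    U (cs.simple i) * U w = U (cs.simple i * w) + ζ i • U w := by
  have h1 := cs.length_simple_mul w i
  have h2 := hU.mul_of_lt i (cs.simple i * w) (by rw [cs.simple_mul_simple_cancel_left]; omega)
  rw [cs.simple_mul_simple_cancel_left] at h2
  rw [← h2, ← mul_assoc, hU.mul_self, add_mul, one_mul, smul_mul_assoc]

end HeckeRule

theorem heckeRule_heckeT : HeckeRule cs (xi R L) (heckeT R L) where
  one := heckeT_one R L
  mul_of_lt _ _ h := heckeT_simple_mul_of_lt R L h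
  mul_self i := heckeT_simple_mul_self R L i

variable [Fintype W]

/-- The semilinear map sending `T_w` to `U w`. -/
def liftT {A S : Type*} [CommRing A] [Ring S] [Algebra A S] (f : AddMonoidAlgebra R Γ →+* A)
    (U : W → S) : Hecke R L →ₛₗ[f] S where
  toFun h := ∑ w : W, f ((heckeT R L).repr h w) • U w
  map_add' x y := by simp [add_smul, Finset.sum_add_distrib]
  map_smul' a x := by simp [Finset.smul_sum, mul_smul]

section LiftT

variable {A S : Type*} [CommRing A] [Ring S] [Algebra A S] {f : AddMonoidAlgebra R Γ →+* A}
    {U : W → S}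

theorem liftT_apply (h : Hecke R L) :
    liftT R L f U h = ∑ w : W, f ((heckeT R L).repr h w) • U w := rfl

theorem liftT_heckeT (w : W) : liftT R L f U (heckeT R L w) = U w := by
  simp [liftT_apply, Finsupp.single_apply, apply_ite f, ite_smul]

/-- Multiplicativity is checked for left factors `T_s`, then for `T_w` by length, then for all by
linearity. It acts as a universal property: the bar involution, the sign involution and the
antiautomorphism `T_w ↦ T_{w⁻¹}` all arise from it. Semilinearity along `f` is what the first two
need. -/
theorem liftT_mul (hU : HeckeRule cs (fun i => f (xi R L i)) U) (x y : Hecke R L) :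
    liftT R L f U (x * y) = liftT R L f U x * liftT R L f U y := by
  have h1 : ∀ i y, liftT R L f U (heckeT R L (cs.simple i) * y) =
      U (cs.simple i) * liftT R L f U y := by
    intro i y
    suffices h : (liftT R L f U).comp (LinearMap.mulLeft _ (heckeT R L (cs.simple i))) =
        (LinearMap.mulLeft A (U (cs.simple i))).comp (liftT R L f U) from LinearMap.congr_fun h y
    refine (heckeT R L).ext fun w => ?_
    simp only [LinearMap.comp_apply, LinearMap.mulLeft_apply]
    rw [heckeT_simple_mul]
    split_ifs with hw
    · rw [liftT_heckeT, liftT_heckeT, hU.mul_of_lt i w hw]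
    · rw [map_add, LinearMap.map_smulₛₗ, liftT_heckeT, liftT_heckeT, hU.mul_of_gt i w hw]
  have h2 : ∀ w, ∀ y, liftT R L f U (heckeT R L w * y) = U w * liftT R L f U y := by
    intro w
    induction w using length_induction cs with
    | one => intro y; rw [heckeT_one, hU.one, one_mul, one_mul]
    | step i w hw ih =>
      intro y
      rw [← heckeT_simple_mul_of_lt R L hw, mul_assoc, h1, ih, ← hU.mul_of_lt i w hw, mul_assoc]
  suffices h : (liftT R L f U).comp (LinearMap.mulRight _ y) =
      (LinearMap.mulRight A (liftT R L f U y)).comp (liftT R L f U) from LinearMap.congr_fun h x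
  refine (heckeT R L).ext fun w => ?_
  simp only [LinearMap.comp_apply, LinearMap.mulRight_apply]
  rw [h2, liftT_heckeT]

/-- The semilinear ring homomorphism sending `T_w` to `U w`. -/
def liftHom (hU : HeckeRule cs (fun i => f (xi R L i)) U) : Hecke R L →+* S where
  toFun := liftT R L f U
  map_one' := by rw [← heckeT_one, liftT_heckeT, hU.one]
  map_mul' := liftT_mul R L hU
  map_zero' := map_zero _
  map_add' := map_add _

theorem liftHom_heckeT (hU : HeckeRule cs (fun i => f (xi R L i)) U) (w : W) :
    liftHom R L hU (heckeT R L w) = U w := liftT_heckeT R L w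

theorem liftHom_smul (hU : HeckeRule cs (fun i => f (xi R L i)) U) (a : AddMonoidAlgebra R Γ)
    (h : Hecke R L) : liftHom R L hU (a • h) = f a • liftHom R L hU h :=
  LinearMap.map_smulₛₗ (liftT R L f U) a h

end LiftT

end HeckeMaps

/-! ### Invertibility of the standard basis elements -/

section HeckeInverse

variable {B W Γ : Type*} [Group W] {M : CoxeterMatrix B} {cs : CoxeterSystem M W}
  [AddCommGroup Γ] (R : Type*) [CommRing R] (L : WeightFunction cs Γ)

theorem heckeT_simple_mul_inv (i : B) :
    heckeT R L (cs.simple i) * (heckeT R L (cs.simple i) - xi R L i • 1) = 1 := by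
  rw [mul_sub, heckeT_simple_mul_self, mul_smul_comm, mul_one, add_sub_cancel_right]

theorem heckeT_simple_inv_mul (i : B) :
    (heckeT R L (cs.simple i) - xi R L i • 1) * heckeT R L (cs.simple i) = 1 := by
  rw [sub_mul, heckeT_simple_mul_self, smul_mul_assoc, one_mul, add_sub_cancel_right]

theorem isUnit_heckeT_simple (i : B) : IsUnit (heckeT R L (cs.simple i)) :=
  ⟨⟨_, _, heckeT_simple_mul_inv R L i, heckeT_simple_inv_mul R L i⟩, rfl⟩

theorem inverse_heckeT_simple (i : B) :
    Ring.inverse (heckeT R L (cs.simple i)) = heckeT R L (cs.simple i) - xi R L i • 1 :=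
  Ring.inverse_unit (M₀ := Hecke R L)
    ⟨_, _, heckeT_simple_mul_inv R L i, heckeT_simple_inv_mul R L i⟩

theorem isUnit_heckeT (w : W) : IsUnit (heckeT R L w) := by
  induction w using length_induction cs with
  | one => rw [heckeT_one]; exact isUnit_one
  | step i w hw ih =>
    rw [← heckeT_simple_mul_of_lt R L hw]
    exact (isUnit_heckeT_simple R L i).mul ih

theorem heckeT_inv_mul_simple {i : B} {w : W} (h : cs.length w < cs.length (cs.simple i * w)) :
    heckeT R L w⁻¹ * heckeT R L (cs.simple i) = heckeT R L (cs.simple i * w)⁻¹ := by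
  rw [heckeT_mul_simple_of_lt, mul_inv_rev, cs.inv_simple]
  rwa [← cs.length_inv (w⁻¹ * _), mul_inv_rev, inv_inv, cs.inv_simple, cs.length_inv]

theorem inverse_mul_of_isUnit {S : Type*} [Ring S] {a b : S} (ha : IsUnit a) (hb : IsUnit b) :
    Ring.inverse (a * b) = Ring.inverse b * Ring.inverse a := by
  obtain ⟨u, rfl⟩ := ha
  obtain ⟨v, rfl⟩ := hb
  rw [← Units.val_mul, Ring.inverse_unit, Ring.inverse_unit, Ring.inverse_unit, mul_inv_rev,
    Units.val_mul]

theorem inverse_eq_of_mul {S : Type*} [Ring S] {a b : S} (ha : IsUnit a) (h : a * b = 1) :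
    Ring.inverse a = b := by
  obtain ⟨u, rfl⟩ := ha
  rw [Ring.inverse_unit, ← Units.mul_eq_one_iff_inv_eq, h]

theorem map_inverse_of_isUnit {S T : Type*} [Ring S] [Ring T] (f : S →+* T) {a : S}
    (ha : IsUnit a) : f (Ring.inverse a) = Ring.inverse (f a) :=
  (inverse_eq_of_mul (ha.map f) (by rw [← map_mul, Ring.mul_inverse_cancel _ ha, map_one])).symm

end HeckeInverse

theorem neg_one_pow_mul_eq_zsmul {S : Type*} [Ring S] (n : ℕ) (x : S) :
    (-1) ^ n * x = (-1 : ℤ) ^ n • x := by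
  rcases Nat.even_or_odd n with h | h <;> simp [h.neg_one_pow]

theorem neg_one_pow_zsmul_zsmul {S : Type*} [AddCommGroup S] (n : ℕ) (x : S) :
    (-1 : ℤ) ^ n • (-1 : ℤ) ^ n • x = x := by
  rcases Nat.even_or_odd n with h | h <;> simp [h.neg_one_pow]

/-! ### The bar involution on coefficients -/

section BarCoefficients

variable {Γ : Type*} [AddCommGroup Γ] (R : Subring ℂ)

/-- The bar involution of `R[Γ]` as a ring homomorphism. -/
def barHom : AddMonoidAlgebra R Γ →+* AddMonoidAlgebra R Γ :=
  AddMonoidAlgebra.mapDomainRingHom R (negAddMonoidHom : Γ →+ Γ)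

theorem barHom_single (g : Γ) (r : R) :
    barHom R (AddMonoidAlgebra.single g r) = AddMonoidAlgebra.single (-g) r := by
  simp [barHom]

theorem barHom_eps (g : Γ) : barHom R (eps R g) = eps R (-g) := barHom_single R g 1

theorem barHom_barHom (a : AddMonoidAlgebra R Γ) : barHom R (barHom R a) = a := by
  induction a using AddMonoidAlgebra.induction_linear with
  | zero => simp
  | add x y hx hy => rw [map_add, map_add, hx, hy]
  | single g r => rw [barHom_single, barHom_single, neg_neg]

theorem coeff_barHom (a : AddMonoidAlgebra R Γ) (g : Γ) :
    (barHom R a).coeff g = a.coeff (-g) := by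
  induction a using AddMonoidAlgebra.induction_linear with
  | zero => simp
  | add x y hx hy => simp [hx, hy]
  | single h r =>
    rw [barHom_single]
    simp [Finsupp.single_apply, neg_eq_iff_eq_neg]

/-- The elements of `R[Γ]` with integral coefficients. -/
def intCoeffs : Subring (AddMonoidAlgebra R Γ) :=
  (AddMonoidAlgebra.mapRingHom Γ (Int.castRingHom R)).range

variable {R} in
theorem mem_intCoeffs {a : AddMonoidAlgebra R Γ} :
    a ∈ intCoeffs R ↔ ∀ g, ∃ n : ℤ, a.coeff g = n := by
  constructor
  · rintro ⟨b, rfl⟩ g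
    exact ⟨b.coeff g, by simp⟩
  · intro h
    choose n hn using h
    have : a = ∑ g ∈ a.coeff.support, AddMonoidAlgebra.single g (n g : R) := by
      ext g
      simp only [AddMonoidAlgebra.coeff_sum, AddMonoidAlgebra.coeff_single, Finsupp.finsetSum_apply,
        Finsupp.single_apply, Finset.sum_ite_eq', ← hn]
      simp only [Finsupp.mem_support_iff, ne_eq, ite_not]
      split_ifs with h0 <;> simp [h0]
    rw [this]
    exact sum_mem fun g _ => ⟨AddMonoidAlgebra.single g (n g), by simp⟩

theorem eps_mem_intCoeffs (g : Γ) : eps R g ∈ intCoeffs R :=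
  ⟨AddMonoidAlgebra.single g 1, by simp [eps]⟩

theorem barHom_mem_intCoeffs {a : AddMonoidAlgebra R Γ} (ha : a ∈ intCoeffs R) :
    barHom R a ∈ intCoeffs R := by
  rw [mem_intCoeffs] at ha ⊢
  intro g
  rw [coeff_barHom]
  exact ha _

variable [LinearOrder Γ]

theorem IsIntNeg.mem_intCoeffs {a : AddMonoidAlgebra R Γ} (ha : IsIntNeg R a) :
    a ∈ intCoeffs R := KLAsym.mem_intCoeffs.2 fun g => (ha g).1

theorem isIntNeg_zero : IsIntNeg R (0 : AddMonoidAlgebra R Γ) := fun g =>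
  ⟨⟨0, by simp⟩, fun h => absurd (by simp) h⟩

theorem IsIntNeg.sub {a b : AddMonoidAlgebra R Γ} (ha : IsIntNeg R a) (hb : IsIntNeg R b) :
    IsIntNeg R (a - b) := fun g => by
  refine ⟨KLAsym.mem_intCoeffs.1 (sub_mem ha.mem_intCoeffs hb.mem_intCoeffs) g, fun h => ?_⟩
  by_cases h0 : a.coeff g = 0
  · exact (hb g).2 fun h1 => h (by simp [h0, h1])
  · exact (ha g).2 h0

theorem IsIntNeg.add {a b : AddMonoidAlgebra R Γ} (ha : IsIntNeg R a) (hb : IsIntNeg R b) :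
    IsIntNeg R (a + b) := fun g => by
  refine ⟨KLAsym.mem_intCoeffs.1 (add_mem ha.mem_intCoeffs hb.mem_intCoeffs) g, fun h => ?_⟩
  by_cases h0 : a.coeff g = 0
  · exact (hb g).2 fun h1 => h (by simp [h0, h1])
  · exact (ha g).2 h0

theorem isIntNeg_eps {g : Γ} (hg : g < 0) : IsIntNeg R (eps R g) := fun h => by
  refine ⟨KLAsym.mem_intCoeffs.1 (eps_mem_intCoeffs R g) h, fun h0 => ?_⟩
  have : g = h := by
    by_contra h1
    exact h0 (by simp [eps, h1])
  rwa [← this]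

variable [IsOrderedAddMonoid Γ]

theorem IsIntNeg.eq_zero_of_barHom_eq {a : AddMonoidAlgebra R Γ} (ha : IsIntNeg R a)
    (h : barHom R a = a) : a = 0 := by
  ext g
  by_contra h0
  have h0 : a.coeff g ≠ 0 := fun h => h0 (by simp [h])
  have h1 := (ha g).2 h0
  have h2 := (ha (-g)).2 (by rwa [← coeff_barHom, h])
  exact absurd (add_neg h1 h2) (by simp)

/-- An integral element that is antisymmetric for the bar involution is the difference of an
element of `ℤ[Γ_{<0}]` and its conjugate. -/
theorem exists_isIntNeg_sub_bar {a : AddMonoidAlgebra R Γ} (ha : a ∈ intCoeffs R)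
    (h : barHom R a = -a) : ∃ b, IsIntNeg R b ∧ a = b - barHom R b := by
  have hz : ∀ g, a.coeff (-g) = -a.coeff g := fun g => by rw [← coeff_barHom, h]; simp
  -- The part of `a` with negative exponents serves as `b`; antisymmetry supplies the positive part,
  -- and the constant coefficient equals its own negative in a subring of `ℂ`, hence is zero.
  refine ⟨AddMonoidAlgebra.ofCoeff (a.coeff.filter (· < 0)), fun g => ⟨?_, ?_⟩, ?_⟩
  · by_cases hg : g < 0
    · simpa [Finsupp.filter_apply, hg] using mem_intCoeffs.1 ha g
    · exact ⟨0, by simp [hg]⟩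
  · intro h0
    by_contra hg
    exact h0 (by simp [hg])
  · ext g
    simp only [AddMonoidAlgebra.coeff_sub, Finsupp.sub_apply, coeff_barHom, Finsupp.filter_apply]
    rcases lt_trichotomy g 0 with hg | rfl | hg
    · simp [hg, hg.not_gt]
    · have := hz 0
      rw [neg_zero] at this
      have h0 : a.coeff 0 = 0 := by
        have h2 : ((a.coeff 0 : R) : ℂ) = -(a.coeff 0 : R) := congrArg Subtype.val this
        exact Subtype.ext (self_eq_neg.1 h2)
      simp [h0]
    · simp [hg, hg.le, hz]

end BarCoefficients

/-! ### Existence and uniqueness of the Kazhdan–Lusztig basis -/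

section KLBasis

variable {B W Γ : Type*} [Group W] [Fintype W] {M : CoxeterMatrix B} {cs : CoxeterSystem M W}
  [AddCommGroup Γ] (R : Subring ℂ) (L : WeightFunction cs Γ)

theorem barHom_xi (i : B) : barHom R (xi R L i) = -xi R L i := by
  rw [xi, map_sub, barHom_eps, barHom_eps, neg_neg, neg_sub]

theorem xi_mem_intCoeffs (i : B) : xi R L i ∈ intCoeffs R :=
  sub_mem (eps_mem_intCoeffs R _) (eps_mem_intCoeffs R _)

/-- `T_s⁻¹ = T_s - ξ_s` satisfies the quadratic relation with `-ξ_s`, and `-ξ_s` is the conjugate of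
`ξ_s`. -/
theorem barRule : HeckeRule cs (fun i => barHom R (xi R L i))
    (fun w => Ring.inverse (heckeT R L w⁻¹)) where
  one := by rw [inv_one, heckeT_one, Ring.inverse_one]
  mul_of_lt i w h := by
    rw [← heckeT_inv_mul_simple R L h, inverse_mul_of_isUnit (isUnit_heckeT R L _)
      (isUnit_heckeT R L _), cs.inv_simple]
  mul_self i := by
    rw [cs.inv_simple, barHom_xi, inverse_heckeT_simple, mul_sub,
      heckeT_simple_inv_mul, mul_smul_comm, mul_one, neg_smul, sub_eq_add_neg]

/-- The bar involution of the Hecke algebra as a ring homomorphism. -/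
def barRing : Hecke R L →+* Hecke R L := liftHom R L (barRule R L)

theorem barRing_heckeT (w : W) : barRing R L (heckeT R L w) = Ring.inverse (heckeT R L w⁻¹) :=
  liftHom_heckeT R L (barRule R L) w

theorem barRing_smul (a : AddMonoidAlgebra R Γ) (h : Hecke R L) :
    barRing R L (a • h) = barHom R a • barRing R L h :=
  liftHom_smul R L (barRule R L) a h

theorem barRing_barRing (h : Hecke R L) : barRing R L (barRing R L h) = h := by
  rw [← (heckeT R L).sum_repr h]
  simp only [map_sum, barRing_smul, barHom_barHom, barRing_heckeT]
  refine Finset.sum_congr rfl fun w _ => ?_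
  rw [map_inverse_of_isUnit _ (isUnit_heckeT R L _), barRing_heckeT, inv_inv,
    Ring.inverse_inverse (isUnit_heckeT R L _)]

/-- Changing the sign of `T_s` also turns `ξ_s` into `-ξ_s`. Composing with the bar involution
cancels the two conjugations of scalars, which yields the linear map `†`. -/
theorem signRule : HeckeRule cs (fun i => barHom R (xi R L i))
    (fun w => (-1 : ℤ) ^ cs.length w • heckeT R L w) where
  one := by simp [heckeT_one]
  mul_of_lt i w h := by
    have h1 := cs.length_simple_mul w i
    rw [← heckeT_simple_mul_of_lt R L h, show cs.length (cs.simple i * w) = cs.length w + 1 by omega]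
    rw [cs.length_simple, pow_one, neg_one_smul, mul_smul_comm, neg_mul, pow_succ, mul_neg_one,
      neg_smul, smul_neg]
  mul_self i := by
    simp [heckeT_simple_mul_self, barHom_xi]

/-- The semilinear ring involution sending `T_w` to `(-1)^{ℓ(w)} T_w`. -/
def signRing : Hecke R L →+* Hecke R L := liftHom R L (signRule R L)

theorem signRing_heckeT (w : W) :
    signRing R L (heckeT R L w) = (-1 : ℤ) ^ cs.length w • heckeT R L w :=
  liftHom_heckeT R L (signRule R L) w

theorem signRing_smul (a : AddMonoidAlgebra R Γ) (h : Hecke R L) :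
    signRing R L (a • h) = barHom R a • signRing R L h :=
  liftHom_smul R L (signRule R L) a h

/-- On bar-invariant elements `†` therefore reduces to the sign involution. This is how the
coefficients of `C_w` are obtained from those of `C'_w`: negative exponents become positive. -/
theorem dagger_eq (h : Hecke R L) : dagger R L h = signRing R L (barRing R L h) := by
  have h1 : ∀ w : W, signRing R L (Ring.inverse (heckeT R L w⁻¹)) =
      (-1) ^ cs.length w * Ring.inverse (heckeT R L w⁻¹) := by
    intro w
    have hu := isUnit_heckeT R L w⁻¹
    rw [map_inverse_of_isUnit _ hu, neg_one_pow_mul_eq_zsmul]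
    refine inverse_eq_of_mul (hu.map _) ?_
    rw [signRing_heckeT, cs.length_inv, smul_mul_assoc, mul_smul_comm, neg_one_pow_zsmul_zsmul,
      Ring.mul_inverse_cancel _ hu]
  conv_rhs => rw [← (heckeT R L).sum_repr h]
  simp only [map_sum, barRing_smul, signRing_smul, barHom_barHom, barRing_heckeT, h1]
  simp [dagger, Module.Basis.constr_apply_fintype]

/-- An antiautomorphism is a homomorphism to the opposite algebra, so the same universal property
applies. -/
theorem flatRule : HeckeRule cs (fun i => RingHom.id (AddMonoidAlgebra R Γ) (xi R L i))
    (fun w => MulOpposite.op (heckeT R L w⁻¹)) where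
  one := by simp [heckeT_one]
  mul_of_lt i w h := by
    rw [← heckeT_inv_mul_simple R L h, cs.inv_simple, MulOpposite.op_mul]
  mul_self i := by
    rw [cs.inv_simple, ← MulOpposite.op_mul, heckeT_simple_mul_self]
    simp

/-- The linear antiautomorphism sending `T_w` to `T_{w⁻¹}`. -/
def flat (h : Hecke R L) : Hecke R L := (liftHom R L (flatRule R L) h).unop

theorem flat_heckeT (w : W) : flat R L (heckeT R L w) = heckeT R L w⁻¹ := by
  rw [flat, liftHom_heckeT, MulOpposite.unop_op]

theorem flat_smul (a : AddMonoidAlgebra R Γ) (h : Hecke R L) :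
    flat R L (a • h) = a • flat R L h := by
  rw [flat, liftHom_smul, RingHom.id_apply, MulOpposite.unop_smul, flat]

theorem flat_mul (x y : Hecke R L) : flat R L (x * y) = flat R L y * flat R L x := by
  simp only [flat, map_mul, MulOpposite.unop_mul]

theorem flat_sum {ι : Type*} (s : Finset ι) (f : ι → Hecke R L) :
    flat R L (∑ i ∈ s, f i) = ∑ i ∈ s, flat R L (f i) := by
  simp only [flat, map_sum]
  exact map_sum MulOpposite.opAddEquiv.symm _ _

theorem flat_one : flat R L 1 = 1 := by simp [flat]

theorem flat_zsmul (n : ℤ) (h : Hecke R L) : flat R L (n • h) = n • flat R L h := by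
  simp only [flat, map_zsmul, MulOpposite.unop_smul]

theorem flat_inverse {a : Hecke R L} (ha : IsUnit a) :
    flat R L (Ring.inverse a) = Ring.inverse (flat R L a) := by
  have h1 : flat R L a * flat R L (Ring.inverse a) = 1 := by
    rw [← flat_mul, Ring.inverse_mul_cancel _ ha, flat_one]
  have h2 : flat R L (Ring.inverse a) * flat R L a = 1 := by
    rw [← flat_mul, Ring.mul_inverse_cancel _ ha, flat_one]
  exact (inverse_eq_of_mul ⟨⟨_, _, h1, h2⟩, rfl⟩ h1).symm

theorem repr_flat (h : Hecke R L) (w : W) :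
    (heckeT R L).repr (flat R L h) w = (heckeT R L).repr h w⁻¹ := by
  conv_lhs => rw [← (heckeT R L).sum_repr h]
  simp only [flat_sum, flat_smul, flat_heckeT, map_sum, map_smul, Module.Basis.repr_self,
    Finsupp.finsetSum_apply, Finsupp.smul_apply, Finsupp.single_apply, smul_eq_mul, mul_ite,
    mul_one, mul_zero, inv_eq_iff_eq_inv, Finset.sum_ite_eq', Finset.mem_univ, if_true]

theorem flat_barRing (h : Hecke R L) :
    flat R L (barRing R L h) = barRing R L (flat R L h) := by
  rw [← (heckeT R L).sum_repr h]
  simp only [map_sum, barRing_smul, barRing_heckeT, flat_sum, flat_smul, flat_heckeT]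
  refine Finset.sum_congr rfl fun w _ => ?_
  rw [flat_inverse R L (isUnit_heckeT R L _), flat_heckeT]

theorem flat_signRing (h : Hecke R L) :
    flat R L (signRing R L h) = signRing R L (flat R L h) := by
  rw [← (heckeT R L).sum_repr h]
  simp only [map_sum, signRing_smul, signRing_heckeT, flat_sum, flat_smul, flat_heckeT]
  refine Finset.sum_congr rfl fun w _ => ?_
  rw [cs.length_inv, flat_zsmul, flat_heckeT]

/-- The integral combinations of the `T_y` with `ℓ(y) < n`. -/
def intSpan (n : ℕ) : AddSubgroup (Hecke R L) where
  carrier := {h | ∀ y, (heckeT R L).repr h y ∈ intCoeffs R ∧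
    (n ≤ cs.length y → (heckeT R L).repr h y = 0)}
  zero_mem' y := by simp [zero_mem]
  add_mem' {a b} ha hb y := by
    rw [map_add, Finsupp.add_apply]
    exact ⟨add_mem (ha y).1 (hb y).1, fun h => by rw [(ha y).2 h, (hb y).2 h, add_zero]⟩
  neg_mem' {a} ha y := by
    rw [map_neg, Finsupp.neg_apply]
    exact ⟨neg_mem (ha y).1, fun h => by rw [(ha y).2 h, neg_zero]⟩

variable {R L}

theorem smul_mem_intSpan {n : ℕ} {a : AddMonoidAlgebra R Γ} {h : Hecke R L}
    (ha : a ∈ intCoeffs R) (hh : h ∈ intSpan R L n) : a • h ∈ intSpan R L n := fun y => by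
  rw [map_smul, Finsupp.smul_apply, smul_eq_mul]
  exact ⟨mul_mem ha (hh y).1, fun h => by rw [(hh y).2 h, mul_zero]⟩

theorem intSpan_mono {m n : ℕ} (hmn : m ≤ n) : intSpan R L m ≤ intSpan R L n := fun _ hh y =>
  ⟨(hh y).1, fun h => (hh y).2 (hmn.trans h)⟩

theorem heckeT_mem_intSpan {n : ℕ} {w : W} (h : cs.length w < n) :
    heckeT R L w ∈ intSpan R L n := fun y => by
  rw [Module.Basis.repr_self, Finsupp.single_apply]
  split_ifs with h1
  · exact ⟨one_mem _, fun h2 => by subst h1; omega⟩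
  · exact ⟨zero_mem _, fun _ => rfl⟩

/-- Additive maps preserve the integral spans as soon as they do so on the standard basis. -/
theorem sum_mem_intSpan {n m : ℕ} {h : Hecke R L} (hh : h ∈ intSpan R L n)
    {f : AddMonoidAlgebra R Γ → AddMonoidAlgebra R Γ} (f0 : f 0 = 0)
    (hf : ∀ a ∈ intCoeffs R, f a ∈ intCoeffs R) {g : W → Hecke R L}
    (hg : ∀ w, cs.length w < n → g w ∈ intSpan R L m) :
    ∑ w, f ((heckeT R L).repr h w) • g w ∈ intSpan R L m := by
  refine sum_mem fun w _ => ?_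
  by_cases hw : cs.length w < n
  · exact smul_mem_intSpan (hf _ (hh w).1) (hg w hw)
  · rw [(hh w).2 (by omega), f0, zero_smul]
    exact zero_mem _

theorem simple_mul_mem_intSpan {n : ℕ} {h : Hecke R L} (hh : h ∈ intSpan R L n) (i : B) :
    heckeT R L (cs.simple i) * h ∈ intSpan R L (n + 1) := by
  rw [← (heckeT R L).sum_repr h, Finset.mul_sum]
  simp only [mul_smul_comm]
  refine sum_mem_intSpan (f := id) hh rfl (fun _ => id) fun w hw => ?_
  have h1 := cs.length_simple_mul w i
  rw [heckeT_simple_mul]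
  split_ifs
  · exact heckeT_mem_intSpan (by omega)
  · exact add_mem (heckeT_mem_intSpan (by omega))
      (smul_mem_intSpan (xi_mem_intCoeffs R L i) (heckeT_mem_intSpan (by omega)))

/-- The bar involution is unitriangular, because `T_s⁻¹` and `T_s` differ by a scalar. Triangularity
with respect to length is enough here; the Bruhat order is not needed. -/
theorem barRing_heckeT_sub_mem (w : W) :
    barRing R L (heckeT R L w) - heckeT R L w ∈ intSpan R L (cs.length w) := by
  induction w using length_induction cs with
  | one => rw [heckeT_one, map_one, sub_self]; exact zero_mem _
  | step i w hw ih =>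
    have h1 := cs.length_simple_mul w i
    rw [show cs.length (cs.simple i * w) = cs.length w + 1 by omega,
      ← heckeT_simple_mul_of_lt R L hw, map_mul, barRing_heckeT R L (cs.simple i), cs.inv_simple,
      inverse_heckeT_simple]
    set k := barRing R L (heckeT R L w) - heckeT R L w with hk
    have h2 : barRing R L (heckeT R L w) = heckeT R L w + k := by rw [hk]; abel
    have h3 : (heckeT R L (cs.simple i) - xi R L i • 1) * barRing R L (heckeT R L w) -
        heckeT R L (cs.simple i) * heckeT R L w =
        heckeT R L (cs.simple i) * k - (xi R L i • heckeT R L w + xi R L i • k) := by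
      rw [h2, sub_mul, smul_mul_assoc, one_mul, mul_add, smul_add]
      abel
    rw [h3]
    exact sub_mem (simple_mul_mem_intSpan ih i)
      (add_mem (smul_mem_intSpan (xi_mem_intCoeffs R L i) (heckeT_mem_intSpan (by omega)))
        (smul_mem_intSpan (xi_mem_intCoeffs R L i) (intSpan_mono (by omega) ih)))

theorem barRing_eq_sum (h : Hecke R L) : barRing R L h =
    ∑ w, barHom R ((heckeT R L).repr h w) • barRing R L (heckeT R L w) := by
  conv_lhs => rw [← (heckeT R L).sum_repr h]
  simp only [map_sum, barRing_smul]

theorem barRing_mem_intSpan {n : ℕ} {h : Hecke R L} (hh : h ∈ intSpan R L n) :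
    barRing R L h ∈ intSpan R L n := by
  rw [barRing_eq_sum]
  refine sum_mem_intSpan hh (map_zero _) (fun a => barHom_mem_intCoeffs R) fun w hw => ?_
  have := add_mem (intSpan_mono hw.le (barRing_heckeT_sub_mem (R := R) (L := L) w))
    (heckeT_mem_intSpan hw)
  rwa [sub_add_cancel] at this

/-- In the top length the bar involution only conjugates coefficients. This reduces both existence
and uniqueness of `C'_w` to statements about `R[Γ]`, one length at a time. -/
theorem repr_barRing_of_length_eq {n : ℕ} {h : Hecke R L} (hh : h ∈ intSpan R L (n + 1)) {y : W}
    (hy : cs.length y = n) :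
    (heckeT R L).repr (barRing R L h) y = barHom R ((heckeT R L).repr h y) := by
  have h1 : barRing R L h - ∑ w, barHom R ((heckeT R L).repr h w) • heckeT R L w ∈
      intSpan R L n := by
    rw [barRing_eq_sum, ← Finset.sum_sub_distrib]
    simp only [← smul_sub]
    exact sum_mem_intSpan hh (map_zero _) (fun a => barHom_mem_intCoeffs R) fun w hw =>
      intSpan_mono (by omega) (barRing_heckeT_sub_mem (R := R) (L := L) w)
  have h2 := (h1 y).2 hy.ge
  rw [map_sub, Finsupp.sub_apply, sub_eq_zero] at h2
  rw [h2]
  simp [Finsupp.single_apply]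

theorem mem_intSpan_of_succ {n : ℕ} {h : Hecke R L} (hh : h ∈ intSpan R L (n + 1))
    (h0 : ∀ y, cs.length y = n → (heckeT R L).repr h y = 0) : h ∈ intSpan R L n := fun y =>
  ⟨(hh y).1, fun hy => by
    rcases hy.eq_or_lt with hy | hy
    · exact h0 y hy.symm
    · exact (hh y).2 hy⟩

theorem eq_zero_of_mem_intSpan_zero {h : Hecke R L} (hh : h ∈ intSpan R L 0) : h = 0 :=
  (heckeT R L).repr.map_eq_zero_iff.1 (Finsupp.ext fun y => (hh y).2 (Nat.zero_le _))

theorem barH_eq (h : Hecke R L) : barH R L h = barRing R L h := by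
  rw [barRing_eq_sum]
  simp only [barRing_heckeT, barH]
  refine Finset.sum_congr rfl fun w _ => ?_
  congr 1
  exact (AddMonoidAlgebra.ext (by simp [barA, barHom, AddMonoidAlgebra.mapDomain, Finsupp.mapDomain]))

variable [LinearOrder Γ] [IsOrderedAddMonoid Γ]

/-- The top coefficients of an antisymmetric `h` are antisymmetric, hence of the form `b - b̄`.
Removing `k₀ - k̄₀`, with `k₀` collecting these `b`, lowers the length. Applied to the difference
between the bar conjugate of `T_w` and `T_w`, the resulting `k` makes `T_w + k` bar-invariant. -/
theorem exists_sub_barRing (n : ℕ) (h : Hecke R L) (hh : h ∈ intSpan R L n)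
    (hb : barRing R L h = -h) :
    ∃ k ∈ intSpan R L n, (∀ y, IsIntNeg R ((heckeT R L).repr k y)) ∧ h = k - barRing R L k := by
  induction n generalizing h with
  | zero =>
    refine ⟨0, zero_mem _, fun y => ?_, ?_⟩
    · simpa using isIntNeg_zero R
    · simp [eq_zero_of_mem_intSpan_zero hh]
  | succ n ih =>
    have h1 : ∀ y, cs.length y = n → ∃ b, IsIntNeg R b ∧
        (heckeT R L).repr h y = b - barHom R b := fun y hy =>
      exists_isIntNeg_sub_bar R (hh y).1 (by rw [← repr_barRing_of_length_eq hh hy, hb]; simp)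
    choose! b hb1 hb2 using h1
    set k₀ : Hecke R L := (heckeT R L).repr.symm
      (Finsupp.equivFunOnFinite.symm fun y => if cs.length y = n then b y else 0) with hk₀
    have hr : ∀ y, (heckeT R L).repr k₀ y = if cs.length y = n then b y else 0 := by
      intro y; simp [hk₀]
    have hneg : ∀ y, IsIntNeg R ((heckeT R L).repr k₀ y) := by
      intro y
      rw [hr]
      split_ifs with hy
      · exact hb1 y hy
      · exact isIntNeg_zero R
    have hk₀m : k₀ ∈ intSpan R L (n + 1) := fun y =>
      ⟨(hneg y).mem_intCoeffs, fun hy => by rw [hr, if_neg (by omega)]⟩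
    obtain ⟨k₁, hk₁, hk₁', he⟩ := ih (h - (k₀ - barRing R L k₀))
      (mem_intSpan_of_succ (sub_mem hh (sub_mem hk₀m (barRing_mem_intSpan hk₀m))) fun y hy => by
        rw [map_sub, map_sub, Finsupp.sub_apply, Finsupp.sub_apply,
          repr_barRing_of_length_eq hk₀m hy, hr, if_pos hy, hb2 y hy, sub_self])
      (by rw [map_sub, map_sub, barRing_barRing, hb]; abel)
    refine ⟨k₀ + k₁, add_mem hk₀m (intSpan_mono (by omega) hk₁), fun y => ?_, ?_⟩
    · rw [map_add, Finsupp.add_apply]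
      exact (hneg y).add R (hk₁' y)
    · rw [map_add, sub_eq_iff_eq_add.1 he]
      abel

/-- A top coefficient would be bar-invariant with only negative exponents, hence zero; descending
through the lengths removes everything. The difference of two candidates for `C'_w` is such an
element. -/
theorem eq_zero_of_barRing_eq {h : Hecke R L}
    (hn : ∀ y, IsIntNeg R ((heckeT R L).repr h y)) (hb : barRing R L h = h) : h = 0 := by
  have key : ∀ n, h ∈ intSpan R L n → h ∈ intSpan R L 0 := by
    intro n
    induction n with
    | zero => exact id
    | succ n ih =>
      exact fun hm => ih (mem_intSpan_of_succ hm fun y hy =>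
        (hn y).eq_zero_of_barHom_eq R (by rw [← repr_barRing_of_length_eq hm hy, hb]))
  refine eq_zero_of_mem_intSpan_zero (key (Finset.univ.sup cs.length + 1) fun y =>
    ⟨(hn y).mem_intCoeffs, fun hy => ?_⟩)
  have := Finset.le_sup (f := cs.length) (Finset.mem_univ y)
  omega

theorem IsKLElement.unique {w : W} {c c' : Hecke R L} (hc : IsKLElement R L w c)
    (hc' : IsKLElement R L w c') : c = c' := by
  refine sub_eq_zero.1 (eq_zero_of_barRing_eq (fun y => ?_) ?_)
  · have := (hc.2 y).sub R (hc'.2 y)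
    rwa [sub_sub_sub_cancel_right, ← Finsupp.sub_apply, ← map_sub] at this
  · rw [map_sub, ← barH_eq, ← barH_eq, hc.1, hc'.1]

theorem exists_isKLElement (w : W) :
    ∃ c, IsKLElement R L w c ∧ c - heckeT R L w ∈ intSpan R L (cs.length w) := by
  obtain ⟨k, hk, hneg, he⟩ := exists_sub_barRing (cs.length w) _
    (barRing_heckeT_sub_mem (R := R) (L := L) w) (by rw [map_sub, barRing_barRing]; abel)
  refine ⟨heckeT R L w + k, ⟨?_, fun y => ?_⟩, by rwa [add_sub_cancel_left]⟩
  · rw [barH_eq, map_add, sub_eq_iff_eq_add.1 he]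
    abel
  · have := hneg y
    rwa [map_add, Finsupp.add_apply, Module.Basis.repr_self, Finsupp.single_apply,
      show (if w = y then (1 : AddMonoidAlgebra R Γ) else 0) = if y = w then 1 else 0 by
        simp only [eq_comm], add_sub_cancel_left]

theorem isKLElement_klC' (w : W) : IsKLElement R L w (klC' R L w) :=
  Classical.epsilon_spec ⟨_, (exists_isKLElement w).choose_spec.1⟩

theorem klC'_sub_mem (w : W) : klC' R L w - heckeT R L w ∈ intSpan R L (cs.length w) := by
  obtain ⟨c, hc, hm⟩ := exists_isKLElement (R := R) (L := L) w
  rwa [(isKLElement_klC' w).unique hc]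

theorem klC_eq (w : W) : klC R L w = signRing R L (klC' R L w) := by
  rw [klC, dagger_eq, ← barH_eq, (isKLElement_klC' w).1]

theorem flat_klC (w : W) : flat R L (klC R L w) = klC R L w⁻¹ := by
  have h : flat R L (klC' R L w) = klC' R L w⁻¹ := by
    refine IsKLElement.unique (w := w⁻¹) ⟨?_, fun y => ?_⟩ (isKLElement_klC' _)
    · rw [barH_eq, ← flat_barRing, ← barH_eq, (isKLElement_klC' w).1]
    · rw [repr_flat]
      have := (isKLElement_klC' (R := R) (L := L) w).2 y⁻¹
      simpa only [inv_eq_iff_eq_inv] using this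
  rw [klC_eq, klC_eq, flat_signRing, h]

theorem repr_signRing (h : Hecke R L) (y : W) : (heckeT R L).repr (signRing R L h) y =
    (-1 : ℤ) ^ cs.length y • barHom R ((heckeT R L).repr h y) := by
  conv_lhs => rw [← (heckeT R L).sum_repr h]
  simp only [map_sum, signRing_smul, signRing_heckeT, map_smul, map_zsmul, Module.Basis.repr_self,
    Finsupp.finsetSum_apply, Finsupp.smul_apply]
  rw [Finset.sum_eq_single y]
  · rw [Finsupp.single_eq_same, smul_eq_mul, mul_smul_comm, mul_one]
  · intro w _ hw
    rw [Finsupp.single_eq_of_ne hw.symm, smul_zero, smul_zero]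
  · simp

theorem repr_klC_sub (w y : W) :
    (heckeT R L).repr (klC R L w - (-1 : ℤ) ^ cs.length w • heckeT R L w) y =
      (-1 : ℤ) ^ cs.length y •
        barHom R ((heckeT R L).repr (klC' R L w) y - if y = w then 1 else 0) := by
  rw [map_sub, map_zsmul, Finsupp.sub_apply, Finsupp.smul_apply, Module.Basis.repr_self,
    Finsupp.single_apply, klC_eq, repr_signRing, map_sub, smul_sub]
  by_cases hy : y = w
  · subst hy
    rw [if_pos rfl, map_one]
  · rw [if_neg hy, if_neg (Ne.symm hy), map_zero, smul_zero, smul_zero]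

/-- The coefficients of `C_w` in the standard basis: up to the leading term `(-1)^{ℓ(w)} T_w`,
they lie in `ℤ[Γ_{>0}]`. -/
theorem coeff_repr_klC_sub (w y : W) (g : Γ)
    (h : ((heckeT R L).repr (klC R L w - (-1 : ℤ) ^ cs.length w • heckeT R L w) y).coeff g ≠ 0) :
    0 < g := by
  have h1 := ((isKLElement_klC' (R := R) (L := L) w).2 y (-g)).2
  rw [neg_lt_zero] at h1
  refine h1 fun h2 => h ?_
  rw [repr_klC_sub]
  rcases Nat.even_or_odd (cs.length y) with h' | h'
  · rw [h'.neg_one_pow, one_smul, coeff_barHom, h2]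
  · rw [h'.neg_one_pow, neg_smul, one_smul, AddMonoidAlgebra.coeff_neg, Finsupp.neg_apply,
      coeff_barHom, h2, neg_zero]

theorem klC_sub_mem (w : W) :
    klC R L w - (-1 : ℤ) ^ cs.length w • heckeT R L w ∈ intSpan R L (cs.length w) := fun y => by
  have h := klC'_sub_mem (R := R) (L := L) w y
  rw [map_sub, Finsupp.sub_apply, Module.Basis.repr_self, Finsupp.single_apply] at h
  simp only [eq_comm (a := w)] at h
  rw [repr_klC_sub]
  exact ⟨zsmul_mem (barHom_mem_intCoeffs R h.1) _,
    fun hy => by rw [h.2 hy, map_zero, smul_zero]⟩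

theorem heckeT_mem_span_klC (w : W) :
    heckeT R L w ∈ Submodule.span (AddMonoidAlgebra R Γ) (Set.range (klC R L)) := by
  induction hn : cs.length w using Nat.strong_induction_on generalizing w with
  | _ n ih =>
    have h1 : klC R L w - (-1 : ℤ) ^ cs.length w • heckeT R L w ∈
        Submodule.span (AddMonoidAlgebra R Γ) (Set.range (klC R L)) := by
      set k := klC R L w - (-1 : ℤ) ^ cs.length w • heckeT R L w with hk
      rw [← (heckeT R L).sum_repr k]
      refine sum_mem fun y _ => ?_
      by_cases hy : cs.length y < n
      · exact Submodule.smul_mem _ _ (ih _ hy y rfl)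
      · rw [(klC_sub_mem (R := R) (L := L) w y).2 (by omega), zero_smul]
        exact zero_mem _
    have h2 := zsmul_mem (sub_mem (Submodule.subset_span (Set.mem_range_self w)) h1)
      ((-1 : ℤ) ^ cs.length w)
    rwa [sub_sub_cancel, neg_one_pow_zsmul_zsmul] at h2

theorem span_klC : ⊤ ≤ Submodule.span (AddMonoidAlgebra R Γ) (Set.range (klC R L)) := by
  rw [← (heckeT R L).span_eq, Submodule.span_le]
  rintro _ ⟨w, rfl⟩
  exact heckeT_mem_span_klC w

variable (R L)

/-- Triangularity shows that the `C_w` span. A surjective endomorphism of a finite module over a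
commutative ring is injective, so they are also independent. -/
theorem constr_klC_bijective :
    Function.Bijective ((heckeT R L).constr (AddMonoidAlgebra R Γ) (klC R L)) := by
  have hs : Function.Surjective ((heckeT R L).constr (AddMonoidAlgebra R Γ) (klC R L)) := by
    rw [← LinearMap.range_eq_top, Module.Basis.constr_range]
    exact top_le_iff.1 span_klC
  have := Module.Finite.of_basis (heckeT R L)
  exact ⟨OrzechProperty.injective_of_surjective_endomorphism _ hs, hs⟩

/-- The basis `C_w` of the Hecke algebra. -/
def klBasis : Module.Basis W (AddMonoidAlgebra R Γ) (Hecke R L) :=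
  (heckeT R L).map (LinearEquiv.ofBijective _ (constr_klC_bijective R L))

theorem klBasis_apply (w : W) : klBasis R L w = klC R L w := by
  rw [klBasis, Module.Basis.map_apply, LinearEquiv.ofBijective_apply, Module.Basis.constr_basis]

theorem eq_sum_klCoord (h : Hecke R L) : h = ∑ z : W, klCoord R L h z • klC R L z := by
  have hex : ∃ c : W → AddMonoidAlgebra R Γ, h = ∑ z : W, c z • klC R L z := by
    refine ⟨fun z => (klBasis R L).repr h z, ?_⟩
    simp only [← klBasis_apply]
    exact ((klBasis R L).sum_repr h).symm
  exact Classical.epsilon_spec hex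

theorem klCoord_eq (h : Hecke R L) (z : W) : klCoord R L h z = (klBasis R L).repr h z := by
  have h2 := congrArg (klBasis R L).repr (eq_sum_klCoord R L h)
  simp only [← klBasis_apply] at h2
  have h3 := (klBasis R L).repr_sum_self (klCoord R L h)
  rw [h2, h3]

/-- `T_s + v_s⁻¹` is bar-invariant, and positivity of `L(s)` is what puts `v_s⁻¹` in `ℤ[Γ_{<0}]`;
uniqueness then identifies it with `C'_s`. -/
theorem klC_simple {i : B} (hi : 0 < L (cs.simple i)) :
    klC R L (cs.simple i) = eps R (L (cs.simple i)) • 1 - heckeT R L (cs.simple i) := by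
  have h : klC' R L (cs.simple i) =
      heckeT R L (cs.simple i) + eps R (-L (cs.simple i)) • 1 := by
    refine (isKLElement_klC' _).unique ⟨?_, fun y => ?_⟩
    · rw [barH_eq, map_add, barRing_heckeT, cs.inv_simple, inverse_heckeT_simple, barRing_smul,
        map_one, barHom_eps, neg_neg, xi, sub_smul]
      abel
    · have : (if y = cs.simple i then (1 : AddMonoidAlgebra R Γ) else 0) =
        if cs.simple i = y then 1 else 0 := by simp only [eq_comm]
      rw [map_add, Finsupp.add_apply, Module.Basis.repr_self, Finsupp.single_apply, this,
        add_sub_cancel_left, map_smul, ← heckeT_one, Module.Basis.repr_self, Finsupp.smul_apply,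
        Finsupp.single_apply]
      split_ifs
      · rw [smul_eq_mul, mul_one]
        exact isIntNeg_eps R (by rwa [neg_lt_zero])
      · rw [smul_zero]
        exact isIntNeg_zero R
  rw [klC_eq, h, map_add, signRing_heckeT, signRing_smul, map_one, barHom_eps, neg_neg]
  simp
  abel

end KLBasis

/-! ### Two-sided ideals of the Kazhdan–Lusztig preorder -/

section CellOrder

variable {B W Γ : Type*} [Group W] [Fintype W] {M : CoxeterMatrix B} {cs : CoxeterSystem M W}
  [AddCommGroup Γ] [LinearOrder Γ] [IsOrderedAddMonoid Γ] {R : Subring ℂ} {L : WeightFunction cs Γ}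

theorem klCoord_add (x y : Hecke R L) (z : W) :
    klCoord R L (x + y) z = klCoord R L x z + klCoord R L y z := by
  simp only [klCoord_eq, map_add, Finsupp.add_apply]

theorem klCoord_smul (a : AddMonoidAlgebra R Γ) (x : Hecke R L) (z : W) :
    klCoord R L (a • x) z = a * klCoord R L x z := by
  simp only [klCoord_eq, map_smul, Finsupp.smul_apply, smul_eq_mul]

theorem klCoord_zero (z : W) : klCoord R L 0 z = 0 := by
  simp only [klCoord_eq, map_zero, Finsupp.zero_apply]

theorem klCoord_klC (w z : W) : klCoord R L (klC R L w) z = if z = w then 1 else 0 := by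
  rw [klCoord_eq, ← klBasis_apply, Module.Basis.repr_self, Finsupp.single_apply]
  simp only [eq_comm]

theorem klCoord_sum {ι : Type*} (s : Finset ι) (f : ι → Hecke R L) (z : W) :
    klCoord R L (∑ i ∈ s, f i) z = ∑ i ∈ s, klCoord R L (f i) z := by
  simp only [klCoord_eq, map_sum, Finsupp.finsetSum_apply]

theorem leLR_refl (w : W) : leLR R L w w := Relation.ReflTransGen.refl

theorem leLR.trans {x y z : W} (h : leLR R L x y) (h' : leLR R L y z) : leLR R L x z :=
  Relation.ReflTransGen.trans h h'

theorem eqvLR_refl (w : W) : eqvLR R L w w := ⟨leLR_refl w, leLR_refl w⟩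

theorem eqvLR.symm {x y : W} (h : eqvLR R L x y) : eqvLR R L y x := ⟨h.2, h.1⟩

theorem eqvLR.trans {x y z : W} (h : eqvLR R L x y) (h' : eqvLR R L y z) : eqvLR R L x z :=
  ⟨h.1.trans h'.1, h'.2.trans h.2⟩

variable (R L) in
/-- The span of the `C_y` with `y ≤_LR w`. -/
def lowerIdeal (w : W) : Submodule (AddMonoidAlgebra R Γ) (Hecke R L) where
  carrier := {h | ∀ y, klCoord R L h y ≠ 0 → leLR R L y w}
  zero_mem' y hy := absurd (klCoord_zero y) hy
  add_mem' {a b} ha hb y hy := by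
    rw [klCoord_add] at hy
    by_cases h : klCoord R L a y = 0
    · exact hb y fun h' => hy (by rw [h, h', add_zero])
    · exact ha y h
  smul_mem' a x hx y hy := by
    rw [klCoord_smul] at hy
    exact hx y fun h => hy (by rw [h, mul_zero])

theorem klC_mem_lowerIdeal {y w : W} (h : leLR R L y w) : klC R L y ∈ lowerIdeal R L w := by
  intro z hz
  rw [klCoord_klC] at hz
  by_cases hzy : z = y
  · rwa [hzy]
  · rw [if_neg hzy] at hz
    exact absurd rfl hz

theorem lowerIdeal_induction {P : Hecke R L → Prop} (w : W)
    (hsum : ∀ f : W → Hecke R L, (∀ z, P (f z)) → P (∑ z, f z))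
    (hsmul : ∀ (a : AddMonoidAlgebra R Γ) h, P h → P (a • h))
    (hC : ∀ y, leLR R L y w → P (klC R L y)) (h0 : P 0) {h : Hecke R L}
    (hh : h ∈ lowerIdeal R L w) : P h := by
  rw [eq_sum_klCoord R L h]
  refine hsum _ fun z => ?_
  by_cases hz : klCoord R L h z = 0
  · rwa [hz, zero_smul]
  · exact hsmul _ _ (hC z (hh z hz))

theorem heckeT_simple_eq (hL : ∀ i : B, 0 < L (cs.simple i))
    (i : B) :
    heckeT R L (cs.simple i) = eps R (L (cs.simple i)) • 1 - klC R L (cs.simple i) := by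
  rw [klC_simple R L (hL i), sub_sub_cancel]

/-- `T_s` is a scalar minus `C_s`, and multiplication by `C_s` is one step of the preorder. Since
the `T_s` generate the algebra, the span is a left ideal, and symmetrically a right ideal. -/
theorem simple_mul_mem_lowerIdeal (hL : ∀ i : B, 0 < L (cs.simple i))
    (i : B) {w : W} {h : Hecke R L} (hh : h ∈ lowerIdeal R L w) :
    heckeT R L (cs.simple i) * h ∈ lowerIdeal R L w := by
  refine lowerIdeal_induction (P := fun h => heckeT R L (cs.simple i) * h ∈ lowerIdeal R L w) w
    (fun f hf => ?_) (fun a h hh => ?_) (fun y hy => ?_) ?_ hh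
  · rw [Finset.mul_sum]
    exact sum_mem fun z _ => hf z
  · rw [mul_smul_comm]
    exact Submodule.smul_mem _ _ hh
  · rw [heckeT_simple_eq hL, sub_mul, smul_mul_assoc, one_mul]
    refine sub_mem (Submodule.smul_mem _ _ (klC_mem_lowerIdeal hy)) fun z hz => ?_
    exact (Relation.ReflTransGen.single ⟨i, Or.inl hz⟩ : leLR R L z y).trans hy
  · rw [mul_zero]
    exact zero_mem _

theorem mul_simple_mem_lowerIdeal (hL : ∀ i : B, 0 < L (cs.simple i))
    (i : B) {w : W} {h : Hecke R L} (hh : h ∈ lowerIdeal R L w) :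
    h * heckeT R L (cs.simple i) ∈ lowerIdeal R L w := by
  refine lowerIdeal_induction (P := fun h => h * heckeT R L (cs.simple i) ∈ lowerIdeal R L w) w
    (fun f hf => ?_) (fun a h hh => ?_) (fun y hy => ?_) ?_ hh
  · rw [Finset.sum_mul]
    exact sum_mem fun z _ => hf z
  · rw [smul_mul_assoc]
    exact Submodule.smul_mem _ _ hh
  · rw [heckeT_simple_eq hL, mul_sub, mul_smul_comm, mul_one]
    refine sub_mem (Submodule.smul_mem _ _ (klC_mem_lowerIdeal hy)) fun z hz => ?_
    exact (Relation.ReflTransGen.single ⟨i, Or.inr hz⟩ : leLR R L z y).trans hy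
  · rw [zero_mul]
    exact zero_mem _

theorem mul_mem_lowerIdeal_left (hL : ∀ i : B, 0 < L (cs.simple i))
    (x : Hecke R L) {w : W} {h : Hecke R L}
    (hh : h ∈ lowerIdeal R L w) : x * h ∈ lowerIdeal R L w := by
  rw [← (heckeT R L).sum_repr x, Finset.sum_mul]
  refine sum_mem fun v hv => ?_
  clear hv
  rw [smul_mul_assoc]
  refine Submodule.smul_mem _ _ ?_
  induction v using length_induction cs with
  | one => rwa [heckeT_one, one_mul]
  | step i v hv ih =>
    rw [← heckeT_simple_mul_of_lt R L hv, mul_assoc]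
    exact simple_mul_mem_lowerIdeal hL i ih

theorem mul_mem_lowerIdeal_right (hL : ∀ i : B, 0 < L (cs.simple i))
    (x : Hecke R L) {w : W} {h : Hecke R L}
    (hh : h ∈ lowerIdeal R L w) : h * x ∈ lowerIdeal R L w := by
  rw [← (heckeT R L).sum_repr x, Finset.mul_sum]
  refine sum_mem fun v hv => ?_
  clear hv
  rw [mul_smul_comm]
  refine Submodule.smul_mem _ _ ?_
  induction v using length_induction cs generalizing h with
  | one => rwa [heckeT_one, mul_one]
  | step i v hv ih =>
    rw [← heckeT_simple_mul_of_lt R L hv, ← mul_assoc]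
    exact ih (mul_simple_mem_lowerIdeal hL i hh)

theorem leLR_of_klCoord_mul_ne_zero (hL : ∀ i : B, 0 < L (cs.simple i))
    {x : Hecke R L} {y w : W}
    (h : klCoord R L (x * klC R L w) y ≠ 0) : leLR R L y w :=
  mul_mem_lowerIdeal_left hL x (klC_mem_lowerIdeal (leLR_refl w)) y h

theorem klCoord_flat (h : Hecke R L) (z : W) :
    klCoord R L (flat R L h) z = klCoord R L h z⁻¹ := by
  conv_lhs => rw [eq_sum_klCoord R L h]
  simp only [flat_sum, flat_smul, flat_klC, klCoord_sum, klCoord_smul, klCoord_klC]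
  rw [Finset.sum_eq_single z⁻¹]
  · simp
  · intro w _ hw
    rw [if_neg (fun h => hw (by rw [h, inv_inv])), mul_zero]
  · simp

theorem hConst_inv (x y z : W) : hConst R L x⁻¹ y⁻¹ z⁻¹ = hConst R L y x z := by
  rw [hConst, hConst, ← inv_inv z, ← klCoord_flat, flat_mul, flat_klC, flat_klC, inv_inv, inv_inv,
    inv_inv]

/-- The antiautomorphism `flat` sends `C_w` to `C_{w⁻¹}` and exchanges left with right factors,
while a step of the preorder treats both sides alike. -/
theorem leLR.inv {y w : W} (h : leLR R L y w) : leLR R L y⁻¹ w⁻¹ := by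
  induction h with
  | refl => exact leLR_refl _
  | tail _ h ih =>
    refine ih.tail ?_
    obtain ⟨i, h⟩ := h
    refine ⟨i, ?_⟩
    rw [← cs.inv_simple i, hConst_inv, hConst_inv]
    exact h.symm

end CellOrder

/-! ### The regular character of a finite group -/

section RegularCharacter

open CategoryTheory

variable {W : Type*} [Group W]

/-- Connects categorical simplicity with the absence of invariant subspaces: the range of a nonzero
monomorphism is a nonzero invariant subspace, hence everything, and isomorphisms are detected on
underlying vector spaces. -/
theorem FDRep_simple_of {V : Type} [AddCommGroup V] [Module ℂ V] [FiniteDimensional ℂ V]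
    [Nontrivial V] (σ : Representation ℂ W V)
    (h : ∀ N : Submodule ℂ V, (∀ g, ∀ x ∈ N, σ g x ∈ N) → N = ⊥ ∨ N = ⊤) :
    Simple (FDRep.of σ) := by
  refine ⟨fun {Y} f hf => ⟨fun hi h0 => ?_, fun h0 => ?_⟩⟩
  · obtain ⟨v, hv⟩ := exists_ne (0 : V)
    obtain ⟨k, -, hk⟩ := hi.out
    rw [h0, Limits.comp_zero] at hk
    have h2 : (𝟙 (FDRep.of σ) : FDRep.of σ ⟶ FDRep.of σ).hom.hom.hom v =
        (0 : FDRep.of σ ⟶ FDRep.of σ).hom.hom.hom v := by rw [hk]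
    exact hv h2
  · let F : Y.V →ₗ[ℂ] V := f.hom.hom.hom
    have hcomm : ∀ g x, F (Y.ρ g x) = σ g (F x) := fun g x =>
      congrArg (fun k => k.hom.hom x) (f.comm g)
    have hinj : Function.Injective F := by
      have h1 : Mono ((Action.forget _ _).map f) := inferInstance
      have h2 := (forget₂ (FGModuleCat ℂ) (ModuleCat ℂ)).map_mono ((Action.forget _ _).map f)
      exact (ModuleCat.mono_iff_injective _).1 h2
    have hsurj : Function.Surjective F := by
      rw [← LinearMap.range_eq_top]
      refine (h (LinearMap.range F) ?_).resolve_left fun hb => h0 ?_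
      · rintro g _ ⟨x, rfl⟩
        exact ⟨Y.ρ g x, hcomm g x⟩
      · rw [LinearMap.range_eq_bot] at hb
        ext x
        exact LinearMap.congr_fun hb x
    have h3 : IsIso ((forget₂ (FGModuleCat ℂ) (ModuleCat ℂ)).map ((Action.forget _ _).map f)) :=
      (ConcreteCategory.isIso_iff_bijective _).2 ⟨hinj, hsurj⟩
    have h4 : IsIso ((Action.forget _ _).map f) :=
      isIso_of_reflects_iso _ (forget₂ (FGModuleCat ℂ) (ModuleCat ℂ))
    exact isIso_of_reflects_iso f (Action.forget _ _)

theorem finrank_ne_zero_of_simple (V : FDRep ℂ W) [Simple V] : Module.finrank ℂ V ≠ 0 := by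
  intro h
  have : Subsingleton V := Module.finrank_zero_iff.1 h
  refine id_nonzero V ?_
  ext x
  exact Subsingleton.elim (α := V) _ _

/-- The character of a simple module over the group algebra is the character of a member of a
complete family of irreducible representations. -/
theorem exists_trace_eq_character {Λ : Type*} {E : Λ → FDRep ℂ W} (hE : IsIrrFamily E)
    (N : Type*) [AddCommGroup N] [Module ℂ N] [Module (MonoidAlgebra ℂ W) N]
    [IsScalarTower ℂ (MonoidAlgebra ℂ W) N] [FiniteDimensional ℂ N]
    [IsSimpleModule (MonoidAlgebra ℂ W) N] :
    ∃ l, Module.finrank ℂ N = Module.finrank ℂ (E l) ∧ ∀ g : W,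
      LinearMap.trace ℂ N (Algebra.lsmul ℂ ℂ N (MonoidAlgebra.single g (1 : ℂ))) =
        (E l).character g := by
  -- A choice of coordinates moves `N`, which may live in any universe, to a space in the universe
  -- of `ℂ`, as `FDRep ℂ W` requires.
  let b : N ≃ₗ[ℂ] (Fin (Module.finrank ℂ N) → ℂ) := (Module.finBasis ℂ N).equivFun
  let τ : W →* Module.End ℂ N := Representation.ofModule' N
  have hτ : ∀ g, τ g = Algebra.lsmul ℂ ℂ N (MonoidAlgebra.single g (1 : ℂ)) := fun g => rfl
  let σ : Representation ℂ W (Fin (Module.finrank ℂ N) → ℂ) :=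
    { toFun := fun g => b.conj (τ g)
      map_one' := by rw [map_one]; exact b.conj_id
      map_mul' := fun g h => by rw [map_mul]; exact b.conj_comp _ _ }
  have hσ : ∀ g x, σ g x = b (τ g (b.symm x)) := fun g x => b.conj_apply_apply _ _
  have hN : Nontrivial N := IsSimpleModule.nontrivial (MonoidAlgebra ℂ W) N
  have : Nontrivial (Fin (Module.finrank ℂ N) → ℂ) := b.symm.toEquiv.nontrivial
  have hs : Simple (FDRep.of σ) := by
    refine FDRep_simple_of σ fun P hP => ?_
    let Q : Submodule (MonoidAlgebra ℂ W) N :=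
      { carrier := {x | b x ∈ P}
        zero_mem' := by simp
        add_mem' := fun {x y} hx hy => by
          simp only [Set.mem_ofPred_eq, map_add] at *
          exact add_mem hx hy
        smul_mem' := fun a x hx => by
          simp only [Set.mem_ofPred_eq] at *
          induction a using MonoidAlgebra.induction_linear with
          | zero => simp
          | add a c ha hc => rw [add_smul, map_add]; exact add_mem ha hc
          | single g r =>
            have h1 := P.smul_mem r (hP g _ hx)
            rw [hσ, b.symm_apply_apply, hτ, Algebra.lsmul_coe, ← map_smul, ← smul_assoc] at h1
            simpa using h1 }
    have hQ : ∀ x, x ∈ Q ↔ b x ∈ P := fun x => Iff.rfl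
    rcases eq_bot_or_eq_top Q with h | h
    · left
      rw [eq_bot_iff]
      intro x hx
      have : b.symm x ∈ Q := by rwa [hQ, b.apply_symm_apply]
      rw [h, Submodule.mem_bot] at this
      simpa using this
    · right
      rw [eq_top_iff]
      intro x _
      have : b.symm x ∈ Q := by rw [h]; trivial
      rwa [hQ, b.apply_symm_apply] at this
  obtain ⟨l, ⟨i⟩⟩ := hE.complete (FDRep.of σ) hs
  have hc : ∀ g, LinearMap.trace ℂ N (τ g) = (E l).character g := by
    intro g
    rw [← FDRep.char_iso i]
    exact (LinearMap.trace_conj' (τ g) b).symm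
  refine ⟨l, ?_, hc⟩
  have := hc 1
  rw [FDRep.char_one, map_one, LinearMap.trace_one] at this
  exact_mod_cast this

variable [Fintype W]

theorem sum_character_mul_character_inv {Λ : Type*} {E : Λ → FDRep ℂ W} (hE : IsIrrFamily E)
    (l m : Λ) : ∑ g : W, (E l).character g * (E m).character g⁻¹ =
      if l = m then (Fintype.card W : ℂ) else 0 := by
  have := hE.simple l
  have := hE.simple m
  have hW : (Nat.card W : ℂ) ≠ 0 := by simp
  have : Invertible (Nat.card W : ℂ) := invertibleOfNonzero hW
  have h := FDRep.char_orthonormal (E l) (E m)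
  rw [inv_mul_eq_iff_eq_mul₀ hW] at h
  rw [h]
  by_cases hlm : l = m
  · subst hlm
    rw [if_pos ⟨Iso.refl _⟩, if_pos rfl, mul_one, Nat.card_eq_fintype_card]
  · rw [if_neg (fun hi => hlm (hE.inequivalent l m hi)), if_neg hlm, mul_zero]

/-- The decomposition of the regular character of a finite group. -/
theorem sum_finrank_mul_character {Λ : Type*} [Fintype Λ] {E : Λ → FDRep ℂ W}
    (hE : IsIrrFamily E) (w : W) :
    ∑ l, (Module.finrank ℂ (E l) : ℂ) * (E l).character w =
      if w = 1 then (Fintype.card W : ℂ) else 0 := by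
  set f : W → ℂ := fun g => (if g = 1 then (Fintype.card W : ℂ) else 0) -
    ∑ l, (Module.finrank ℂ (E l) : ℂ) * (E l).character g with hf
  suffices h : ∀ g, f g = 0 from (sub_eq_zero.1 (h w)).symm
  have hclass : ∀ g h, f (h * g * h⁻¹) = f g := by
    intro g h
    simp only [hf, FDRep.char_conj, conj_eq_one_iff]
  -- The defect `f` between the two sides is a class function, so it defines a central element `z`.
  -- It remains to show that `z` vanishes.
  set z : MonoidAlgebra ℂ W := ∑ g, MonoidAlgebra.single g (f g⁻¹) with hz
  have hcoeff : ∀ g, z.coeff g = f g⁻¹ := by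
    intro g
    simp [hz, Finsupp.single_apply]
  have hcomm : ∀ h : W, MonoidAlgebra.single h (1 : ℂ) * z = z * MonoidAlgebra.single h 1 := by
    intro h
    simp only [hz, Finset.mul_sum, Finset.sum_mul, MonoidAlgebra.single_mul_single, one_mul, mul_one]
    refine Finset.sum_bij' (fun g _ => h * g * h⁻¹) (fun g _ => h⁻¹ * g * h) ?_ ?_ ?_ ?_ ?_
    · simp
    · simp
    · simp [mul_assoc]
    · simp [mul_assoc]
    · intro g _
      rw [← hclass g⁻¹ h]
      simp [mul_assoc]
  have hsingle : ∀ (g : W) (r : ℂ), MonoidAlgebra.single g r = r • MonoidAlgebra.single g (1 : ℂ) := by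
    simp
  have hcentral : ∀ a, a * z = z * a := by
    intro a
    induction a using MonoidAlgebra.induction_linear with
    | zero => simp
    | add a c ha hc => rw [add_mul, mul_add, ha, hc]
    | single g r =>
      rw [hsingle, smul_mul_assoc, hcomm, mul_smul_comm]
  -- On each simple module `z` is a scalar by Schur's lemma, and its trace there is zero by
  -- orthogonality of characters. Hence `z` lies in every maximal left ideal, and the Jacobson
  -- radical is zero because the group algebra is semisimple.
  have hz0 : z = 0 := by
    have hj : z ∈ Ring.jacobson (MonoidAlgebra ℂ W) := by
      rw [Ring.jacobson, Module.jacobson, Submodule.mem_sInf]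
      intro m hm
      have hm : IsCoatom m := hm
      have hs : IsSimpleModule (MonoidAlgebra ℂ W) (MonoidAlgebra ℂ W ⧸ m) :=
        isSimpleModule_iff_isCoatom.2 hm
      have hfd : FiniteDimensional ℂ (MonoidAlgebra ℂ W ⧸ m) :=
        Module.Finite.trans (R := ℂ) (MonoidAlgebra ℂ W) _
      obtain ⟨l, hdim, htr⟩ := exists_trace_eq_character hE (MonoidAlgebra ℂ W ⧸ m)
      let Z : Module.End (MonoidAlgebra ℂ W) (MonoidAlgebra ℂ W ⧸ m) :=
        { toFun := fun x => z • x
          map_add' := smul_add z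
          map_smul' := fun a x => by simp only [RingHom.id_apply, smul_smul, hcentral] }
      obtain ⟨c, hc⟩ := (IsSimpleModule.algebraMap_end_bijective_of_isAlgClosed
        (A := MonoidAlgebra ℂ W) (V := MonoidAlgebra ℂ W ⧸ m) ℂ).2 Z
      have hzc : ∀ x : MonoidAlgebra ℂ W ⧸ m, z • x = c • x := fun x =>
        (LinearMap.congr_fun hc x).symm
      have h1 : Algebra.lsmul ℂ ℂ (MonoidAlgebra ℂ W ⧸ m) z =
          c • (1 : Module.End ℂ (MonoidAlgebra ℂ W ⧸ m)) := LinearMap.ext hzc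
      have h2 : LinearMap.trace ℂ _ (Algebra.lsmul ℂ ℂ (MonoidAlgebra ℂ W ⧸ m) z) =
          ∑ g, f g⁻¹ * (E l).character g := by
        rw [hz, map_sum, map_sum]
        refine Finset.sum_congr rfl fun g _ => ?_
        rw [← htr, hsingle g (f g⁻¹), map_smul, map_smul, smul_eq_mul]
      have h3 : ∑ g, f g⁻¹ * (E l).character g = 0 := by
        simp only [hf, sub_mul, Finset.sum_sub_distrib, inv_eq_one, ite_mul, zero_mul,
          Finset.sum_ite_eq', Finset.mem_univ, if_true, FDRep.char_one, Finset.sum_mul]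
        rw [Finset.sum_comm, Finset.sum_eq_single l]
        · have := sum_character_mul_character_inv hE l l
          rw [if_pos rfl] at this
          rw [sub_eq_zero, ← this, Finset.sum_mul]
          exact Finset.sum_congr rfl fun g _ => by ring
        · intro l' _ hl'
          have := sum_character_mul_character_inv hE l l'
          rw [if_neg hl'.symm] at this
          simp only [mul_assoc, ← Finset.mul_sum, mul_comm ((E l').character _)]
          rw [this, mul_zero]
        · simp
      have hd : (Module.finrank ℂ (MonoidAlgebra ℂ W ⧸ m) : ℂ) ≠ 0 := by
        have := hE.simple l
        rw [hdim]
        exact_mod_cast finrank_ne_zero_of_simple (E l)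
      have hc0 : c = 0 := by
        rw [h3, h1, map_smul, LinearMap.trace_one, smul_eq_mul, mul_eq_zero] at h2
        exact h2.resolve_right hd
      have h4 := hzc (Submodule.Quotient.mk 1)
      rw [hc0, zero_smul, ← Submodule.Quotient.mk_smul, smul_eq_mul, mul_one,
        Submodule.Quotient.mk_eq_zero] at h4
      exact h4
    rwa [IsSemisimpleRing.jacobson_eq_bot, Submodule.mem_bot] at hj
  intro g
  rw [← inv_inv g, ← hcoeff, hz0]
  simp

end RegularCharacter

/-! ### Split families of representations and the Schur relations -/

section HeckeReps

variable {B W : Type*} [Group W] {M : CoxeterMatrix B} {cs : CoxeterSystem M W}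

namespace HeckeRule

variable {A S : Type*} [CommRing A] [Ring S] [Algebra A S] {ζ : B → A} {U : W → S}

theorem simple_mul (hU : HeckeRule cs ζ U) (i : B) (w : W) :
    U (cs.simple i) * U w = U (cs.simple i * w) +
      (if cs.length w < cs.length (cs.simple i * w) then 0 else ζ i) • U w := by
  split_ifs with h
  · rw [hU.mul_of_lt i w h, zero_smul, add_zero]
  · exact hU.mul_of_gt i w h

/-- Write the element as `s w`. If `s w t` is longer than `s w`, then `w t` is longer than `w`, so
induction applies to `w`, and the left rule then applies to `w t`. -/
theorem mul_simple_of_lt (hU : HeckeRule cs ζ U) (j : B) (w : W)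
    (h : cs.length w < cs.length (w * cs.simple j)) :
    U w * U (cs.simple j) = U (w * cs.simple j) := by
  induction w using length_induction cs with
  | one => rw [hU.one, one_mul, one_mul]
  | step i w hw ih =>
    have h1 := cs.length_simple_mul w i
    have h2 := cs.length_mul_simple w j
    have h3 := cs.length_simple_mul (w * cs.simple j) i
    rw [mul_assoc] at h ⊢
    rw [← hU.mul_of_lt i w hw, mul_assoc, ih (by omega), hU.mul_of_lt i _ (by omega)]

theorem mul_simple (hU : HeckeRule cs ζ U) (j : B) (w : W) :
    U w * U (cs.simple j) = U (w * cs.simple j) +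
      (if cs.length w < cs.length (w * cs.simple j) then 0 else ζ j) • U w := by
  split_ifs with h
  · rw [hU.mul_simple_of_lt j w h, zero_smul, add_zero]
  · have h1 := cs.length_mul_simple w j
    have h2 := hU.mul_simple_of_lt j (w * cs.simple j)
      (by rw [cs.simple_mul_simple_cancel_right]; omega)
    rw [cs.simple_mul_simple_cancel_right] at h2
    rw [← h2, mul_assoc, hU.mul_self, mul_add, mul_one, mul_smul_comm]

theorem map {T : Type*} [Ring T] {A' : Type*} [CommRing A'] [Algebra A' T]
    (hU : HeckeRule cs ζ U) (F : S →+* T) {ζ' : B → A'}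
    (hF : ∀ i x, F (ζ i • x) = ζ' i • F x) : HeckeRule cs ζ' (fun w => F (U w)) where
  one := by rw [hU.one, map_one]
  mul_of_lt i w h := by rw [← map_mul, hU.mul_of_lt i w h]
  mul_self i := by rw [← map_mul, hU.mul_self, map_add, map_one, hF]

end HeckeRule

theorem length_induction_right (cs : CoxeterSystem M W) {P : W → Prop} (one : P 1)
    (step : ∀ i w, cs.length w < cs.length (w * cs.simple i) → P w → P (w * cs.simple i)) (w : W) :
    P w := by
  suffices h : ∀ v : W, P v⁻¹ by simpa using h w⁻¹
  intro v
  induction v using length_induction cs with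
  | one => rwa [inv_one]
  | step i v hv ih =>
    rw [mul_inv_rev, cs.inv_simple]
    refine step i _ ?_ ih
    rwa [← cs.length_inv (v⁻¹ * _), mul_inv_rev, inv_inv, cs.inv_simple, cs.length_inv]

section Intertwiner

variable [Fintype W] {𝕂 : Type*} [Field 𝕂] {ζ : B → 𝕂} {n m : ℕ}
  {σ : W → Matrix (Fin n) (Fin n) 𝕂} {τ : W → Matrix (Fin m) (Fin m) 𝕂}

/-- The sum of the `σ(w) X τ(w⁻¹)` intertwines `τ` with `σ`. -/
theorem intertwiner (hσ : HeckeRule cs ζ σ) (hτ : HeckeRule cs ζ τ)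
    (X : Matrix (Fin n) (Fin m) 𝕂) (v : W) :
    σ v * ∑ w, σ w * X * τ w⁻¹ = (∑ w, σ w * X * τ w⁻¹) * τ v := by
  induction v using length_induction cs with
  | one => rw [hσ.one, hτ.one, Matrix.one_mul, Matrix.mul_one]
  | step i v hv ih =>
    -- Multiplication by `T_s` produces the same correction terms on both sides, since `w` and `w⁻¹`
    -- have the same length; the main terms agree after replacing `w` by `s w`.
    have key : σ (cs.simple i) * ∑ w, σ w * X * τ w⁻¹ =
        (∑ w, σ w * X * τ w⁻¹) * τ (cs.simple i) := by
      have h1 : ∀ w : W, (τ w⁻¹ * τ (cs.simple i)) = τ (cs.simple i * w)⁻¹ +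
          (if cs.length w < cs.length (cs.simple i * w) then 0 else ζ i) • τ w⁻¹ := by
        intro w
        rw [hτ.mul_simple, mul_inv_rev, cs.inv_simple, cs.length_inv,
          ← cs.length_inv (w⁻¹ * cs.simple i), mul_inv_rev, inv_inv, cs.inv_simple]
      rw [Matrix.mul_sum, Matrix.sum_mul]
      simp only [Matrix.mul_assoc, h1]
      simp only [← Matrix.mul_assoc, hσ.simple_mul, Matrix.add_mul, Matrix.mul_add,
        Finset.sum_add_distrib, Matrix.smul_mul, Matrix.mul_smul]
      congr 1
      refine Fintype.sum_equiv (Equiv.mulLeft (cs.simple i)) _ _ fun w => ?_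
      simp
    rw [← hσ.mul_of_lt i v hv, ← hτ.mul_of_lt i v hv, Matrix.mul_assoc, ih, ← Matrix.mul_assoc,
      key, Matrix.mul_assoc]

end Intertwiner

/-- A family of matrix representations of the Hecke algebra over a field `𝕂` whose characters take
values in a subring `A`, with the regular character as their specialisation along `θ : A → ℂ`. -/
structure IsSplitFamily {A 𝕂 Λ : Type*} [CommRing A] [Field 𝕂] [Fintype Λ] [Fintype W]
    (cs : CoxeterSystem M W) (j : A →+* 𝕂) (θ : A →+* ℂ) (ξ : B → A) (χ : Λ → W → ℂ) {d : Λ → ℕ}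
    (σ : ∀ l, W → Matrix (Fin (d l)) (Fin (d l)) 𝕂) : Prop where
  inj : Function.Injective j
  xi_zero : ∀ i, θ (ξ i) = 0
  rule : ∀ l, HeckeRule cs (fun i => j (ξ i)) (σ l)
  trace : ∀ l w, ∃ a, j a = (σ l w).trace ∧ θ a = χ l w
  regular : ∀ w, ∑ l, (d l : ℂ) * χ l w = if w = 1 then (Fintype.card W : ℂ) else 0

namespace IsSplitFamily

variable {A 𝕂 Λ : Type*} [CommRing A] [Field 𝕂] [Fintype Λ] [Fintype W]
  {j : A →+* 𝕂} {θ : A →+* ℂ} {ξ : B → A} {χ : Λ → W → ℂ} {d : Λ → ℕ}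
  {σ : ∀ l, W → Matrix (Fin (d l)) (Fin (d l)) 𝕂}

/-- Expanding the product in the standard basis introduces correction terms with a factor `ξ`, which
specialises to zero; what survives is the group multiplication. -/
theorem trace_mul (H : IsSplitFamily cs j θ ξ χ σ) (l : Λ) (x y : W) :
    ∃ a, j a = (σ l x * σ l y).trace ∧ θ a = χ l (x * y) := by
  induction x using length_induction_right cs generalizing y with
  | one => rw [(H.rule l).one, one_mul, one_mul]; exact H.trace l y
  | step i x hx ih =>
    rw [← (H.rule l).mul_simple_of_lt i x hx, mul_assoc, mul_assoc, (H.rule l).simple_mul, mul_add,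
      mul_smul_comm, Matrix.trace_add, Matrix.trace_smul, smul_eq_mul]
    obtain ⟨a, ha, ha'⟩ := ih (cs.simple i * y)
    obtain ⟨b, hb, hb'⟩ := ih y
    split_ifs
    · exact ⟨a, by rw [ha, zero_mul, add_zero], ha'⟩
    · exact ⟨a + ξ i * b, by rw [map_add, map_mul, ha, hb],
        by rw [map_add, map_mul, H.xi_zero, zero_mul, add_zero, ha']⟩

/-- The Gram matrix formed from the traces of `σ(x) σ(y⁻¹)`, weighted by degree, specialises to
`|W|` times the identity. Its determinant is therefore nonzero before specialisation, while a linear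
relation among the `σ(w)` valid in all members of the family would give it a kernel. -/
theorem eq_zero_of_forall_sum_smul_eq_zero (H : IsSplitFamily cs j θ ξ χ σ) (a : W → 𝕂)
    (h : ∀ l, ∑ w, a w • σ l w = 0) : a = 0 := by
  choose g hg hg' using fun l x y => H.trace_mul l x y
  let G : Matrix W W A := Matrix.of fun x y => ∑ l, (d l : A) * g l x y⁻¹
  have hG : G.map θ = Matrix.diagonal fun _ => (Fintype.card W : ℂ) := by
    ext x y
    simp only [G, Matrix.map_apply, Matrix.of_apply, map_sum, map_mul, map_natCast, hg', H.regular,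
      Matrix.diagonal_apply, mul_inv_eq_one]
  have hdet : (G.map j).det ≠ 0 := by
    intro h0
    have h1 : j G.det = 0 := by rw [RingHom.map_det]; exact h0
    rw [map_eq_zero_iff j H.inj] at h1
    have h2 : θ G.det = 0 := by rw [h1, map_zero]
    rw [RingHom.map_det, RingHom.mapMatrix_apply, hG, Matrix.det_diagonal] at h2
    simp at h2
  refine Matrix.eq_zero_of_vecMul_eq_zero hdet ?_
  ext y
  simp only [Matrix.vecMul, dotProduct, G, Matrix.map_apply, Matrix.of_apply, map_sum, map_mul,
    map_natCast, hg, Finset.mul_sum, Pi.zero_apply]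
  rw [Finset.sum_comm]
  refine Finset.sum_eq_zero fun l _ => ?_
  have h1 : (((∑ w, a w • σ l w) * σ l y⁻¹).trace) = 0 := by rw [h, zero_mul, Matrix.trace_zero]
  rw [Finset.sum_mul, Matrix.trace_sum] at h1
  simp only [smul_mul_assoc, Matrix.trace_smul, smul_eq_mul] at h1
  rw [← mul_zero (d l : 𝕂), ← h1, Finset.mul_sum]
  exact Finset.sum_congr rfl fun w _ => by ring

theorem sum_sq (H : IsSplitFamily cs j θ ξ χ σ) : ∑ l, d l * d l = Fintype.card W := by
  have h1 : ∀ l, χ l 1 = d l := by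
    intro l
    obtain ⟨a, ha, ha'⟩ := H.trace l 1
    rw [(H.rule l).one, Matrix.trace_one, Fintype.card_fin, ← map_natCast j] at ha
    rw [← ha', H.inj ha, map_natCast]
  have h2 := H.regular 1
  simp only [h1, if_true] at h2
  exact_mod_cast h2

/-- The map from `𝕂^W` to the product of the matrix algebras is injective, and by `sum_sq` the
dimensions agree. So arbitrary matrices can be prescribed in the different factors simultaneously.
-/
theorem exists_sum_smul_eq (H : IsSplitFamily cs j θ ξ χ σ)
    (P : ∀ l, Matrix (Fin (d l)) (Fin (d l)) 𝕂) : ∃ a : W → 𝕂, ∀ l, ∑ w, a w • σ l w = P l := by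
  let Φ : (W → 𝕂) →ₗ[𝕂] (∀ l, Matrix (Fin (d l)) (Fin (d l)) 𝕂) :=
    LinearMap.pi fun l => Fintype.linearCombination 𝕂 (σ l)
  have hΦ : ∀ a l, Φ a l = ∑ w, a w • σ l w := fun a l => rfl
  have hinj : Function.Injective Φ := (injective_iff_map_eq_zero Φ).2 fun a ha =>
    H.eq_zero_of_forall_sum_smul_eq_zero a fun l => by rw [← hΦ, ha]; rfl
  have hdim : Module.finrank 𝕂 (W → 𝕂) =
      Module.finrank 𝕂 (∀ l, Matrix (Fin (d l)) (Fin (d l)) 𝕂) := by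
    rw [Module.finrank_pi, Module.finrank_pi_fintype, ← H.sum_sq]
    exact Finset.sum_congr rfl fun l _ => by simp [Module.finrank_matrix]
  obtain ⟨a, ha⟩ := (LinearMap.injective_iff_surjective_of_finrank_eq_finrank hdim).1 hinj P
  exact ⟨a, fun l => by rw [← hΦ, ha]⟩

theorem sum_mul_eq_zero (H : IsSplitFamily cs j θ ξ χ σ) {l m : Λ} (hlm : l ≠ m)
    (X : Matrix (Fin (d l)) (Fin (d m)) 𝕂) : ∑ w, σ l w * X * σ m w⁻¹ = 0 := by
  obtain ⟨a, ha⟩ := H.exists_sum_smul_eq (Pi.single l 1)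
  have h1 := ha l
  have h2 := ha m
  rw [Pi.single_eq_same] at h1
  rw [Pi.single_eq_of_ne hlm.symm] at h2
  set I := ∑ w, σ l w * X * σ m w⁻¹ with hI
  calc I = (∑ w, a w • σ l w) * I := by rw [h1, Matrix.one_mul]
    _ = I * ∑ w, a w • σ m w := by
      rw [Matrix.sum_mul, Matrix.mul_sum]
      refine Finset.sum_congr rfl fun w _ => ?_
      rw [Matrix.smul_mul, Matrix.mul_smul, hI, intertwiner (H.rule l) (H.rule m)]
    _ = 0 := by rw [h2, Matrix.mul_zero]

theorem sum_mul_eq_scalar (H : IsSplitFamily cs j θ ξ χ σ) (l : Λ)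
    (X : Matrix (Fin (d l)) (Fin (d l)) 𝕂) :
    ∃ c : 𝕂, ∑ w, σ l w * X * σ l w⁻¹ = Matrix.scalar _ c := by
  set I := ∑ w, σ l w * X * σ l w⁻¹ with hI
  have h : I ∈ Set.range (Matrix.scalar (Fin (d l))) := by
    refine Matrix.mem_range_scalar_of_commute_single fun p q _ => ?_
    obtain ⟨a, ha⟩ := H.exists_sum_smul_eq (Pi.single l (Matrix.single p q 1))
    have h1 := ha l
    rw [Pi.single_eq_same] at h1
    rw [← h1, Commute, SemiconjBy, Matrix.sum_mul, Matrix.mul_sum]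
    refine Finset.sum_congr rfl fun w _ => ?_
    rw [Matrix.smul_mul, Matrix.mul_smul, hI, intertwiner (H.rule l) (H.rule l)]
  obtain ⟨c, hc⟩ := h
  exact ⟨c, hc.symm⟩

theorem sum_mul_single_mul_apply {n m : ℕ} (f : W → Matrix (Fin n) (Fin n) 𝕂)
    (g : W → Matrix (Fin m) (Fin m) 𝕂) (i p : Fin n) (q k : Fin m) :
    (∑ w, f w * Matrix.single p q (1 : 𝕂) * g w⁻¹) i k = ∑ w, f w i p * g w⁻¹ q k := by
  rw [Matrix.sum_apply]
  refine Finset.sum_congr rfl fun w _ => ?_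
  rw [Matrix.mul_assoc, Matrix.mul_apply, Finset.sum_eq_single p]
  · rw [Matrix.single_mul_apply_same, one_mul]
  · intro b _ hb
    rw [Matrix.single_mul_apply_of_ne _ _ _ _ _ hb, mul_zero]
  · simp

theorem schur_of_ne (H : IsSplitFamily cs j θ ξ χ σ) {l m : Λ} (hlm : l ≠ m) (i p : Fin (d l))
    (q k : Fin (d m)) : ∑ w, σ l w i p * σ m w⁻¹ q k = 0 := by
  rw [← sum_mul_single_mul_apply, H.sum_mul_eq_zero hlm]
  rfl

/-- The Schur relations. -/
theorem schur (H : IsSplitFamily cs j θ ξ χ σ) [CharZero 𝕂] (l : Λ) (i p q k : Fin (d l)) :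
    ∑ w, σ l w i p * σ l w⁻¹ q k =
      if i = k ∧ p = q then (d l : 𝕂)⁻¹ * ∑ w, (σ l w).trace * (σ l w⁻¹).trace else 0 := by
  set S : Fin (d l) → Fin (d l) → Fin (d l) → Fin (d l) → 𝕂 := fun i p q k =>
    ∑ w, σ l w i p * σ l w⁻¹ q k with hS
  choose c hc using fun p q => H.sum_mul_eq_scalar l (Matrix.single p q 1)
  have h1 : ∀ i p q k, S i p q k = if i = k then c p q else 0 := by
    intro i p q k
    simp only [hS]
    rw [← sum_mul_single_mul_apply, hc, Matrix.scalar_apply, Matrix.diagonal_apply]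
  -- Replacing `w` by `w⁻¹` exchanges the two pairs of indices. Hence the condition `p = q` appears
  -- as well as `i = k`, and comparing both descriptions shows that one constant serves all indices;
  -- the sum of traces identifies it.
  have h2 : ∀ i p q k, S i p q k = S q k i p := by
    intro i p q k
    refine Fintype.sum_equiv (Equiv.inv W) _ _ fun w => ?_
    simp [mul_comm]
  have h3 : ∀ i p q k, S i p q k = if i = k ∧ p = q then c i i else 0 := by
    intro i p q k
    by_cases hik : i = k
    · subst hik
      rw [h2, h1]
      simp only [true_and, eq_comm (a := p)]
    · rw [h1, if_neg hik, if_neg (fun h => hik h.1)]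
  have h4 : ∀ i k, c i i = c k k := by
    intro i k
    have h5 := h1 k i i k
    have h6 := h3 k i i k
    rw [if_pos rfl] at h5
    rw [if_pos ⟨rfl, rfl⟩] at h6
    rw [← h5, h6]
  change S i p q k = _
  rw [h3]
  by_cases h : i = k ∧ p = q
  swap
  · rw [if_neg h, if_neg h]
  rw [if_pos h, if_pos h]
  have hd : (d l : 𝕂) ≠ 0 := by
    have : 0 < d l := Fin.pos i
    exact_mod_cast this.ne'
  have h7 : ∑ w, (σ l w).trace * (σ l w⁻¹).trace = ∑ a, ∑ b, S a a b b := by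
    simp only [hS, Matrix.trace, Matrix.diag_apply, Finset.sum_mul_sum]
    rw [Finset.sum_comm]
    exact Finset.sum_congr rfl fun a _ => Finset.sum_comm
  rw [h7, eq_inv_mul_iff_mul_eq₀ hd]
  have h8 : ∀ a, ∑ b, S a a b b = c i i := by
    intro a
    rw [Finset.sum_eq_single a]
    · rw [h3, if_pos ⟨rfl, rfl⟩, h4]
    · intro b _ hb
      rw [h3, if_neg fun h => hb h.1.symm]
    · simp
  simp only [h8]
  simp

end IsSplitFamily

end HeckeReps

/-! ### Hahn series, positivity and conjugate characters -/

section Hahn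

variable {Γ : Type*} [AddCommGroup Γ] [LinearOrder Γ] [IsOrderedAddMonoid Γ]

/-- All coefficients of `x` below `p` vanish. -/
def LowBound (x : HahnSeries Γ ℂ) (p : Γ) : Prop := ∀ g < p, x.coeff g = 0

theorem LowBound.sum {ι : Type*} {s : Finset ι} {f : ι → HahnSeries Γ ℂ} {p : Γ}
    (h : ∀ i ∈ s, LowBound (f i) p) : LowBound (∑ i ∈ s, f i) p := fun g hg => by
  rw [HahnSeries.coeff_sum]
  exact Finset.sum_eq_zero fun i hi => h i hi g hg

theorem LowBound.mul {x y : HahnSeries Γ ℂ} {p q : Γ} (hx : LowBound x p) (hy : LowBound y q) :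
    LowBound (x * y) (p + q) := fun g hg => by
  rw [HahnSeries.coeff_mul]
  refine Finset.sum_eq_zero fun ab hab => ?_
  obtain ⟨h1, h2, h3⟩ := Finset.mem_antidiagonal.1 hab
  by_cases h : ab.1 < p
  · rw [hx _ h, zero_mul]
  · rw [hy _ (lt_of_not_ge fun h' => hg.not_ge (h3 ▸ add_le_add (not_lt.1 h) h')), mul_zero]

/-- At the extreme exponent only the pair `(p, q)` contributes. The bounds need not be the exact
orders, so the rule also covers vanishing leading coefficients. -/
theorem LowBound.coeff_mul {x y : HahnSeries Γ ℂ} {p q : Γ} (hx : LowBound x p)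
    (hy : LowBound y q) : (x * y).coeff (p + q) = x.coeff p * y.coeff q := by
  rw [HahnSeries.coeff_mul]
  rw [Finset.sum_eq_single (p, q)]
  · intro ab hab hne
    obtain ⟨h1, h2, h3⟩ := Finset.mem_antidiagonal.1 hab
    exfalso
    have hp : p ≤ ab.1 := le_of_not_gt fun h => h1 (hx _ h)
    have hq : q ≤ ab.2 := le_of_not_gt fun h => h2 (hy _ h)
    have hp' : ab.1 = p := le_antisymm (le_of_not_gt fun h =>
      (add_lt_add_of_lt_of_le h hq).ne' h3) hp
    rw [hp', add_left_cancel_iff] at h3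
    exact hne (Prod.ext hp' h3)
  · intro h
    rw [Finset.mem_antidiagonal] at h
    simp only [HahnSeries.mem_support, ne_eq, and_true, not_and_or, not_not] at h
    rcases h with h | h <;> rw [h] <;> simp

theorem lowBound_order (x : HahnSeries Γ ℂ) : LowBound x x.order := fun _ hg =>
  HahnSeries.coeff_eq_zero_of_lt_order hg

theorem LowBound.mono {x : HahnSeries Γ ℂ} {p q : Γ} (hx : LowBound x p) (hqp : q ≤ p) :
    LowBound x q := fun g hg => hx g (hg.trans_le hqp)

theorem LowBound.order_eq {x : HahnSeries Γ ℂ} {p : Γ} (hx : LowBound x p) (hp : x.coeff p ≠ 0) :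
    x.order = p :=
  le_antisymm (HahnSeries.order_le_of_coeff_ne_zero hp)
    (le_of_not_gt fun h => by
      have h0 := hx _ h
      rw [HahnSeries.coeff_order_eq_zero] at h0
      exact hp (by rw [h0]; rfl))

/-- Complex conjugation of the coefficients of a Hahn series. -/
def conjH : HahnSeries Γ ℂ →+* HahnSeries Γ ℂ where
  toFun x := x.map (starRingEnd ℂ)
  map_one' := HahnSeries.map_one (starRingEnd ℂ).toMonoidWithZeroHom
  map_mul' _ _ := HahnSeries.map_mul (starRingEnd ℂ).toNonUnitalRingHom
  map_zero' := HahnSeries.map_zero (starRingEnd ℂ).toMonoidWithZeroHom.toZeroHom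
  map_add' _ _ := HahnSeries.map_add (starRingEnd ℂ).toAddMonoidHom

theorem coeff_conjH (x : HahnSeries Γ ℂ) (g : Γ) :
    (conjH x).coeff g = starRingEnd ℂ (x.coeff g) := rfl

theorem LowBound.conjH {x : HahnSeries Γ ℂ} {p : Γ} (hx : LowBound x p) : LowBound (conjH x) p :=
  fun g hg => by rw [coeff_conjH, hx g hg, map_zero]

theorem exists_lowBound {ι : Type*} [Fintype ι] (x : ι → HahnSeries Γ ℂ) {k : ι} (hk : x k ≠ 0) :
    ∃ p, (∀ i, LowBound (x i) p) ∧ ∃ i, (x i).coeff p ≠ 0 := by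
  obtain ⟨i, hi, hmin⟩ := Finset.exists_min_image (Finset.univ.filter fun i => x i ≠ 0)
    (fun i => (x i).order) ⟨k, by simpa using hk⟩
  refine ⟨(x i).order, fun k => ?_, i, fun h => ?_⟩
  · by_cases h : x k = 0
    · intro g _
      rw [h]
      rfl
    · exact (lowBound_order _).mono (hmin k (by simpa using h))
  · rw [HahnSeries.coeff_order_eq_zero] at h
    exact (Finset.mem_filter.1 hi).2 h

/-- The coefficient is a sum of squared absolute values, one of them positive, so the lowest terms
cannot cancel. -/
theorem coeff_sum_conjH_mul {ι : Type*} [Fintype ι] {x : ι → HahnSeries Γ ℂ} {p : Γ}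
    (hp : ∀ i, LowBound (x i) p) {k : ι} (hk : (x k).coeff p ≠ 0) :
    (∑ i, conjH (x i) * x i).coeff (p + p) ≠ 0 := by
  rw [HahnSeries.coeff_sum]
  simp only [(hp _).conjH.coeff_mul (hp _), coeff_conjH]
  have : ∀ i, (starRingEnd ℂ) ((x i).coeff p) * (x i).coeff p =
      ((Complex.normSq ((x i).coeff p) : ℝ) : ℂ) := fun i => Complex.normSq_eq_conj_mul_self.symm
  simp only [this]
  rw [← Complex.ofReal_sum, Complex.ofReal_ne_zero]
  have hpos : 0 < ∑ i, Complex.normSq ((x i).coeff p) :=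
    Finset.sum_pos' (fun i _ => Complex.normSq_nonneg _)
      ⟨k, Finset.mem_univ k, Complex.normSq_pos.2 hk⟩
  exact hpos.ne'

theorem sum_conjH_mul_eq_zero {ι : Type*} [Fintype ι] {x : ι → HahnSeries Γ ℂ}
    (h : ∑ i, conjH (x i) * x i = 0) (i : ι) : x i = 0 := by
  by_contra hi
  obtain ⟨p, hp, k, hk⟩ := exists_lowBound x hi
  exact coeff_sum_conjH_mul hp hk (by rw [h]; rfl)

theorem exists_order_sum_conjH_mul {ι : Type*} [Fintype ι] {x : ι → HahnSeries Γ ℂ} {k : ι}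
    (hk : x k ≠ 0) : ∃ p, (∑ i, conjH (x i) * x i).order = p + p := by
  obtain ⟨p, hp, i, hi⟩ := exists_lowBound x hk
  exact ⟨p, (LowBound.sum fun i _ => (hp i).conjH.mul (hp i)).order_eq (coeff_sum_conjH_mul hp hi)⟩

variable {B W : Type*} [Group W] [Fintype W] {M : CoxeterMatrix B} {cs : CoxeterSystem M W}
  {ζ : B → HahnSeries Γ ℂ} {n : ℕ} {σ : W → Matrix (Fin n) (Fin n) (HahnSeries Γ ℂ)}

/-- Transposing and inverting `w` each reverse products, and the parameters are real; so this is
again a representation, the conjugate dual one. -/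
theorem HeckeRule.conjTranspose (hσ : HeckeRule cs ζ σ) (hζ : ∀ i, conjH (ζ i) = ζ i) :
    HeckeRule cs ζ (fun w => (σ w⁻¹).transpose.map conjH) where
  one := by
    rw [inv_one, hσ.one, Matrix.transpose_one, Matrix.map_one _ (map_zero _) (map_one _)]
  mul_of_lt i w h := by
    rw [← Matrix.map_mul, ← Matrix.transpose_mul, cs.inv_simple, hσ.mul_simple_of_lt, mul_inv_rev,
      cs.inv_simple]
    rwa [← cs.length_inv (w⁻¹ * _), mul_inv_rev, inv_inv, cs.inv_simple, cs.length_inv]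
  mul_self i := by
    rw [← Matrix.map_mul, ← Matrix.transpose_mul, cs.inv_simple, hσ.mul_self]
    ext a b
    simp only [Matrix.map_apply, Matrix.transpose_apply, Matrix.add_apply, Matrix.smul_apply,
      smul_eq_mul, map_add, map_mul, hζ, Matrix.one_apply]
    congr 1
    by_cases hab : a = b
    · subst hab
      simp
    · rw [if_neg hab, if_neg (Ne.symm hab), map_zero]

/-- The character values at `w` and `w⁻¹` of a representation over a field of Hahn series are
conjugate to each other. -/
theorem HeckeRule.trace_inv (hσ : HeckeRule cs ζ σ) (hζ : ∀ i, conjH (ζ i) = ζ i) (w : W) :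
    conjH (σ w⁻¹).trace = (σ w).trace := by
  set τ : W → Matrix (Fin n) (Fin n) (HahnSeries Γ ℂ) := fun w => (σ w⁻¹).transpose.map conjH
    with hτ
  -- This is the invariant Hermitian form obtained by averaging the standard one; by `intertwiner`
  -- it intertwines `σ` with its conjugate dual.
  set I := ∑ w, τ w * 1 * σ w⁻¹ with hI
  have h1 : τ w * I = I * σ w := intertwiner (hσ.conjTranspose hζ) hσ 1 w
  -- The form is anisotropic: evaluated at `v` it is the sum over all `w` and all coordinates of `x̄
  -- x`, with `x` a coordinate of `σ(w⁻¹) v`, and the terms at `w = 1` already detect `v`.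
  have hdet : I.det ≠ 0 := by
    intro h0
    obtain ⟨v, hv0, hv⟩ := Matrix.exists_mulVec_eq_zero_iff.2 h0
    have h2 : ∑ p : W × Fin n, conjH ((σ p.1⁻¹).mulVec v p.2) * (σ p.1⁻¹).mulVec v p.2 = 0 := by
      have h3 : (fun k => conjH (v k)) ⬝ᵥ I.mulVec v = 0 := by rw [hv, dotProduct_zero]
      rw [← h3, hI, Matrix.sum_mulVec, dotProduct_sum, Fintype.sum_prod_type]
      refine Finset.sum_congr rfl fun u _ => ?_
      rw [mul_one, ← Matrix.mulVec_mulVec, Matrix.dotProduct_mulVec]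
      refine Finset.sum_congr rfl fun k _ => ?_
      congr 1
      simp only [hτ, Matrix.mulVec, Matrix.vecMul, dotProduct, map_sum, map_mul, Matrix.map_apply,
        Matrix.transpose_apply]
      exact Finset.sum_congr rfl fun _ _ => mul_comm _ _
    refine hv0 (funext fun k => ?_)
    have := sum_conjH_mul_eq_zero h2 (1, k)
    simpa [hσ.one] using this
  have h4 : (τ w).trace = conjH (σ w⁻¹).trace := by
    simp [hτ, Matrix.trace, map_sum]
  have hu : IsUnit I.det := isUnit_iff_ne_zero.2 hdet
  rw [← h4]
  calc (τ w).trace = (τ w * I * I⁻¹).trace := by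
        rw [Matrix.mul_nonsing_inv_cancel_right _ _ hu]
    _ = (I * σ w * I⁻¹).trace := by rw [h1]
    _ = (σ w).trace := by
      rw [Matrix.trace_mul_comm, ← Matrix.mul_assoc, Matrix.nonsing_inv_mul _ hu, Matrix.one_mul]

end Hahn

/-! ### Embedding of `K` into Hahn series; the valuation as order -/

section Embedding

variable {Γ : Type*} [AddCommGroup Γ] [LinearOrder Γ] [IsOrderedAddMonoid Γ]

/-- The embedding of a group algebra into Hahn series attached to a ring homomorphism to `ℂ`. -/
def toHahn {S : Type*} [CommRing S] (f : S →+* ℂ) : AddMonoidAlgebra S Γ →+* HahnSeries Γ ℂ :=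
  AddMonoidAlgebra.liftNCRingHom (HahnSeries.C.comp f)
    { toFun := fun g => HahnSeries.single g.toAdd 1
      map_one' := rfl
      map_mul' := fun g h => by simp }
    fun _ _ => Commute.all _ _

theorem toHahn_single {S : Type*} [CommRing S] (f : S →+* ℂ) (g : Γ) (r : S) :
    toHahn f (AddMonoidAlgebra.single g r) = HahnSeries.single g (f r) := by
  simp [toHahn]

theorem coeff_toHahn {S : Type*} [CommRing S] (f : S →+* ℂ) (a : AddMonoidAlgebra S Γ) (g : Γ) :
    (toHahn f a).coeff g = f (a.coeff g) := by
  induction a using AddMonoidAlgebra.induction_linear with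
  | zero => simp
  | add x y hx hy => simp [hx, hy]
  | single h r =>
    rw [toHahn_single, HahnSeries.coeff_single, AddMonoidAlgebra.coeff_single, Finsupp.single_apply]
    simp only [eq_comm (a := g), apply_ite f, map_zero]

theorem toHahn_injective {S : Type*} [CommRing S] {f : S →+* ℂ} (hf : Function.Injective f) :
    Function.Injective (toHahn (Γ := Γ) f) := by
  intro a b h
  refine AddMonoidAlgebra.ext (Finsupp.ext fun g => hf ?_)
  rw [← coeff_toHahn, h, coeff_toHahn]

variable (R : Subring ℂ)

/-- The embedding of `R[Γ]` into Hahn series. -/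
def iA : AddMonoidAlgebra R Γ →+* HahnSeries Γ ℂ := toHahn R.subtype

theorem coeff_iA (a : AddMonoidAlgebra R Γ) (g : Γ) : (iA R a).coeff g = (a.coeff g : ℂ) :=
  coeff_toHahn _ a g

theorem iA_injective : Function.Injective (iA (Γ := Γ) R) := toHahn_injective Subtype.val_injective

/-- The embedding of the field of fractions of `R` into `ℂ`. -/
def iF : FractionRing R →+* ℂ := IsFractionRing.lift (g := R.subtype) Subtype.val_injective

/-- The embedding of `K` into Hahn series. -/
def iK : KField Γ R →+* HahnSeries Γ ℂ := IsFractionRing.lift (g := iA R) (iA_injective R)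

theorem iF_algebraMap (r : R) : iF R (algebraMap R (FractionRing R) r) = r :=
  IsFractionRing.lift_algebraMap _ _

theorem iF_injective : Function.Injective (iF R) := (iF R).injective

theorem iK_algebraMap (a : AddMonoidAlgebra R Γ) :
    iK R (algebraMap (AddMonoidAlgebra R Γ) (KField Γ R) a) = iA R a :=
  IsFractionRing.lift_algebraMap _ _

theorem iK_injective : Function.Injective (iK (Γ := Γ) R) := (iK R).injective

theorem iK_epsK (g : Γ) : iK R (epsK R g) = HahnSeries.single g 1 := by
  rw [epsK, iK_algebraMap, eps, iA, toHahn_single, map_one]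

theorem FtoK_algebraMap (r : R) : FtoK (Γ := Γ) R (algebraMap R (FractionRing R) r) =
    algebraMap (AddMonoidAlgebra R Γ) (KField Γ R) (AddMonoidAlgebra.single 0 r) := by
  rw [FtoK, IsFractionRing.lift_algebraMap,
    IsScalarTower.algebraMap_apply R (AddMonoidAlgebra R Γ) (KField Γ R)]
  rfl

theorem iK_FtoK (r : FractionRing R) : iK (Γ := Γ) R (FtoK R r) = HahnSeries.C (iF R r) := by
  suffices h : (iK (Γ := Γ) R).comp (FtoK R) = HahnSeries.C.comp (iF R) from RingHom.congr_fun h r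
  refine IsLocalization.ringHom_ext (nonZeroDivisors R) (RingHom.ext fun a => ?_)
  simp only [RingHom.comp_apply]
  rw [FtoK_algebraMap, iK_algebraMap, iF_algebraMap, iA, toHahn_single]
  rfl

/-- The inclusion of `F[Γ]` into `K` as a ring homomorphism. -/
def FGhom : AddMonoidAlgebra (FractionRing R) Γ →+* KField Γ R :=
  AddMonoidAlgebra.liftNCRingHom (FtoK R)
    { toFun := fun g => epsK R g.toAdd
      map_one' := by
        rw [toAdd_one, epsK]
        exact map_one _
      map_mul' := fun g h => by
        rw [toAdd_mul, epsK, epsK, epsK, ← map_mul]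
        congr 1
        simp [eps, AddMonoidAlgebra.single_mul_single] }
    fun _ _ => Commute.all _ _

theorem FGhom_apply (p : AddMonoidAlgebra (FractionRing R) Γ) : FGhom R p = FGtoK R p := rfl

theorem FGhom_single (g : Γ) (r : FractionRing R) :
    FGhom R (AddMonoidAlgebra.single g r) = FtoK R r * epsK R g := by
  simp [FGhom]

theorem iK_FGtoK (p : AddMonoidAlgebra (FractionRing R) Γ) :
    iK R (FGtoK R p) = toHahn (iF R) p := by
  rw [← FGhom_apply]
  induction p using AddMonoidAlgebra.induction_linear with
  | zero => simp
  | add x y hx hy => rw [map_add, map_add, map_add, hx, hy]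
  | single g r =>
    rw [FGhom_single, map_mul, iK_FtoK, iK_epsK, toHahn_single]
    simp [HahnSeries.C_apply]

theorem FGhom_mapRingHom (a : AddMonoidAlgebra R Γ) :
    FGhom R (AddMonoidAlgebra.mapRingHom Γ (algebraMap R (FractionRing R)) a) =
      algebraMap (AddMonoidAlgebra R Γ) (KField Γ R) a := by
  refine iK_injective R ?_
  rw [FGhom_apply, iK_FGtoK, iK_algebraMap]
  ext g
  rw [coeff_toHahn, coeff_iA, AddMonoidAlgebra.coeff_mapRingHom, iF_algebraMap]

variable {R}

theorem IsPos.coeff_one_add {p : AddMonoidAlgebra (FractionRing R) Γ} (hp : IsPos R p) :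
    LowBound (iK R (1 + FGtoK R p)) 0 ∧ (iK R (1 + FGtoK R p)).coeff 0 = 1 := by
  have h : ∀ g ≤ 0, p.coeff g = 0 := fun g hg => by
    by_contra h0
    exact (hp g h0).not_ge hg
  rw [map_add, map_one, iK_FGtoK]
  refine ⟨fun g hg => ?_, ?_⟩
  · rw [HahnSeries.coeff_add, coeff_toHahn, h g hg.le, HahnSeries.coeff_one, if_neg hg.ne, map_zero,
      add_zero]
  · rw [HahnSeries.coeff_add, coeff_toHahn, h 0 le_rfl, HahnSeries.coeff_one, if_pos rfl, map_zero,
      add_zero]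

theorem IsPos.one_add_ne_zero {p : AddMonoidAlgebra (FractionRing R) Γ} (hp : IsPos R p) :
    1 + FGtoK R p ≠ 0 := fun h => by
  have := hp.coeff_one_add.2
  rw [h, map_zero, HahnSeries.coeff_zero] at this
  exact zero_ne_one this

/-- The factors `1 + p` and `1 + q` have order zero and leading coefficient one, and order and
leading coefficient are multiplicative. In particular the pair `(r, g)` is unique, so the choices in
`leadExp` and `leadCoeff` are immaterial. -/
theorem HasLead.order_eq {x : KField Γ R} {r : FractionRing R} {g : Γ} (hr : r ≠ 0)
    (h : HasLead R x r g) : (iK R x).order = g ∧ (iK R x).leadingCoeff = iF R r := by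
  obtain ⟨p, q, hp, hq, hx⟩ := h
  have hq0 := hq.one_add_ne_zero
  have h1 : x * (1 + FGtoK R q) = FtoK R r * epsK R g * (1 + FGtoK R p) := by
    rw [hx]
    field_simp
  have hr' : iF R r ≠ 0 := (map_ne_zero (iF R)).2 hr
  have h2 := congrArg (iK R) h1
  rw [map_mul, map_mul, map_mul, iK_FtoK, iK_epsK] at h2
  have hC : HahnSeries.C (iF R r) * HahnSeries.single g (1 : ℂ) =
      HahnSeries.single g (iF R r) := by
    simp [HahnSeries.C_apply]
  rw [hC] at h2
  have hP := hp.coeff_one_add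
  have hQ := hq.coeff_one_add
  have oP := hP.1.order_eq (by rw [hP.2]; exact one_ne_zero)
  have oQ := hQ.1.order_eq (by rw [hQ.2]; exact one_ne_zero)
  have nP := (map_ne_zero (iK R)).2 hp.one_add_ne_zero
  have nQ := (map_ne_zero (iK R)).2 hq0
  have nS : HahnSeries.single g (iF R r) ≠ 0 := HahnSeries.single_ne_zero hr'
  have nX : iK R x ≠ 0 := fun h0 => by
    rw [h0, zero_mul] at h2
    exact mul_ne_zero nS nP h2.symm
  constructor
  · have := congrArg HahnSeries.order h2
    rwa [HahnSeries.order_mul nX nQ, HahnSeries.order_mul nS nP, oP, oQ, add_zero, add_zero,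
      HahnSeries.order_single hr'] at this
  · have := congrArg HahnSeries.leadingCoeff h2
    rwa [HahnSeries.leadingCoeff_mul, HahnSeries.leadingCoeff_mul,
      HahnSeries.leadingCoeff_eq (x := iK R (1 + FGtoK R q)),
      HahnSeries.leadingCoeff_eq (x := iK R (1 + FGtoK R p)), oP, oQ, hP.2, hQ.2, mul_one, mul_one,
      HahnSeries.leadingCoeff_of_single] at this

theorem exists_lead_of_ne_zero {a : AddMonoidAlgebra R Γ} (ha : a ≠ 0) :
    ∃ (r : FractionRing R) (g : Γ) (p : AddMonoidAlgebra (FractionRing R) Γ), r ≠ 0 ∧ IsPos R p ∧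
      algebraMap (AddMonoidAlgebra R Γ) (KField Γ R) a =
        FtoK R r * epsK R g * (1 + FGtoK R p) := by
  have hne : a.coeff.support.Nonempty := by
    rw [Finsupp.support_nonempty_iff]
    exact fun h => ha (AddMonoidAlgebra.ext h)
  set g := a.coeff.support.min' hne with hg
  have hmem : g ∈ a.coeff.support := Finset.min'_mem _ _
  have hlow : ∀ h < g, a.coeff h = 0 := fun h hh => by
    by_contra h0
    exact hh.not_ge (Finset.min'_le _ _ (Finsupp.mem_support_iff.2 h0))
  set b : AddMonoidAlgebra (FractionRing R) Γ :=
    AddMonoidAlgebra.mapRingHom Γ (algebraMap R (FractionRing R)) a with hb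
  have hbc : ∀ h, b.coeff h = algebraMap R (FractionRing R) (a.coeff h) := fun h => by
    rw [hb, AddMonoidAlgebra.coeff_mapRingHom]
  have hr : b.coeff g ≠ 0 := by
    rw [hbc]
    intro h0
    rw [← map_zero (algebraMap R (FractionRing R))] at h0
    exact Finsupp.mem_support_iff.1 hmem (IsFractionRing.injective R (FractionRing R) h0)
  set r := b.coeff g with hr'
  -- The element divided by its lowest term, minus one, has only positive exponents.
  refine ⟨r, g, AddMonoidAlgebra.single (-g) r⁻¹ * b - 1, hr, fun h hh => ?_, ?_⟩
  · by_contra hneg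
    apply hh
    rw [AddMonoidAlgebra.coeff_sub, Finsupp.sub_apply, AddMonoidAlgebra.coeff_single_mul_apply,
      AddMonoidAlgebra.one_def, AddMonoidAlgebra.coeff_single, Finsupp.single_apply, neg_neg]
    rcases (not_lt.1 hneg).eq_or_lt with h0 | h0
    · rw [h0, add_zero, if_pos rfl, ← hr', inv_mul_cancel₀ hr, sub_self]
    · rw [if_neg h0.ne', sub_zero, hbc, hlow _ (by simpa using h0), map_zero, mul_zero]
  · rw [← FGhom_apply, map_sub, map_one, add_sub_cancel, map_mul, FGhom_single, hb,
      FGhom_mapRingHom]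
    have h1 : FtoK (Γ := Γ) R r * FtoK R r⁻¹ = 1 := by
      rw [← map_mul, mul_inv_cancel₀ hr, map_one]
    have h2 : epsK R g * epsK R (-g) = 1 := by
      refine iK_injective R ?_
      rw [map_mul, iK_epsK, iK_epsK, HahnSeries.single_mul_single, map_one (iK R)]
      simp
    calc _ = (FtoK R r * FtoK R r⁻¹) * (epsK R g * epsK R (-g)) *
          algebraMap (AddMonoidAlgebra R Γ) (KField Γ R) a := by rw [h1, h2, one_mul, one_mul]
      _ = _ := by ring

theorem exists_hasLead {x : KField Γ R} (hx : x ≠ 0) : ∃ r ≠ 0, ∃ g, HasLead R x r g := by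
  obtain ⟨a, b, hb, rfl⟩ := IsFractionRing.div_surjective (AddMonoidAlgebra R Γ) x
  have hb0 : b ≠ 0 := nonZeroDivisors.ne_zero hb
  have ha0 : a ≠ 0 := by
    rintro rfl
    exact hx (by rw [map_zero, zero_div])
  obtain ⟨r, g, p, hr, hp, h1⟩ := exists_lead_of_ne_zero ha0
  obtain ⟨s, h, q, hs, hq, h2⟩ := exists_lead_of_ne_zero hb0
  refine ⟨r / s, div_ne_zero hr hs, g - h, p, q, hp, hq, ?_⟩
  have h3 : epsK R g = epsK R (g - h) * epsK R h := by
    refine iK_injective R ?_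
    rw [map_mul, iK_epsK, iK_epsK, iK_epsK, HahnSeries.single_mul_single]
    simp
  have h4 : epsK R h ≠ 0 := by
    intro h0
    have := iK_epsK R h
    rw [h0, map_zero] at this
    exact HahnSeries.single_ne_zero one_ne_zero this.symm
  have h5 : FtoK (Γ := Γ) R s ≠ 0 := (map_ne_zero _).2 hs
  have h6 := hq.one_add_ne_zero
  rw [h1, h2, h3, map_div₀]
  field_simp

theorem not_hasLead_zero {r : FractionRing R} (hr : r ≠ 0) (g : Γ) : ¬ HasLead R 0 r g := fun h => by
  have := (h.order_eq hr).2
  rw [map_zero, HahnSeries.leadingCoeff_zero] at this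
  exact hr ((map_eq_zero (iF R)).1 this.symm)

/-- Valid at `x = 0` too, where both sides take the default value `0`. -/
theorem leadExp_eq (x : KField Γ R) : leadExp R x = (iK R x).order := by
  by_cases hx : x = 0
  · subst hx
    rw [leadExp, dif_neg, map_zero, HahnSeries.order_zero]
    rintro ⟨g, r, hr, h⟩
    exact not_hasLead_zero hr g h
  · obtain ⟨r, hr, g, h⟩ := exists_hasLead hx
    have hex : ∃ g : Γ, ∃ r : FractionRing R, r ≠ 0 ∧ HasLead R x r g := ⟨g, r, hr, h⟩
    rw [leadExp, dif_pos hex]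
    obtain ⟨r', hr', h'⟩ := hex.choose_spec
    exact (h'.order_eq hr').1.symm

theorem iF_leadCoeff (x : KField Γ R) : iF R (leadCoeff R x) = (iK R x).leadingCoeff := by
  by_cases hx : x = 0
  · subst hx
    rw [leadCoeff, dif_neg, map_zero, map_zero, HahnSeries.leadingCoeff_zero]
    rintro ⟨r, hr, g, h⟩
    exact not_hasLead_zero hr g h
  · obtain ⟨r, hr, g, h⟩ := exists_hasLead hx
    have hex : ∃ r : FractionRing R, r ≠ 0 ∧ ∃ g : Γ, HasLead R x r g := ⟨r, hr, g, h⟩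
    rw [leadCoeff, dif_pos hex]
    obtain ⟨hr', g', h'⟩ := hex.choose_spec
    exact (h'.order_eq hr').2.symm

theorem lowBound_of_mem_valO {x : KField Γ R} (hx : x ∈ valO R) : LowBound (iK R x) 0 := by
  rcases hx with hx | hx
  · intro g _
    rw [hx, map_zero]
    rfl
  · rw [leadExp_eq] at hx
    exact (lowBound_order _).mono hx

theorem iF_constTerm {x : KField Γ R} (hx : x ∈ valO R) :
    iF R (constTerm R x) = (iK R x).coeff 0 := by
  rw [constTerm, leadExp_eq]
  split_ifs with h
  · rw [iF_leadCoeff, HahnSeries.leadingCoeff_eq, h]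
  · rw [map_zero]
    rcases hx with hx | hx
    · rw [hx, map_zero, HahnSeries.coeff_zero]
    · rw [leadExp_eq] at hx
      exact (HahnSeries.coeff_eq_zero_of_lt_order (lt_of_le_of_ne hx (Ne.symm h))).symm

end Embedding

/-! ### Orthogonality of leading matrix coefficients and the identity of `J̃` -/

section LeadingCoefficients

variable {B W Γ Λ : Type*} [Group W] [Fintype W] {M : CoxeterMatrix B} {cs : CoxeterSystem M W}
  [AddCommGroup Γ] [LinearOrder Γ] [IsOrderedAddMonoid Γ] {R : Subring ℂ} {L : WeightFunction cs Γ}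
  {n : ℕ}

/-- The extension of a matrix representation of the Hecke algebra to Hahn series. -/
def hahnRep (ρ : MatRep R L n) : Hecke R L →+* Matrix (Fin n) (Fin n) (HahnSeries Γ ℂ) :=
  (iK R).mapMatrix.comp (ρ : Hecke R L →+* Matrix (Fin n) (Fin n) (KField Γ R))

theorem hahnRep_apply (ρ : MatRep R L n) (h : Hecke R L) (i j : Fin n) :
    hahnRep ρ h i j = iK R (ρ h i j) := rfl

theorem trace_hahnRep (ρ : MatRep R L n) (h : Hecke R L) :
    (hahnRep ρ h).trace = iK R (ρ h).trace := by
  simp only [Matrix.trace, map_sum]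
  rfl

theorem hahnRep_smul (ρ : MatRep R L n) (a : AddMonoidAlgebra R Γ) (h : Hecke R L) :
    hahnRep ρ (a • h) = iA R a • hahnRep ρ h := by
  ext1 i j
  rw [hahnRep_apply, map_smul, Matrix.smul_apply, Matrix.smul_apply, hahnRep_apply,
    Algebra.smul_def, map_mul, iK_algebraMap, smul_eq_mul]

theorem heckeRule_hahnRep (ρ : MatRep R L n) :
    HeckeRule cs (fun i => iA R (xi R L i)) (fun w => hahnRep ρ (heckeT R L w)) :=
  (heckeRule_heckeT R L).map (hahnRep ρ) fun i x => hahnRep_smul ρ (xi R L i) x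

theorem conjH_iA_xi (i : B) : conjH (iA R (xi R L i)) = iA R (xi R L i) := by
  have h : ∀ g : Γ, conjH (iA R (eps R g)) = iA R (eps R g) := fun g => by
    rw [iA, eps, toHahn_single, map_one]
    ext h
    rw [coeff_conjH, HahnSeries.coeff_single]
    split_ifs <;> simp
  rw [xi, map_sub, map_sub, h, h]

variable (R) in
/-- The specialisation `ε^g ↦ 1` with values in `ℂ`. -/
def specOne : AddMonoidAlgebra R Γ →+* ℂ :=
  AddMonoidAlgebra.liftNCRingHom R.subtype (1 : Multiplicative Γ →* ℂ) fun _ _ => Commute.all _ _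

theorem specOne_single (g : Γ) (r : R) : specOne R (AddMonoidAlgebra.single g r) = r := by
  simp [specOne]

theorem specOne_eq (a : AddMonoidAlgebra R Γ) : specOne R a = theta1 R a := by
  induction a using AddMonoidAlgebra.induction_linear with
  | zero => simp [theta1]
  | add x y hx hy =>
    rw [map_add, hx, hy, theta1, theta1, theta1, AddMonoidAlgebra.coeff_add,
      Finsupp.sum_add_index' (fun _ => rfl) (fun _ _ _ => rfl)]
    push_cast
    rfl
  | single g r =>
    rw [specOne_single, theta1, AddMonoidAlgebra.coeff_single, Finsupp.sum_single_index rfl]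

theorem specOne_xi (i : B) : specOne R (xi R L i) = 0 := by
  rw [xi, eps, eps, map_sub, specOne_single, specOne_single, sub_self]

/-- Working over Hahn series rather than over `K` allows the Schur relations to be compared
coefficient by coefficient. -/
theorem isSplitFamily_hahnRep [Fintype Λ] {E : Λ → FDRep ℂ W} (hE : IsIrrFamily E) {d : Λ → ℕ}
    {ρ : ∀ l, MatRep R L (d l)} (hρ : ∀ l, Corresponds (E l) (ρ l)) :
    IsSplitFamily cs (iA R) (specOne R) (xi R L) (fun l => (E l).character)
      (fun l w => hahnRep (ρ l) (heckeT R L w)) where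
  inj := iA_injective R
  xi_zero := specOne_xi
  rule l := heckeRule_hahnRep (ρ l)
  trace l w := by
    obtain ⟨a, ha, ha'⟩ := (hρ l).2 w
    exact ⟨a, by rw [trace_hahnRep, ← ha, iK_algebraMap], by rw [specOne_eq, ha']⟩
  regular w := by
    rw [← sum_finrank_mul_character hE w]
    exact Finset.sum_congr rfl fun l _ => by rw [(hρ l).1]

instance : CharZero (HahnSeries Γ ℂ) :=
  charZero_of_injective_ringHom (f := (HahnSeries.C : ℂ →+* HahnSeries Γ ℂ)) HahnSeries.C_injective

section SchurElement

theorem iK_schurElt (ρ : MatRep R L n) : iK R (schurElt ρ) =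
    (n : HahnSeries Γ ℂ)⁻¹ * ∑ w : W, (hahnRep ρ (heckeT R L w)).trace *
      (hahnRep ρ (heckeT R L w⁻¹)).trace := by
  rw [schurElt, map_mul, map_inv₀, map_natCast, map_sum]
  simp only [map_mul, trace_hahnRep]

/-- Characters at `w` and `w⁻¹` are conjugate, so up to the factor `1/n` the Schur element is a sum
of `x̄ x`. The term at `w = 1` is nonzero, and the order of such a sum is twice the smallest order
occurring. -/
theorem exists_order_iK_schurElt (ρ : MatRep R L n) (hn : n ≠ 0) :
    iK R (schurElt ρ) ≠ 0 ∧ ∃ p, (iK R (schurElt ρ)).order = p + p := by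
  have h1 : ∀ w : W, (hahnRep ρ (heckeT R L w)).trace * (hahnRep ρ (heckeT R L w⁻¹)).trace =
      conjH (hahnRep ρ (heckeT R L w⁻¹)).trace * (hahnRep ρ (heckeT R L w⁻¹)).trace := fun w => by
    rw [(heckeRule_hahnRep ρ).trace_inv conjH_iA_xi]
  have hn' : (n : HahnSeries Γ ℂ)⁻¹ ≠ 0 := inv_ne_zero (Nat.cast_ne_zero.2 hn)
  have h2 : (hahnRep ρ (heckeT R L (1 : W)⁻¹)).trace ≠ 0 := by
    rw [inv_one, heckeT_one, map_one, Matrix.trace_one, Fintype.card_fin]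
    exact Nat.cast_ne_zero.2 hn
  have h3 : ∑ w : W, conjH (hahnRep ρ (heckeT R L w⁻¹)).trace *
      (hahnRep ρ (heckeT R L w⁻¹)).trace ≠ 0 := fun h0 => h2 (sum_conjH_mul_eq_zero h0 1)
  rw [iK_schurElt]
  simp only [h1]
  refine ⟨mul_ne_zero hn' h3, ?_⟩
  obtain ⟨p, hp⟩ := exists_order_sum_conjH_mul
    (x := fun w : W => (hahnRep ρ (heckeT R L w⁻¹)).trace) h2
  refine ⟨p, ?_⟩
  rw [HahnSeries.order_mul hn' h3, hp, ← map_natCast (HahnSeries.C : ℂ →+* HahnSeries Γ ℂ),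
    ← map_inv₀, HahnSeries.order_C, zero_add]

/-- Divisibility of the order by two is what makes the choice in the definition of `aInv` a genuine
solution. -/
theorem order_iK_schurElt (ρ : MatRep R L n) (hn : n ≠ 0) :
    (iK R (schurElt ρ)).order = -aInv ρ + -aInv ρ := by
  obtain ⟨p, hp⟩ := (exists_order_iK_schurElt ρ hn).2
  have h : ∃ a, leadExp R (schurElt ρ) = -(2 • a) :=
    ⟨-p, by rw [leadExp_eq, hp, two_nsmul, neg_add, neg_neg]⟩
  have := Classical.epsilon_spec h
  rw [← leadExp_eq, ← neg_add, ← two_nsmul]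
  exact this

theorem coeff_iK_schurElt (ρ : MatRep R L n) (hn : n ≠ 0) :
    (iK R (schurElt ρ)).coeff (-aInv ρ + -aInv ρ) = iF R (fInv ρ) := by
  rw [fInv, iF_leadCoeff, HahnSeries.leadingCoeff_eq, order_iK_schurElt ρ hn]

theorem fInv_ne_zero (ρ : MatRep R L n) (hn : n ≠ 0) : fInv ρ ≠ 0 := by
  intro h0
  have := iF_leadCoeff (schurElt ρ)
  rw [← fInv, h0, map_zero] at this
  exact (exists_order_iK_schurElt ρ hn).1 (HahnSeries.leadingCoeff_eq_zero.1 this.symm)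

end SchurElement

theorem neg_one_pow_mul_mem_valO {x : KField Γ R} (hx : x ∈ valO R) (k : ℕ) :
    (-1) ^ k * x ∈ valO R := by
  rcases neg_one_pow_eq_or (KField Γ R) k with h | h
  · rwa [h, one_mul]
  · rw [h, neg_one_mul]
    rcases hx with hx | hx
    · exact Or.inl (by rw [hx, neg_zero])
    · exact Or.inr (by rwa [leadExp_eq, map_neg, HahnSeries.order_neg, ← leadExp_eq])

theorem lowBound_hahnRep {ρ : MatRep R L n} (hb : IsBalanced ρ) (w : W) (i j : Fin n) :
    LowBound (hahnRep ρ (heckeT R L w) i j) (-aInv ρ) := fun g hg => by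
  have h := lowBound_of_mem_valO (hb w i j) (g + aInv ρ) (by rwa [← lt_neg_iff_add_neg])
  rwa [map_mul, iK_epsK, HahnSeries.coeff_single_mul, one_mul, add_sub_cancel_right,
    ← hahnRep_apply] at h

theorem coeff_neg_one_pow_mul (k : ℕ) (x : HahnSeries Γ ℂ) (g : Γ) :
    ((-1) ^ k * x).coeff g = (-1) ^ k * x.coeff g := by
  have h : (-1 : HahnSeries Γ ℂ) ^ k = HahnSeries.C ((-1) ^ k) := by
    rw [map_pow, map_neg, map_one]
  rw [h, HahnSeries.C_mul_eq_smul, HahnSeries.coeff_smul, smul_eq_mul]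

theorem iF_leadMat {ρ : MatRep R L n} (hb : IsBalanced ρ) (w : W) (i j : Fin n) :
    iF R (leadMat ρ w i j) =
      (-1) ^ cs.length w * (hahnRep ρ (heckeT R L w) i j).coeff (-aInv ρ) := by
  rw [leadMat, iF_constTerm (neg_one_pow_mul_mem_valO (hb w i j) _), map_mul, map_mul, iK_epsK,
    map_pow, map_neg, map_one (iK R), ← hahnRep_apply]
  rw [coeff_neg_one_pow_mul, HahnSeries.coeff_single_mul, one_mul, zero_sub]

/-- Balancedness bounds both factors from below, so lowest coefficients multiply; the signs cancel
because `w` and `w⁻¹` have equal length. -/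
theorem iF_leadMat_mul {m : ℕ} {ρ : MatRep R L n} (hb : IsBalanced ρ) {τ : MatRep R L m}
    (hb' : IsBalanced τ) (w : W) (i p : Fin n) (q k : Fin m) :
    iF R (leadMat ρ w i p) * iF R (leadMat τ w⁻¹ q k) =
      (hahnRep ρ (heckeT R L w) i p * hahnRep τ (heckeT R L w⁻¹) q k).coeff
        (-aInv ρ + -aInv τ) := by
  rw [iF_leadMat hb, iF_leadMat hb', (lowBound_hahnRep hb w i p).coeff_mul
    (lowBound_hahnRep hb' w⁻¹ q k), cs.length_inv, mul_mul_mul_comm, ← mul_pow, neg_one_mul, neg_neg,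
    one_pow, one_mul]

variable [Fintype Λ] {E : Λ → FDRep ℂ W} {d : Λ → ℕ} {ρ : ∀ l, MatRep R L (d l)}

theorem deg_ne_zero (hE : IsIrrFamily E) (hρ : ∀ l, Corresponds (E l) (ρ l)) (l : Λ) : d l ≠ 0 := by
  have := hE.simple l
  rw [(hρ l).1]
  exact finrank_ne_zero_of_simple (E l)

theorem leadMat_orthogonal_of_ne (hE : IsIrrFamily E) (hρ : ∀ l, Corresponds (E l) (ρ l))
    (hb : ∀ l, IsBalanced (ρ l)) {l m : Λ} (hlm : l ≠ m) (i p : Fin (d l)) (q k : Fin (d m)) :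
    ∑ w, leadMat (ρ l) w i p * leadMat (ρ m) w⁻¹ q k = 0 := by
  apply iF_injective R
  rw [map_sum, map_zero]
  simp only [map_mul, iF_leadMat_mul (hb l) (hb m)]
  rw [← HahnSeries.coeff_sum, (isSplitFamily_hahnRep hE hρ).schur_of_ne hlm i p q k,
    HahnSeries.coeff_zero]

/-- This is the coefficient at exponent `-2a` of the Schur relation; on the right the Schur element
contributes its leading coefficient. -/
theorem leadMat_orthogonal (hE : IsIrrFamily E) (hρ : ∀ l, Corresponds (E l) (ρ l))
    (hb : ∀ l, IsBalanced (ρ l)) (l : Λ) (i p q k : Fin (d l)) :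
    ∑ w, leadMat (ρ l) w i p * leadMat (ρ l) w⁻¹ q k =
      if i = k ∧ p = q then fInv (ρ l) else 0 := by
  apply iF_injective R
  rw [map_sum]
  simp only [map_mul, iF_leadMat_mul (hb l) (hb l)]
  rw [← HahnSeries.coeff_sum, (isSplitFamily_hahnRep hE hρ).schur l i p q k, ← iK_schurElt]
  split_ifs
  · exact coeff_iK_schurElt _ (deg_ne_zero hE hρ l)
  · rw [HahnSeries.coeff_zero, map_zero]

/-- The orthogonality relations say `X Y = 1` for matrices indexed by `W` and by triples `(l, i,
j)`. The index sets have equal size, so `Y X = 1` as well. -/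
theorem sum_inv_mul_leadMat_mul_leadMat (hE : IsIrrFamily E) (hρ : ∀ l, Corresponds (E l) (ρ l))
    (hb : ∀ l, IsBalanced (ρ l)) (x y : W) :
    ∑ l, ∑ i, ∑ j, (fInv (ρ l))⁻¹ * leadMat (ρ l) y i j * leadMat (ρ l) x⁻¹ j i =
      if x = y then 1 else 0 := by
  let I := Σ l, Fin (d l) × Fin (d l)
  have hcard : Fintype.card I = Fintype.card W := by
    rw [← (isSplitFamily_hahnRep hE hρ).sum_sq, Fintype.card_sigma]
    exact Finset.sum_congr rfl fun l _ => by simp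
  let X : Matrix I W (FractionRing R) := Matrix.of fun s w => leadMat (ρ s.1) w s.2.1 s.2.2
  let Y : Matrix W I (FractionRing R) := Matrix.of fun w s =>
    (fInv (ρ s.1))⁻¹ * leadMat (ρ s.1) w⁻¹ s.2.2 s.2.1
  have hXY : X * Y = 1 := by
    ext ⟨l, i, p⟩ ⟨m, k, q⟩
    rw [Matrix.mul_apply, Matrix.one_apply]
    simp only [X, Y, Matrix.of_apply]
    simp only [mul_left_comm _ (fInv (ρ m))⁻¹]
    rw [← Finset.mul_sum]
    by_cases hlm : l = m
    · subst hlm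
      rw [leadMat_orthogonal hE hρ hb]
      by_cases h : i = k ∧ p = q
      · rw [if_pos h, inv_mul_cancel₀ (fInv_ne_zero _ (deg_ne_zero hE hρ l)), if_pos]
        rw [h.1, h.2]
      · rw [if_neg h, mul_zero, if_neg]
        intro h'
        simp only [Sigma.mk.injEq, heq_eq_eq, Prod.mk.injEq, true_and] at h'
        exact h h'
    · rw [leadMat_orthogonal_of_ne hE hρ hb hlm, mul_zero, if_neg]
      exact fun h => hlm (congrArg Sigma.fst h)
  have hYX : Y * X = 1 :=
    (Matrix.mul_eq_one_comm_of_card_eq _ _ _ hcard).1 hXY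
  have := congrFun (congrFun hYX x) y
  rw [Matrix.mul_apply, Matrix.one_apply, Fintype.sum_sigma] at this
  rw [← this]
  refine Finset.sum_congr rfl fun l _ => ?_
  rw [Fintype.sum_prod_type]
  refine Finset.sum_congr rfl fun i _ => Finset.sum_congr rfl fun j _ => ?_
  simp only [X, Y, Matrix.of_apply]
  ring

/-- The candidate identity `∑ ñ_w t_w` corresponds to the identity matrix in every leading matrix
family. With `sum_inv_mul_leadMat_mul_leadMat` this makes it a two-sided identity of `J̃`. -/
theorem sum_nT_mul_leadMat (hE : IsIrrFamily E) (hρ : ∀ l, Corresponds (E l) (ρ l))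
    (hb : ∀ l, IsBalanced (ρ l)) (l : Λ) (i j : Fin (d l)) :
    ∑ w, nT ρ w * leadMat (ρ l) w i j = if i = j then 1 else 0 := by
  simp only [nT, Finset.sum_mul]
  rw [Finset.sum_comm, Finset.sum_eq_single l]
  · rw [Finset.sum_comm]
    have : ∀ p, ∑ w, (fInv (ρ l))⁻¹ * leadMat (ρ l) w⁻¹ p p * leadMat (ρ l) w i j =
        if i = p ∧ j = p then 1 else 0 := fun p => by
      simp only [mul_assoc, mul_comm (leadMat (ρ l) _⁻¹ _ _)]
      rw [← Finset.mul_sum, leadMat_orthogonal hE hρ hb]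
      split_ifs
      · exact inv_mul_cancel₀ (fInv_ne_zero _ (deg_ne_zero hE hρ l))
      · exact mul_zero _
    simp only [this]
    by_cases hij : i = j
    · subst hij
      simp
    · rw [if_neg hij]
      exact Finset.sum_eq_zero fun p _ => if_neg fun h => hij (h.1.trans h.2.symm)
  · intro m _ hm
    rw [Finset.sum_comm]
    refine Finset.sum_eq_zero fun p _ => ?_
    simp only [mul_assoc, mul_comm (leadMat (ρ m) _⁻¹ _ _)]
    rw [← Finset.mul_sum, leadMat_orthogonal_of_ne hE hρ hb hm.symm, mul_zero]
  · simp

theorem sum_nT_mul_gammaT_left (hE : IsIrrFamily E) (hρ : ∀ l, Corresponds (E l) (ρ l))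
    (hb : ∀ l, IsBalanced (ρ l)) (y z : W) :
    ∑ w, nT ρ w * gammaT ρ w y z⁻¹ = if z = y then 1 else 0 := by
  rw [← sum_inv_mul_leadMat_mul_leadMat hE hρ hb z y]
  simp only [gammaT, Finset.mul_sum]
  rw [Finset.sum_comm]
  refine Finset.sum_congr rfl fun l _ => ?_
  rw [Finset.sum_comm]
  refine Finset.sum_congr rfl fun i _ => ?_
  rw [Finset.sum_comm, Finset.sum_eq_single i]
  · rw [Finset.sum_comm]
    refine Finset.sum_congr rfl fun k _ => ?_
    have := sum_nT_mul_leadMat hE hρ hb l i i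
    rw [if_pos rfl] at this
    rw [← mul_one (_ * _ * _), ← this, Finset.mul_sum]
    exact Finset.sum_congr rfl fun w _ => by ring
  · intro j _ hj
    rw [Finset.sum_comm]
    refine Finset.sum_eq_zero fun k _ => ?_
    have := sum_nT_mul_leadMat hE hρ hb l i j
    rw [if_neg hj.symm] at this
    rw [← mul_zero ((fInv (ρ l))⁻¹ * leadMat (ρ l) y j k * leadMat (ρ l) z⁻¹ k i), ← this,
      Finset.mul_sum]
    exact Finset.sum_congr rfl fun w _ => by ring
  · simp

theorem sum_nT_mul_gammaT_right (hE : IsIrrFamily E) (hρ : ∀ l, Corresponds (E l) (ρ l))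
    (hb : ∀ l, IsBalanced (ρ l)) (y z : W) :
    ∑ w, nT ρ w * gammaT ρ y w z⁻¹ = if z = y then 1 else 0 := by
  rw [← sum_inv_mul_leadMat_mul_leadMat hE hρ hb z y]
  simp only [gammaT, Finset.mul_sum]
  rw [Finset.sum_comm]
  refine Finset.sum_congr rfl fun l _ => ?_
  rw [Finset.sum_comm]
  refine Finset.sum_congr rfl fun i _ => ?_
  rw [Finset.sum_comm]
  refine Finset.sum_congr rfl fun j _ => ?_
  rw [Finset.sum_comm, Finset.sum_eq_single j]
  · have := sum_nT_mul_leadMat hE hρ hb l j j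
    rw [if_pos rfl] at this
    rw [← mul_one (_ * _ * _), ← this, Finset.mul_sum]
    exact Finset.sum_congr rfl fun w _ => by ring
  · intro k _ hk
    have := sum_nT_mul_leadMat hE hρ hb l j k
    rw [if_neg hk.symm] at this
    rw [← mul_zero ((fInv (ρ l))⁻¹ * leadMat (ρ l) y i j * leadMat (ρ l) z⁻¹ k i), ← this,
      Finset.mul_sum]
    exact Finset.sum_congr rfl fun w _ => by ring
  · simp

end LeadingCoefficients

/-! ### Leading coefficients and two-sided cells -/

section Cells

namespace IsSplitFamily

variable {B W : Type*} [Group W] {M : CoxeterMatrix B} {cs : CoxeterSystem M W}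
  {A 𝕂 Λ : Type*} [CommRing A] [Field 𝕂] [CharZero 𝕂] [Fintype Λ] [Fintype W]
  {j : A →+* 𝕂} {θ : A →+* ℂ} {ξ : B → A} {χ : Λ → W → ℂ} {d : Λ → ℕ}
  {σ : ∀ l, W → Matrix (Fin (d l)) (Fin (d l)) 𝕂}

/-- If a linear form `q` vanishes on the two-sided ideal generated by `Z`, then its component at a
factor where `Z` is nonzero vanishes. -/
theorem sum_mul_inv_eq_zero (H : IsSplitFamily cs j θ ξ χ σ)
    {Z : ∀ l, Matrix (Fin (d l)) (Fin (d l)) 𝕂} {r : W → W → W → 𝕂} {q : W → 𝕂}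
    (hr : ∀ u v m, ∑ w, r u v w • σ m w = σ m u * Z m * σ m v)
    (hq : ∀ u v, ∑ w, r u v w * q w = 0) {l : Λ} {a b : Fin (d l)} (hZ : Z l a b ≠ 0)
    (i k : Fin (d l)) : ∑ w, q w * σ l w⁻¹ i k = 0 := by
  -- The combinations `α` and `β` act as matrix units on the factor `l` and as zero elsewhere, so
  -- they isolate the entry `Z l a b`: the element `s` of the ideal acts as `Z l a b` times the unit
  -- at `(k, i)`.
  obtain ⟨α, hα⟩ := H.exists_sum_smul_eq (Pi.single l (Matrix.single k a 1))
  obtain ⟨β, hβ⟩ := H.exists_sum_smul_eq (Pi.single l (Matrix.single b i 1))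
  set c : 𝕂 := (d l : 𝕂)⁻¹ * ∑ w, (σ l w).trace * (σ l w⁻¹).trace with hc
  set s : W → 𝕂 := fun w => ∑ u, ∑ v, α u * β v * r u v w with hs
  -- By the Schur relations the function `w ↦ σ l w⁻¹ i k` acts as `c` times the same matrix unit.
  -- Both multiples act equally in all factors, so they coincide; nonvanishing of `c` is not needed.
  have key : (fun w => c * s w - Z l a b * σ l w⁻¹ i k) = 0 := by
    refine H.eq_zero_of_forall_sum_smul_eq_zero _ fun m => ?_
    have h1 : ∑ w, s w • σ m w = (Pi.single l (Matrix.single k a (1 : 𝕂)) :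
        ∀ m, Matrix (Fin (d m)) (Fin (d m)) 𝕂) m * Z m * (Pi.single l (Matrix.single b i (1 : 𝕂)) :
        ∀ m, Matrix (Fin (d m)) (Fin (d m)) 𝕂) m := by
      rw [← hα, ← hβ]
      simp only [hs, Finset.sum_smul, Finset.sum_mul, Finset.mul_sum]
      rw [Finset.sum_comm, Finset.sum_comm (s := Finset.univ (α := W)) (t := Finset.univ (α := W))
        (f := fun x i => α i • σ m i * Z m * β x • σ m x)]
      refine Finset.sum_congr rfl fun u _ => ?_
      rw [Finset.sum_comm]
      refine Finset.sum_congr rfl fun v _ => ?_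
      rw [smul_mul_assoc, mul_smul_comm, smul_mul_assoc, ← hr, smul_smul, mul_comm (β v),
        Finset.smul_sum]
      exact Finset.sum_congr rfl fun w _ => by rw [smul_smul]
    have h2 : ∑ w, σ l w⁻¹ i k • σ m w = c • (Pi.single l (Matrix.single k i (1 : 𝕂)) :
        ∀ m, Matrix (Fin (d m)) (Fin (d m)) 𝕂) m := by
      ext1 p q
      rw [Matrix.sum_apply, Matrix.smul_apply]
      simp only [Matrix.smul_apply, smul_eq_mul]
      by_cases hm : m = l
      · subst hm
        simp only [mul_comm (σ m _⁻¹ _ _)]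
        rw [H.schur m p q i k, Pi.single_eq_same, Matrix.single_apply, mul_ite, mul_one, mul_zero]
        simp only [eq_comm, hc]
      · simp only [mul_comm (σ l _⁻¹ _ _)]
        rw [H.schur_of_ne hm p q i k, Pi.single_eq_of_ne hm]
        exact (mul_zero _).symm
    simp only [sub_smul, Finset.sum_sub_distrib, mul_smul]
    rw [← Finset.smul_sum, ← Finset.smul_sum, h1, h2, sub_eq_zero]
    by_cases hm : m = l
    · subst hm
      simp only [Pi.single_eq_same]
      rw [Matrix.single_mul_mul_single, one_mul, mul_one, smul_comm (Z m a b)]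
      congr 1
      rw [Matrix.smul_single, smul_eq_mul, mul_one]
    · simp only [Pi.single_eq_of_ne hm]
      simp
  have h3 : ∑ w, s w * q w = 0 := by
    simp only [hs, Finset.sum_mul]
    rw [Finset.sum_comm]
    refine Finset.sum_eq_zero fun u _ => ?_
    rw [Finset.sum_comm]
    refine Finset.sum_eq_zero fun v _ => ?_
    simp only [mul_assoc]
    rw [← Finset.mul_sum, ← Finset.mul_sum, hq, mul_zero, mul_zero]
  have h4 : Z l a b * ∑ w, q w * σ l w⁻¹ i k = c * ∑ w, s w * q w := by
    rw [Finset.mul_sum, Finset.mul_sum]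
    refine Finset.sum_congr rfl fun w _ => ?_
    have := sub_eq_zero.1 (congrFun key w)
    rw [← mul_assoc c, this]
    ring
  rw [h3, mul_zero] at h4
  exact (mul_eq_zero.1 h4).resolve_left hZ

end IsSplitFamily

variable {B W Γ Λ : Type*} [Group W] [Fintype W] {M : CoxeterMatrix B} {cs : CoxeterSystem M W}
  [AddCommGroup Γ] [LinearOrder Γ] [IsOrderedAddMonoid Γ] {R : Subring ℂ} {L : WeightFunction cs Γ}
  {n : ℕ}

theorem coeff_repr_klC (w y : W) {g : Γ} (hg : g ≤ 0) :
    (iA R ((heckeT R L).repr (klC R L w) y)).coeff g =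
      if g = 0 ∧ y = w then (-1) ^ cs.length w else 0 := by
  have h0 : ((heckeT R L).repr (klC R L w - (-1 : ℤ) ^ cs.length w • heckeT R L w) y).coeff g = 0 := by
    by_contra h
    exact hg.not_gt (coeff_repr_klC_sub w y g h)
  have h1 : iA R ((heckeT R L).repr (klC R L w) y) =
      iA R ((heckeT R L).repr (klC R L w - (-1 : ℤ) ^ cs.length w • heckeT R L w) y) +
        (-1 : ℤ) ^ cs.length w • (if y = w then 1 else 0) := by
    rw [map_sub, Finsupp.sub_apply, map_sub, map_zsmul, Finsupp.smul_apply, map_zsmul,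
      Module.Basis.repr_self, Finsupp.single_apply]
    simp only [eq_comm (a := w), apply_ite (iA R), map_one, map_zero, sub_add_cancel]
  rw [h1, HahnSeries.coeff_add, coeff_iA, h0, Subring.coe_zero, zero_add, HahnSeries.coeff_smul]
  by_cases hy : y = w
  · rw [if_pos hy, HahnSeries.coeff_one]
    by_cases hg0 : g = 0
    · rw [if_pos hg0, if_pos ⟨hg0, hy⟩, zsmul_eq_mul, mul_one]
      push_cast
      rfl
    · rw [if_neg hg0, if_neg fun h => hg0 h.1, smul_zero]
  · rw [if_neg hy, if_neg fun h => hy h.2, HahnSeries.coeff_zero, smul_zero]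

theorem lowBound_repr_klC (w y : W) : LowBound (iA R ((heckeT R L).repr (klC R L w) y)) 0 :=
  fun g hg => by rw [coeff_repr_klC w y hg.le, if_neg fun h => hg.ne h.1]

theorem sum_repr_klC_mul_klCoord (w x : W) :
    ∑ y, iA R ((heckeT R L).repr (klC R L w) y) * iA R (klCoord R L (heckeT R L y) x) =
      if x = w then 1 else 0 := by
  have h : klCoord R L (∑ y, (heckeT R L).repr (klC R L w) y • heckeT R L y) x =
      klCoord R L (klC R L w) x := by rw [(heckeT R L).sum_repr]
  rw [klCoord_sum, klCoord_klC] at h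
  simp only [klCoord_smul] at h
  have := congrArg (iA R) h
  simpa only [map_sum, map_mul, apply_ite (iA R), map_one, map_zero] using this

/-- Modulo positive exponents `C_w` is `(-1)^{ℓ(w)} T_w`, so passing from `T_w` to `C_w` affects a
lowest coefficient only by the sign. -/
theorem coeff_sum_repr_klC_mul {f : W → HahnSeries Γ ℂ} {p : Γ} (hf : ∀ y, LowBound (f y) p) (w : W) :
    (∑ y, iA R ((heckeT R L).repr (klC R L w) y) * f y).coeff p =
      (-1) ^ cs.length w * (f w).coeff p := by
  rw [HahnSeries.coeff_sum, Finset.sum_eq_single w]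
  · have := (lowBound_repr_klC (R := R) (L := L) w w).coeff_mul (hf w)
    rw [zero_add] at this
    rw [this, coeff_repr_klC w w le_rfl, if_pos ⟨rfl, rfl⟩]
  · intro y _ hy
    have := (lowBound_repr_klC (R := R) (L := L) w y).coeff_mul (hf y)
    rw [zero_add] at this
    rw [this, coeff_repr_klC w y le_rfl, if_neg fun h => hy h.2, zero_mul]
  · simp

/-- The inverse base change has no negative exponents either: at a lowest exponent below zero,
multiplication by the base change would preserve a nonzero coefficient up to sign, although the
product is the identity matrix. -/
theorem lowBound_klCoord_heckeT (x y : W) :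
    LowBound (iA R (klCoord R L (heckeT R L y) x)) 0 := by
  by_cases hy : iA R (klCoord R L (heckeT R L y) x) = 0
  · intro g _
    rw [hy]
    rfl
  · obtain ⟨p, hp, w, hw⟩ := exists_lowBound (fun y => iA R (klCoord R L (heckeT R L y) x)) hy
    refine (hp y).mono (le_of_not_gt fun hp0 => hw ?_)
    have h := coeff_sum_repr_klC_mul (R := R) (L := L) hp w
    rw [sum_repr_klC_mul_klCoord] at h
    have h1 : ((if x = w then 1 else 0 : HahnSeries Γ ℂ)).coeff p = 0 := by
      split_ifs
      · rw [HahnSeries.coeff_one, if_neg hp0.ne]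
      · rfl
    rw [h1] at h
    exact (mul_eq_zero.1 h.symm).resolve_left (pow_ne_zero _ (neg_ne_zero.2 one_ne_zero))

theorem coeff_klCoord_heckeT (x w : W) (h : w ≠ x) :
    (iA R (klCoord R L (heckeT R L w) x)).coeff 0 = 0 := by
  have h1 := coeff_sum_repr_klC_mul (R := R) (L := L)
    (fun y => lowBound_klCoord_heckeT (R := R) (L := L) x y) w
  rw [sum_repr_klC_mul_klCoord, if_neg h.symm, HahnSeries.coeff_zero] at h1
  exact (mul_eq_zero.1 h1.symm).resolve_left (pow_ne_zero _ (neg_ne_zero.2 one_ne_zero))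

theorem coeff_klCoord_heckeT_self (w : W) :
    (iA R (klCoord R L (heckeT R L w) w)).coeff 0 ≠ 0 := by
  have h1 := coeff_sum_repr_klC_mul (R := R) (L := L)
    (fun y => lowBound_klCoord_heckeT (R := R) (L := L) w y) w
  rw [sum_repr_klC_mul_klCoord, if_pos rfl, HahnSeries.coeff_one, if_pos rfl] at h1
  exact fun h => one_ne_zero (h1.trans (by rw [h, mul_zero]))

theorem hahnRep_eq_sum (ρ : MatRep R L n) (h : Hecke R L) (i j : Fin n) :
    hahnRep ρ h i j =
      ∑ w, iA R ((heckeT R L).repr h w) * hahnRep ρ (heckeT R L w) i j := by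
  conv_lhs => rw [← (heckeT R L).sum_repr h]
  rw [map_sum, Matrix.sum_apply]
  simp only [hahnRep_smul, Matrix.smul_apply, smul_eq_mul]

/-- The coefficient of this entry at `-a` is exactly `leadMat`: the sign in `C_w` is the sign built
into the leading coefficients. -/
theorem hahnRep_klC_ne_zero {ρ : MatRep R L n} (hb : IsBalanced ρ) {y : W} {i j : Fin n}
    (h : leadMat ρ y i j ≠ 0) : hahnRep ρ (klC R L y) i j ≠ 0 := by
  intro h0
  rw [hahnRep_eq_sum] at h0
  have h1 := coeff_sum_repr_klC_mul (R := R) (L := L) (fun w => lowBound_hahnRep hb w i j) y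
  rw [h0, HahnSeries.coeff_zero, ← iF_leadMat hb] at h1
  exact h (iF_injective R (h1.symm.trans (map_zero _).symm))

variable [Fintype Λ] {E : Λ → FDRep ℂ W} {d : Λ → ℕ} {ρ : ∀ l, MatRep R L (d l)}

/-- The coefficient of `C_x` is a linear form that vanishes on the ideal generated by `C_y` when `x
≤_LR y` fails; a factor on which `C_y` is nonzero is covered by that ideal. -/
theorem sum_klCoord_mul_hahnRep_inv (hL : ∀ i : B, 0 < L (cs.simple i)) (hE : IsIrrFamily E)
    (hρ : ∀ l, Corresponds (E l) (ρ l)) {x y : W} (hxy : ¬ leLR R L x y) {l : Λ} {a b : Fin (d l)}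
    (hy : hahnRep (ρ l) (klC R L y) a b ≠ 0) (i j : Fin (d l)) :
    ∑ w, iA R (klCoord R L (heckeT R L w) x) * hahnRep (ρ l) (heckeT R L w⁻¹) i j = 0 := by
  refine (isSplitFamily_hahnRep hE hρ).sum_mul_inv_eq_zero (Z := fun m => hahnRep (ρ m) (klC R L y))
    (r := fun u v w => iA R ((heckeT R L).repr (heckeT R L u * klC R L y * heckeT R L v) w))
    (fun u v m => ?_) (fun u v => ?_) hy i j
  · rw [← map_mul, ← map_mul]
    ext1 i j
    rw [hahnRep_eq_sum, Matrix.sum_apply]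
    rfl
  · have h1 : klCoord R L (heckeT R L u * klC R L y * heckeT R L v) x = 0 := by
      by_contra h
      exact hxy (mul_mem_lowerIdeal_right hL _ (mul_mem_lowerIdeal_left hL _
        (klC_mem_lowerIdeal (leLR_refl y))) x h)
    rw [← (heckeT R L).sum_repr (heckeT R L u * klC R L y * heckeT R L v), klCoord_sum] at h1
    simp only [klCoord_smul] at h1
    simpa only [map_sum, map_mul, map_zero] using congrArg (iA R) h1

/-- In the lowest coefficient of `sum_klCoord_mul_hahnRep_inv` only the term `w = x` survives, which
forces the leading matrix at `x⁻¹` to vanish. -/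
theorem leLR_of_leadMat_inv (hL : ∀ i : B, 0 < L (cs.simple i)) (hE : IsIrrFamily E)
    (hρ : ∀ l, Corresponds (E l) (ρ l)) (hb : ∀ l, IsBalanced (ρ l)) {l : Λ} {x y : W}
    (hx : leadMat (ρ l) x⁻¹ ≠ 0) (hy : leadMat (ρ l) y ≠ 0) : leLR R L x y := by
  by_contra hxy
  obtain ⟨a, b, hab⟩ : ∃ a b, leadMat (ρ l) y a b ≠ 0 := by
    by_contra! h
    exact hy (funext fun a => funext fun b => h a b)
  refine hx (funext fun i => funext fun j => iF_injective R ?_)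
  have h := sum_klCoord_mul_hahnRep_inv hL hE hρ hxy (hahnRep_klC_ne_zero (hb l) hab) i j
  have h1 := congrArg (fun z => HahnSeries.coeff z (0 + -aInv (ρ l))) h
  simp only [HahnSeries.coeff_sum, HahnSeries.coeff_zero, (lowBound_klCoord_heckeT x _).coeff_mul
    (lowBound_hahnRep (hb l) _ i j)] at h1
  rw [Finset.sum_eq_single x (fun w _ hw => by rw [coeff_klCoord_heckeT x w hw, zero_mul])
    (by simp)] at h1
  rw [iF_leadMat (hb l), (mul_eq_zero.1 h1).resolve_left (coeff_klCoord_heckeT_self x), mul_zero]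
  exact (map_zero _).symm

/-- One inequality is direct. The other is the same statement for the inverses `x⁻¹` and `z⁻¹`,
carried back by `leLR.inv`. -/
theorem eqvLR_of_leadMat_inv (hL : ∀ i : B, 0 < L (cs.simple i)) (hE : IsIrrFamily E)
    (hρ : ∀ l, Corresponds (E l) (ρ l)) (hb : ∀ l, IsBalanced (ρ l)) {l : Λ} {x z : W}
    (hx : leadMat (ρ l) x ≠ 0) (hz : leadMat (ρ l) z⁻¹ ≠ 0) : eqvLR R L x z := by
  refine ⟨?_, leLR_of_leadMat_inv hL hE hρ hb hz hx⟩
  have := (leLR_of_leadMat_inv hL hE hρ hb (x := x⁻¹) (y := z⁻¹) (by rwa [inv_inv]) hz).inv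
  rwa [inv_inv, inv_inv] at this

/-- The structure constants of `J̃` are supported on two-sided cells. -/
theorem eqvLR_of_gammaT_ne_zero (hL : ∀ i : B, 0 < L (cs.simple i)) (hE : IsIrrFamily E)
    (hρ : ∀ l, Corresponds (E l) (ρ l)) (hb : ∀ l, IsBalanced (ρ l)) {x y z : W}
    (h : gammaT ρ x y z⁻¹ ≠ 0) : eqvLR R L x z ∧ eqvLR R L y z := by
  obtain ⟨l, -, h⟩ := Finset.exists_ne_zero_of_sum_ne_zero h
  obtain ⟨i, -, h⟩ := Finset.exists_ne_zero_of_sum_ne_zero h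
  obtain ⟨j, -, h⟩ := Finset.exists_ne_zero_of_sum_ne_zero h
  obtain ⟨k, -, h⟩ := Finset.exists_ne_zero_of_sum_ne_zero h
  have hz : leadMat (ρ l) z⁻¹ ≠ 0 := fun h0 => right_ne_zero_of_mul h (by rw [h0]; rfl)
  have h := left_ne_zero_of_mul h
  have hy : leadMat (ρ l) y ≠ 0 := fun h0 => right_ne_zero_of_mul h (by rw [h0]; rfl)
  have h := left_ne_zero_of_mul h
  have hx : leadMat (ρ l) x ≠ 0 := fun h0 => right_ne_zero_of_mul h (by rw [h0]; rfl)
  exact ⟨eqvLR_of_leadMat_inv hL hE hρ hb hx hz, eqvLR_of_leadMat_inv hL hE hρ hb hy hz⟩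

end Cells

/-! ### The graded action and Lusztig's homomorphism -/

section LusztigHomomorphism

variable {B W Γ Λ : Type*} [Group W] [Fintype W] {M : CoxeterMatrix B} {cs : CoxeterSystem M W}
  [AddCommGroup Γ] [LinearOrder Γ] [IsOrderedAddMonoid Γ] {R : Subring ℂ} {L : WeightFunction cs Γ}
  [Fintype Λ] {E : Λ → FDRep ℂ W} {d : Λ → ℕ} {ρ : ∀ l, MatRep R L (d l)}

variable (ρ) in
/-- The coefficient of `t_z`. -/
def coordJ (z : W) : JTilde ρ →ₗ[KField Γ R] KField Γ R where
  toFun v := v z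
  map_add' _ _ := rfl
  map_smul' _ _ := rfl

theorem JTilde_ext {v v' : JTilde ρ} (h : ∀ z, coordJ ρ z v = coordJ ρ z v') : v = v' := funext h

theorem coordJ_smul_A (a : AddMonoidAlgebra R Γ) (v : JTilde ρ) (z : W) :
    coordJ ρ z (a • v) = algebraMap (AddMonoidAlgebra R Γ) (KField Γ R) a * coordJ ρ z v :=
  Algebra.smul_def a (coordJ ρ z v)

theorem coordJ_tElt (w z : W) : coordJ ρ z (tElt ρ w) = if z = w then 1 else 0 := rfl

theorem coordJ_mul (a b : JTilde ρ) (z : W) : coordJ ρ z (a * b) =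
    ∑ x, ∑ y, coordJ ρ x a * coordJ ρ y b * FtoK R (gammaT ρ x y z⁻¹) := rfl

theorem coordJ_oneJ (z : W) : coordJ ρ z (oneJ ρ) = FtoK R (nT ρ z) := by
  simp only [oneJ, map_sum, map_smul, coordJ_tElt, smul_eq_mul, mul_ite, mul_one, mul_zero]
  rw [Finset.sum_ite_eq]
  split_ifs with h
  · rfl
  · rw [setD, Finset.mem_filter, not_and, not_not] at h
    rw [h (Finset.mem_univ z), map_zero]

theorem coordJ_actT (h : Hecke R L) (w z : W) : coordJ ρ z (actT ρ h w) =
    algebraMap (AddMonoidAlgebra R Γ) (KField Γ R) (klCoord R L (h * klC R L w) z) := by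
  simp only [actT, map_sum, coordJ_smul_A, coordJ_tElt, mul_ite, mul_one, mul_zero]
  simp

theorem coordJ_eq_zero_of_mem_lowerSpan {v : JTilde ρ} {w z : W} (hv : v ∈ lowerSpan ρ w)
    (hz : eqvLR R L z w) : coordJ ρ z v = 0 := by
  induction hv using Submodule.span_induction with
  | mem x hx =>
    obtain ⟨y, hy, rfl⟩ := hx
    rw [coordJ_tElt, if_neg]
    rintro rfl
    exact hy.2 hz
  | zero => exact map_zero _
  | add x y _ _ hx hy => rw [map_add, hx, hy, add_zero]
  | smul a x _ hx => rw [coordJ_smul_A, hx, mul_zero]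

theorem mem_JA_of_forall {v : JTilde ρ}
    (h : ∀ z, coordJ ρ z v ∈ (algebraMap (AddMonoidAlgebra R Γ) (KField Γ R)).range) : v ∈ JA ρ := by
  choose a ha using h
  have : v = ∑ z, a z • tElt ρ z := by
    refine JTilde_ext fun z => ?_
    simp only [map_sum, coordJ_smul_A, coordJ_tElt, mul_ite, mul_one, mul_zero]
    simp [ha]
  rw [this]
  exact sum_mem fun z _ => Submodule.smul_mem _ _ (Submodule.subset_span ⟨z, rfl⟩)

theorem one_mul_J (hE : IsIrrFamily E) (hρ : ∀ l, Corresponds (E l) (ρ l))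
    (hb : ∀ l, IsBalanced (ρ l)) (v : JTilde ρ) : oneJ ρ * v = v := by
  refine JTilde_ext fun z => ?_
  rw [coordJ_mul, Finset.sum_comm]
  have : ∀ y, ∑ x, coordJ ρ x (oneJ ρ) * coordJ ρ y v * FtoK R (gammaT ρ x y z⁻¹) =
      coordJ ρ y v * if z = y then 1 else 0 := fun y => by
    rw [← map_one (FtoK R), ← map_zero (FtoK R), ← apply_ite (FtoK R),
      ← sum_nT_mul_gammaT_left hE hρ hb y z, map_sum, Finset.mul_sum]
    refine Finset.sum_congr rfl fun x _ => ?_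
    rw [coordJ_oneJ, map_mul]
    ring
  simp only [this, mul_ite, mul_one, mul_zero]
  simp

theorem mul_one_J (hE : IsIrrFamily E) (hρ : ∀ l, Corresponds (E l) (ρ l))
    (hb : ∀ l, IsBalanced (ρ l)) (v : JTilde ρ) : v * oneJ ρ = v := by
  refine JTilde_ext fun z => ?_
  rw [coordJ_mul]
  have : ∀ x, ∑ y, coordJ ρ x v * coordJ ρ y (oneJ ρ) * FtoK R (gammaT ρ x y z⁻¹) =
      coordJ ρ x v * if z = x then 1 else 0 := fun x => by
    rw [← map_one (FtoK R), ← map_zero (FtoK R), ← apply_ite (FtoK R),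
      ← sum_nT_mul_gammaT_right hE hρ hb x z, map_sum, Finset.mul_sum]
    refine Finset.sum_congr rfl fun y _ => ?_
    rw [coordJ_oneJ, map_mul]
    ring
  simp only [this, mul_ite, mul_one, mul_zero]
  simp

/-- The action of the Hecke algebra on the associated graded module of the filtration by two-sided
cells, transported to `J̃`. -/
def grAct (h : Hecke R L) (v : JTilde ρ) : JTilde ρ := fun y => ∑ w, coordJ ρ w v *
  if eqvLR R L y w then
    algebraMap (AddMonoidAlgebra R Γ) (KField Γ R) (klCoord R L (h * klC R L w) y) else 0

theorem coordJ_grAct (h : Hecke R L) (v : JTilde ρ) (y : W) : coordJ ρ y (grAct h v) =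
    ∑ w, coordJ ρ w v * if eqvLR R L y w then
      algebraMap (AddMonoidAlgebra R Γ) (KField Γ R) (klCoord R L (h * klC R L w) y) else 0 := rfl

theorem grAct_add (h h' : Hecke R L) (v : JTilde ρ) :
    grAct (h + h') v = grAct h v + grAct h' v := by
  refine JTilde_ext fun y => ?_
  rw [map_add, coordJ_grAct, coordJ_grAct, coordJ_grAct, ← Finset.sum_add_distrib]
  refine Finset.sum_congr rfl fun w _ => ?_
  rw [← mul_add, add_mul, klCoord_add, map_add]
  split_ifs
  · rfl
  · rw [add_zero]

theorem grAct_smul (a : AddMonoidAlgebra R Γ) (h : Hecke R L) (v : JTilde ρ) :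
    grAct (a • h) v = a • grAct h v := by
  refine JTilde_ext fun y => ?_
  rw [coordJ_smul_A, coordJ_grAct, coordJ_grAct, Finset.mul_sum]
  refine Finset.sum_congr rfl fun w _ => ?_
  rw [smul_mul_assoc, klCoord_smul, map_mul]
  split_ifs
  · ring
  · rw [mul_zero, mul_zero]

theorem one_grAct (v : JTilde ρ) : grAct 1 v = v := by
  refine JTilde_ext fun y => ?_
  rw [coordJ_grAct, Finset.sum_eq_single y]
  · rw [if_pos (eqvLR_refl y), one_mul, klCoord_klC, if_pos rfl, map_one, mul_one]
  · intro w _ hw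
    rw [one_mul, klCoord_klC, if_neg hw.symm, map_zero, ite_self, mul_zero]
  · simp

theorem klCoord_mul_mul (h h' : Hecke R L) (y : W) :
    klCoord R L (h * h') y = ∑ u, klCoord R L h' u * klCoord R L (h * klC R L u) y := by
  conv_lhs => rw [eq_sum_klCoord R L h']
  rw [Finset.mul_sum, klCoord_sum]
  simp only [mul_smul_comm, klCoord_smul]

theorem klCoord_mul_klC (h : Hecke R L) (u y : W) :
    klCoord R L (h * klC R L u) y = ∑ x, klCoord R L h x * hConst R L x u y := by
  conv_lhs => rw [eq_sum_klCoord R L h]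
  rw [Finset.sum_mul, klCoord_sum]
  simp only [smul_mul_assoc, klCoord_smul]
  rfl

/-- A contribution through `u` requires `y ≤ u ≤ w`. If `y` and `w` lie in one cell, so does `u`;
hence truncation to cells is compatible with composition. -/
theorem mul_grAct (hL : ∀ i : B, 0 < L (cs.simple i)) (h h' : Hecke R L) (v : JTilde ρ) :
    grAct (h * h') v = grAct h (grAct h' v) := by
  refine JTilde_ext fun y => ?_
  simp only [coordJ_grAct, Finset.sum_mul]
  rw [Finset.sum_comm]
  refine Finset.sum_congr rfl fun w _ => ?_
  rw [mul_assoc, klCoord_mul_mul, map_sum]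
  simp only [mul_assoc]
  rw [← Finset.mul_sum]
  congr 1
  rw [show ∀ (c : Prop) (f : W → KField Γ R), (if c then ∑ u, f u else 0) =
    ∑ u, if c then f u else 0 from fun c f => by split_ifs <;> simp]
  refine Finset.sum_congr rfl fun u _ => ?_
  rw [map_mul]
  by_cases h1 : klCoord R L (h' * klC R L w) u = 0
  · rw [h1, map_zero, zero_mul, ite_self, ite_self, zero_mul]
  by_cases h2 : klCoord R L (h * klC R L u) y = 0
  · rw [h2, map_zero, mul_zero, ite_self, ite_self, mul_zero]
  have h1 := leLR_of_klCoord_mul_ne_zero hL h1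
  have h2 := leLR_of_klCoord_mul_ne_zero hL h2
  by_cases h3 : eqvLR R L y w
  · rw [if_pos h3, if_pos ⟨h1, h3.2.trans h2⟩, if_pos ⟨h2, h1.trans h3.2⟩]
  · rw [if_neg h3]
    by_cases h4 : eqvLR R L u w
    · rw [if_neg fun h5 => h3 (eqvLR.trans h5 h4), mul_zero]
    · rw [if_neg h4, zero_mul]

theorem P15Tilde.hecke (hP : P15Tilde ρ) (h : Hecke R L) {x' y w : W} (hwy : eqvLR R L w y) :
    ∑ u, FtoK R (gammaT ρ w x' u⁻¹) *
        algebraMap (AddMonoidAlgebra R Γ) (KField Γ R) (klCoord R L (h * klC R L u) y) =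
      ∑ u, algebraMap (AddMonoidAlgebra R Γ) (KField Γ R) (klCoord R L (h * klC R L w) u) *
        FtoK R (gammaT ρ u x' y⁻¹) := by
  simp only [klCoord_mul_klC, map_sum, map_mul, Finset.mul_sum, Finset.sum_mul]
  rw [Finset.sum_comm]
  conv_rhs => rw [Finset.sum_comm]
  refine Finset.sum_congr rfl fun x _ => ?_
  simp only [mul_assoc, mul_left_comm (FtoK R _)]
  rw [← Finset.mul_sum, ← Finset.mul_sum, hP x x' y w hwy]

/-- On basis elements this is P̃15 with cell conditions inserted on both sides. The cell support of
`γ̃` makes those conditions automatic when `w` and `z` lie in one cell, and makes both sides zero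
otherwise. -/
theorem grAct_mul (hL : ∀ i : B, 0 < L (cs.simple i)) (hE : IsIrrFamily E)
    (hρ : ∀ l, Corresponds (E l) (ρ l)) (hb : ∀ l, IsBalanced (ρ l)) (hP : P15Tilde ρ)
    (h : Hecke R L) (v b : JTilde ρ) : grAct h (v * b) = grAct h v * b := by
  refine JTilde_ext fun z => ?_
  have key : ∀ w x', (∑ u, FtoK R (gammaT ρ w x' u⁻¹) * if eqvLR R L z u then
      algebraMap (AddMonoidAlgebra R Γ) (KField Γ R) (klCoord R L (h * klC R L u) z) else 0) =
      ∑ u, (if eqvLR R L u w then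
        algebraMap (AddMonoidAlgebra R Γ) (KField Γ R) (klCoord R L (h * klC R L w) u) else 0) *
        FtoK R (gammaT ρ u x' z⁻¹) := by
    intro w x'
    by_cases hwz : eqvLR R L w z
    · have hl : ∀ u, (FtoK R (gammaT ρ w x' u⁻¹) * if eqvLR R L z u then
          algebraMap (AddMonoidAlgebra R Γ) (KField Γ R) (klCoord R L (h * klC R L u) z) else 0) =
          FtoK R (gammaT ρ w x' u⁻¹) *
          algebraMap (AddMonoidAlgebra R Γ) (KField Γ R) (klCoord R L (h * klC R L u) z) := by
        intro u
        by_cases h0 : gammaT ρ w x' u⁻¹ = 0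
        · rw [h0, map_zero, zero_mul, zero_mul]
        · rw [if_pos (hwz.symm.trans (eqvLR_of_gammaT_ne_zero hL hE hρ hb h0).1)]
      have hr : ∀ u, (if eqvLR R L u w then
          algebraMap (AddMonoidAlgebra R Γ) (KField Γ R) (klCoord R L (h * klC R L w) u) else 0) *
          FtoK R (gammaT ρ u x' z⁻¹) =
          algebraMap (AddMonoidAlgebra R Γ) (KField Γ R) (klCoord R L (h * klC R L w) u) *
          FtoK R (gammaT ρ u x' z⁻¹) := by
        intro u
        by_cases h0 : gammaT ρ u x' z⁻¹ = 0
        · rw [h0, map_zero, mul_zero, mul_zero]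
        · rw [if_pos ((eqvLR_of_gammaT_ne_zero hL hE hρ hb h0).1.trans hwz.symm)]
      simp only [hl, hr]
      exact hP.hecke h hwz
    · rw [Finset.sum_eq_zero, Finset.sum_eq_zero]
      · intro u _
        by_cases h0 : gammaT ρ u x' z⁻¹ = 0
        · rw [h0, map_zero, mul_zero]
        · rw [if_neg fun h1 => hwz (h1.symm.trans (eqvLR_of_gammaT_ne_zero hL hE hρ hb h0).1),
            zero_mul]
      · intro u _
        by_cases h0 : gammaT ρ w x' u⁻¹ = 0
        · rw [h0, map_zero, zero_mul]
        · rw [if_neg fun h1 => hwz ((eqvLR_of_gammaT_ne_zero hL hE hρ hb h0).1.trans h1.symm),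
            mul_zero]
  have e1 : coordJ ρ z (grAct h (v * b)) = ∑ w, ∑ x', coordJ ρ w v * coordJ ρ x' b *
      ∑ u, FtoK R (gammaT ρ w x' u⁻¹) * if eqvLR R L z u then
      algebraMap (AddMonoidAlgebra R Γ) (KField Γ R) (klCoord R L (h * klC R L u) z) else 0 := by
    simp only [coordJ_grAct, coordJ_mul, Finset.sum_mul, Finset.mul_sum]
    rw [Finset.sum_comm]
    refine Finset.sum_congr rfl fun w _ => ?_
    rw [Finset.sum_comm]
    simp only [mul_assoc]
  have e2 : coordJ ρ z (grAct h v * b) = ∑ w, ∑ x', coordJ ρ w v * coordJ ρ x' b *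
      ∑ u, (if eqvLR R L u w then
        algebraMap (AddMonoidAlgebra R Γ) (KField Γ R) (klCoord R L (h * klC R L w) u) else 0) *
        FtoK R (gammaT ρ u x' z⁻¹) := by
    rw [coordJ_mul, Finset.sum_comm]
    conv_rhs => rw [Finset.sum_comm]
    refine Finset.sum_congr rfl fun x' _ => ?_
    simp only [coordJ_grAct, Finset.sum_mul, Finset.mul_sum]
    rw [Finset.sum_comm]
    exact Finset.sum_congr rfl fun w _ => Finset.sum_congr rfl fun u _ => by ring
  rw [e1, e2]
  simp only [key]

theorem coordJ_grAct_tElt (h : Hecke R L) (w z : W) : coordJ ρ z (grAct h (tElt ρ w)) =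
    if eqvLR R L z w then
      algebraMap (AddMonoidAlgebra R Γ) (KField Γ R) (klCoord R L (h * klC R L w) z) else 0 := by
  simp only [coordJ_grAct, coordJ_tElt, ite_mul, one_mul, zero_mul]
  simp

theorem coordJ_mul_tElt (a : JTilde ρ) (w z : W) : coordJ ρ z (a * tElt ρ w) =
    ∑ x, coordJ ρ x a * FtoK R (gammaT ρ x w z⁻¹) := by
  simp only [coordJ_mul, coordJ_tElt, mul_ite, ite_mul, mul_one, mul_zero, zero_mul]
  simp

theorem eq_of_forall_mul_tElt (hE : IsIrrFamily E) (hρ : ∀ l, Corresponds (E l) (ρ l))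
    (hb : ∀ l, IsBalanced (ρ l)) {a b : JTilde ρ} (h : ∀ w, a * tElt ρ w = b * tElt ρ w) :
    a = b := by
  have key : ∀ (a v : JTilde ρ) z, coordJ ρ z (a * v) =
      ∑ w, coordJ ρ w v * coordJ ρ z (a * tElt ρ w) := fun a v z => by
    rw [coordJ_mul, Finset.sum_comm]
    refine Finset.sum_congr rfl fun w _ => ?_
    rw [coordJ_mul_tElt, Finset.mul_sum]
    exact Finset.sum_congr rfl fun x _ => by ring
  rw [← mul_one_J hE hρ hb a, ← mul_one_J hE hρ hb b]
  refine JTilde_ext fun z => ?_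
  rw [key, key]
  simp only [h]

/-- Single leading coefficients are only known to lie in `F`, but their diagonal sum is, up to sign,
a coefficient of the trace of `T_w`, which belongs to `R[Γ]`. Together with invertibility of the
`f_l` in `R` this puts `ñ_w` in `R`, and so `φ` takes values in `J̃_A`. -/
theorem exists_sum_leadMat_eq {n : ℕ} {V : FDRep ℂ W} {τ : MatRep R L n} (hτ : Corresponds V τ)
    (hb : IsBalanced τ) (w : W) :
    ∃ r : R, algebraMap R (FractionRing R) r = ∑ i, leadMat τ w i i := by
  obtain ⟨a, ha, -⟩ := hτ.2 w
  refine ⟨(-1) ^ cs.length w * a.coeff (-aInv τ), iF_injective R ?_⟩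
  rw [iF_algebraMap, map_sum]
  simp only [iF_leadMat hb]
  rw [← Finset.mul_sum, ← HahnSeries.coeff_sum]
  have h : ∑ i, hahnRep τ (heckeT R L w) i i = iA R a := by
    rw [← iK_algebraMap, ha, ← trace_hahnRep]
    rfl
  rw [h, coeff_iA]
  push_cast
  rfl

theorem FtoK_nT_mem_range (hρ : ∀ l, Corresponds (E l) (ρ l)) (hb : ∀ l, IsBalanced (ρ l))
    (hR : IsLGood ρ) (w : W) :
    FtoK R (nT ρ w) ∈ (algebraMap (AddMonoidAlgebra R Γ) (KField Γ R)).range := by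
  rw [nT, map_sum]
  refine sum_mem fun l _ => ?_
  obtain ⟨u, hu⟩ := hR.2 l
  obtain ⟨r, hr⟩ := exists_sum_leadMat_eq (hρ l) (hb l) w⁻¹
  have h1 : (fInv (ρ l))⁻¹ = algebraMap R (FractionRing R) (u⁻¹ : Rˣ) := by
    refine inv_eq_of_mul_eq_one_left ?_
    rw [← hu, ← map_mul, Units.inv_mul, map_one]
  rw [← Finset.mul_sum, h1, ← hr, ← map_mul, FtoK_algebraMap]
  exact ⟨_, rfl⟩

/-- The homomorphism of Lusztig from the Hecke algebra to `J̃`. -/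
def lusztigHom (hL : ∀ i : B, 0 < L (cs.simple i)) (hE : IsIrrFamily E)
    (hρ : ∀ l, Corresponds (E l) (ρ l)) (hb : ∀ l, IsBalanced (ρ l)) (hP : P15Tilde ρ) :
    Hecke R L →ₙₐ[AddMonoidAlgebra R Γ] JTilde ρ where
  toFun h := grAct h (oneJ ρ)
  map_smul' a h := grAct_smul a h _
  map_zero' := by
    have := grAct_smul (ρ := ρ) 0 0 (oneJ ρ)
    rwa [zero_smul, zero_smul] at this
  map_add' h h' := grAct_add h h' _
  map_mul' h h' := by
    rw [← grAct_mul hL hE hρ hb hP, one_mul_J hE hρ hb, mul_grAct hL]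

theorem lusztigHom_apply (hL : ∀ i : B, 0 < L (cs.simple i)) (hE : IsIrrFamily E)
    (hρ : ∀ l, Corresponds (E l) (ρ l)) (hb : ∀ l, IsBalanced (ρ l)) (hP : P15Tilde ρ)
    (h : Hecke R L) : lusztigHom hL hE hρ hb hP h = grAct h (oneJ ρ) := rfl

theorem lusztigHom_mul_tElt (hL : ∀ i : B, 0 < L (cs.simple i)) (hE : IsIrrFamily E)
    (hρ : ∀ l, Corresponds (E l) (ρ l)) (hb : ∀ l, IsBalanced (ρ l)) (hP : P15Tilde ρ)
    (h : Hecke R L) (w : W) : lusztigHom hL hE hρ hb hP h * tElt ρ w = grAct h (tElt ρ w) := by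
  rw [lusztigHom_apply, ← grAct_mul hL hE hρ hb hP, one_mul_J hE hρ hb]

theorem grAct_tElt_sub_mem (hL : ∀ i : B, 0 < L (cs.simple i)) (h : Hecke R L) (w : W) :
    grAct h (tElt ρ w) - actT ρ h w ∈ lowerSpan ρ w := by
  have h1 : grAct h (tElt ρ w) - actT ρ h w = ∑ z, -(if eqvLR R L z w then 0 else
      klCoord R L (h * klC R L w) z • tElt ρ z) := by
    refine JTilde_ext fun y => ?_
    rw [map_sub, coordJ_grAct_tElt, coordJ_actT, map_sum, Finset.sum_eq_single y]
    · split_ifs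
      · rw [sub_self, neg_zero, map_zero]
      · rw [map_neg, coordJ_smul_A, coordJ_tElt, if_pos rfl, mul_one, zero_sub]
    · intro z _ hz
      split_ifs
      · rw [neg_zero, map_zero]
      · rw [map_neg, coordJ_smul_A, coordJ_tElt, if_neg hz.symm, mul_zero, neg_zero]
    · simp
  rw [h1]
  refine sum_mem fun z _ => neg_mem ?_
  split_ifs with hz
  · exact zero_mem _
  · by_cases h0 : klCoord R L (h * klC R L w) z = 0
    · rw [h0, zero_smul]
      exact zero_mem _
    · exact Submodule.smul_mem _ _ (Submodule.subset_span
        ⟨z, ⟨leLR_of_klCoord_mul_ne_zero hL h0, hz⟩, rfl⟩)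

theorem isLusztigHom_lusztigHom (hL : ∀ i : B, 0 < L (cs.simple i)) (hE : IsIrrFamily E)
    (hρ : ∀ l, Corresponds (E l) (ρ l)) (hb : ∀ l, IsBalanced (ρ l)) (hR : IsLGood ρ)
    (hP : P15Tilde ρ) : IsLusztigHom ρ (lusztigHom hL hE hρ hb hP) where
  map_one := by rw [lusztigHom_apply, one_grAct]
  mem_JA h := by
    refine mem_JA_of_forall fun z => ?_
    rw [lusztigHom_apply, coordJ_grAct]
    refine sum_mem fun w _ => mul_mem ?_ ?_
    · rw [coordJ_oneJ]
      exact FtoK_nT_mem_range hρ hb hR w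
    · split_ifs
      · exact ⟨_, rfl⟩
      · exact zero_mem _
  sub_mem h w := by
    rw [lusztigHom_mul_tElt]
    exact grAct_tElt_sub_mem hL h w

/-- Coordinates of `ψ(h) t_w` inside the cell of `w` are those of `h.t_w`, since the error lies
strictly below the cell; coordinates outside vanish by the cell support of `γ̃`. Thus `ψ(h)` and
`φ(h)` agree on all `t_w`, hence on `1_J`. -/
theorem IsLusztigHom.eq_lusztigHom (hL : ∀ i : B, 0 < L (cs.simple i)) (hE : IsIrrFamily E)
    (hρ : ∀ l, Corresponds (E l) (ρ l)) (hb : ∀ l, IsBalanced (ρ l)) (hP : P15Tilde ρ)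
    {ψ : Hecke R L →ₙₐ[AddMonoidAlgebra R Γ] JTilde ρ} (hψ : IsLusztigHom ρ ψ) :
    ψ = lusztigHom hL hE hρ hb hP := by
  refine NonUnitalAlgHom.ext fun h => eq_of_forall_mul_tElt hE hρ hb fun w => ?_
  rw [lusztigHom_mul_tElt]
  refine JTilde_ext fun z => ?_
  rw [coordJ_grAct_tElt]
  split_ifs with hz
  · have := coordJ_eq_zero_of_mem_lowerSpan (hψ.sub_mem h w) hz
    rwa [map_sub, sub_eq_zero, coordJ_actT] at this
  · rw [coordJ_mul_tElt]
    refine Finset.sum_eq_zero fun x _ => ?_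
    by_cases h0 : gammaT ρ x w z⁻¹ = 0
    · rw [h0, map_zero, mul_zero]
    · exact absurd (eqvLR_of_gammaT_ne_zero hL hE hρ hb h0).2.symm hz

theorem lusztigHom_klC (hL : ∀ i : B, 0 < L (cs.simple i)) (hE : IsIrrFamily E)
    (hρ : ∀ l, Corresponds (E l) (ρ l)) (hb : ∀ l, IsBalanced (ρ l)) (hP : P15Tilde ρ) (w : W) :
    lusztigHom hL hE hρ hb hP (klC R L w) =
      ∑ δ ∈ setD ρ, ∑ z : W, if eqvLR R L z δ then
        (algebraMap (AddMonoidAlgebra R Γ) (KField Γ R) (hConst R L w δ z) *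
          FtoK R (nT ρ δ)) • tElt ρ z else 0 := by
  refine JTilde_ext fun y => ?_
  rw [lusztigHom_apply, coordJ_grAct, map_sum]
  rw [← Finset.sum_subset (Finset.subset_univ (setD ρ))]
  · refine Finset.sum_congr rfl fun δ _ => ?_
    rw [map_sum, Finset.sum_eq_single y]
    · rw [coordJ_oneJ]
      split_ifs
      · rw [map_smul, coordJ_tElt, if_pos rfl, smul_eq_mul, mul_one, mul_comm]
        rfl
      · rw [mul_zero, map_zero]
    · intro z _ hz
      split_ifs
      · rw [map_smul, coordJ_tElt, if_neg hz.symm, smul_zero]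
      · rw [map_zero]
    · simp
  · intro δ _ hδ
    rw [setD, Finset.mem_filter, not_and, not_not] at hδ
    rw [coordJ_oneJ, hδ (Finset.mem_univ δ), map_zero, zero_mul]

end LusztigHomomorphism

end KLAsym

end

open KLAsym

theorem theorem5p2 {B W Γ Λ : Type*} [Group W] [Fintype W] {M : CoxeterMatrix B}
    (cs : CoxeterSystem M W)
    [AddCommGroup Γ] [LinearOrder Γ] [IsOrderedAddMonoid Γ]
    (L : WeightFunction cs Γ) (hL : ∀ i : B, 0 < L (cs.simple i))
    (R : Subring ℂ)
    [Fintype Λ] (E : Λ → FDRep ℂ W) (hE : IsIrrFamily E)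
    (d : Λ → ℕ) (ρ : ∀ l : Λ, MatRep R L (d l))
    (hρ : ∀ l : Λ, Corresponds (E l) (ρ l)) (hbal : ∀ l : Λ, IsBalanced (ρ l))
    (hR : IsLGood ρ) (hP15 : P15Tilde ρ) :
    ∃ φ : Hecke R L →ₙₐ[AddMonoidAlgebra R Γ] JTilde ρ,
      IsLusztigHom ρ φ ∧
      (∀ ψ : Hecke R L →ₙₐ[AddMonoidAlgebra R Γ] JTilde ρ, IsLusztigHom ρ ψ → ψ = φ) ∧
      ∀ w : W, φ (klC R L w) =
        ∑ δ ∈ setD ρ, ∑ z : W, open scoped Classical in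
          if eqvLR R L z δ then
            (algebraMap (AddMonoidAlgebra R Γ) (KField Γ R) (hConst R L w δ z) *
              FtoK R (nT ρ δ)) • tElt ρ z
          else 0 :=
  ⟨lusztigHom hL hE hρ hbal hP15, isLusztigHom_lusztigHom hL hE hρ hbal hR hP15,
    fun _ hψ => hψ.eq_lusztigHom hL hE hρ hbal hP15, lusztigHom_klC hL hE hρ hbal hP15⟩
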